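/- For an integer $n\ge 0$ let $X_n=\{f\in L^2(\mathbb R;\mathbb C):\ \langle x\rangle\,\partial_x^j f\in L^2(\mathbb R),\ j=0,\dots,n\}$, where $\langle x\rangle=\sqrt{1+x^2}$ and $\partial_x$ is the weak derivative, and let $\|f\|_{X_1}=\|\langle x\rangle f\|_{L^2}+\|\langle x\rangle\partial_x f\|_{L^2}$. Let $H^1$ be the space of $f\in L^2(\mathbb R)$ with weak derivative in $L^2(\mathbb R)$. Let $q\in X_1$, $\mathcal M=\begin{pmatrix}0&q\\-\bar q&0\end{pmatrix}$ and $\sigma_3=\begin{pmatrix}1&0\\0&-1\end{pmatrix}$. For $\lambda\in\mathbb R$ let $\psi_\pm(x;\lambda)=m^{(\pm)}(x;\lambda)e^{i\lambda x\sigma_3}$ be the Jost solutions of the Wadati–Konno–Ichikawa spectral problem $\psi_x=[i\lambda\sigma_3-\lambda\mathcal M]\psi$, where $m^{(\pm)}$ is the bounded solution of $$m^{(\pm)}(x;\lambda)=I-\lambda\int_{\pm\infty}^x e^{i\lambda(x-y)\sigma_3}\mathcal M(y)\,m^{(\pm)}(y;\lambda)\,e^{-i\lambda(x-y)\sigma_3}\,dy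 .$$ The scattering coefficients $a(\lambda)$ and $b(\lambda)$, $\lambda\in\mathbb R$, are the entries of the first column of the matrix $T(\lambda)$, independent of $x$, with $\psi_+=\psi_-T$, $T=\begin{pmatrix}a&d\\b&c\end{pmatrix}$. For $\operatorname{Im}\lambda>0$ the first column of the equation for $m^{(+)}$ and the second column of the equation for $m^{(-)}$ still have bounded solutions, and $a$ is extended there by $a(\lambda)=\det\big((\psi_+)_1,(\psi_-)_2\big)$, where $(\cdot)_j$ is the $j$-th column. **Theorem.** There is a constant $\delta>0$ such that for every integer $n\ge 0$ and every $q\in X_{n+1}$ with $\|q\|_{X_1}<\delta$: $a(\lambda)\neq 0$ for all $\lambda\in\mathbb C$ with $\operatorname{Im}\lambda\ge 0$, and, as functions of $\lambda\in\mathbb R$, $$\lambda^{-1}\frac{b}{a}\in H^1,\qquad \lambda^{j}\frac{b}{a}\in H^1\quad\text{for } j=0,1,\dots,n .$$ -/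

import Mathlib

open MeasureTheory

noncomputable section

namespace WKI

/-! ## Weak derivatives, the Sobolev space `H¹`, and the weighted spaces `X_n` -/

/-- `g` is the `j`-th weak derivative of `f : ℝ → ℂ`. -/
def IsWeakDeriv (j : ℕ) (f g : ℝ → ℂ) : Prop :=
  LocallyIntegrable f ∧ LocallyIntegrable g ∧
    ∀ φ : ℝ → ℝ, ContDiff ℝ (⊤ : ℕ∞) φ → HasCompactSupport φ →
      ∫ x, iteratedDeriv j φ x • f x = (-1 : ℂ) ^ j * ∫ x, φ x • g x

open Classical in
/-- The `j`-th weak derivative of `f` (unique up to null sets; `0` if there is none). -/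
def weakDeriv (j : ℕ) (f : ℝ → ℂ) : ℝ → ℂ :=
  if h : ∃ g, IsWeakDeriv j f g then h.choose else 0

/-- `H¹(ℝ)`: the functions in `L²(ℝ)` whose weak derivative exists and is in `L²(ℝ)`. -/
def MemH1 (f : ℝ → ℂ) : Prop :=
  MemLp f 2 ∧ ∃ g, IsWeakDeriv 1 f g ∧ MemLp g 2

/-- The Japanese bracket `⟨x⟩ = √(1 + x²)`. -/
def bracket (x : ℝ) : ℝ := Real.sqrt (1 + x ^ 2)

/-- `X_n`: the functions `f ∈ L²(ℝ)` with `⟨x⟩ ∂ₓʲ f ∈ L²(ℝ)` for `j = 0, …, n`. -/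
def MemX (n : ℕ) (f : ℝ → ℂ) : Prop :=
  MemLp f 2 ∧ ∀ j ≤ n, ∃ g, IsWeakDeriv j f g ∧ MemLp (fun x => bracket x • g x) 2

/-- The norm `∑_{j ≤ n} ‖⟨x⟩ ∂ₓʲ f‖_{L²}` of `X_n`. -/
def normX (n : ℕ) (f : ℝ → ℂ) : ENNReal :=
  ∑ j ∈ Finset.range (n + 1), eLpNorm (fun x => bracket x • weakDeriv j f x) 2

/-! ## The Jost solutions of `ψₓ = (iλσ₃ - λℳ) ψ` -/

/-- The potential matrix `ℳ(x)`. -/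
def potential (q : ℝ → ℂ) (x : ℝ) : Matrix (Fin 2) (Fin 2) ℂ :=
  !![0, q x; -(starRingEnd ℂ (q x)), 0]

/-- `e^{iλxσ₃}`. -/
def expSigma (l : ℂ) (x : ℝ) : Matrix (Fin 2) (Fin 2) ℂ :=
  Matrix.diagonal ![Complex.exp (Complex.I * l * x), Complex.exp (-(Complex.I * l * x))]

/-- The `j`-th column of `e^{iλ(x-y)σ₃} ℳ(y) m e^{-iλ(x-y)σ₃}`, in terms of the `j`-th
column `v` of the matrix `m`. -/
def kernelColumn (q : ℝ → ℂ) (l : ℂ) (j : Fin 2) (x y : ℝ) (v : Fin 2 → ℂ) : Fin 2 → ℂ :=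
  expSigma l (-(x - y)) j j • Matrix.mulVec (expSigma l (x - y) * potential q y) v

/-- `m` is the `j`-th column of the bounded solution `m⁽⁺⁾` of
`m(x) = I - λ ∫_{+∞}^x e^{iλ(x-y)σ₃} ℳ(y) m(y) e^{-iλ(x-y)σ₃} dy`. -/
structure IsJostPlus (q : ℝ → ℂ) (l : ℂ) (j : Fin 2) (m : ℝ → Fin 2 → ℂ) : Prop where
  continuous : Continuous m
  bounded : ∃ C : ℝ, ∀ x, ‖m x‖ ≤ C
  integrable : ∀ x, IntegrableOn (fun y => kernelColumn q l j x y (m y)) (Set.Ioi x)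
  equation : ∀ x, m x = Pi.single j 1 + l • ∫ y in Set.Ioi x, kernelColumn q l j x y (m y)

/-- `m` is the `j`-th column of the bounded solution `m⁽⁻⁾` of
`m(x) = I - λ ∫_{-∞}^x e^{iλ(x-y)σ₃} ℳ(y) m(y) e^{-iλ(x-y)σ₃} dy`. -/
structure IsJostMinus (q : ℝ → ℂ) (l : ℂ) (j : Fin 2) (m : ℝ → Fin 2 → ℂ) : Prop where
  continuous : Continuous m
  bounded : ∃ C : ℝ, ∀ x, ‖m x‖ ≤ C
  integrable : ∀ x, IntegrableOn (fun y => kernelColumn q l j x y (m y)) (Set.Iic x)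
  equation : ∀ x, m x = Pi.single j 1 - l • ∫ y in Set.Iic x, kernelColumn q l j x y (m y)

open Classical in
/-- The `j`-th column of `m⁽⁺⁾(·; λ)`. For `q ∈ X_1` it exists and is unique when `λ` is real,
and, for the first column `j = 0`, when `Im λ ≥ 0`. -/
def mPlus (q : ℝ → ℂ) (l : ℂ) (j : Fin 2) : ℝ → Fin 2 → ℂ :=
  if h : ∃ m, IsJostPlus q l j m then h.choose else 0

open Classical in
/-- The `j`-th column of `m⁽⁻⁾(·; λ)`. For `q ∈ X_1` it exists and is unique when `λ` is real,
and, for the second column `j = 1`, when `Im λ ≥ 0`. -/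
def mMinus (q : ℝ → ℂ) (l : ℂ) (j : Fin 2) : ℝ → Fin 2 → ℂ :=
  if h : ∃ m, IsJostMinus q l j m then h.choose else 0

/-- The Jost solution `ψ₊ = m⁽⁺⁾ e^{iλxσ₃}`. -/
def psiPlus (q : ℝ → ℂ) (l : ℂ) (x : ℝ) : Matrix (Fin 2) (Fin 2) ℂ :=
  Matrix.of (fun i j => mPlus q l j x i) * expSigma l x

/-- The Jost solution `ψ₋ = m⁽⁻⁾ e^{iλxσ₃}`. -/
def psiMinus (q : ℝ → ℂ) (l : ℂ) (x : ℝ) : Matrix (Fin 2) (Fin 2) ℂ :=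
  Matrix.of (fun i j => mMinus q l j x i) * expSigma l x

/-! ## The scattering coefficients -/

open Classical in
/-- For real `λ`, the matrix `T(λ)`, independent of `x`, with `ψ₊ = ψ₋ T`. -/
def scatteringMatrix (q : ℝ → ℂ) (l : ℝ) : Matrix (Fin 2) (Fin 2) ℂ :=
  if h : ∃ T : Matrix (Fin 2) (Fin 2) ℂ, ∀ x : ℝ, psiPlus q l x = psiMinus q l x * T
  then h.choose else 0

/-- The coefficient `a(λ)`, `Im λ ≥ 0`: the upper left entry of `T(λ)` for real `λ`, continued to
`Im λ > 0` as the determinant of the first column of `ψ₊` and the second column of `ψ₋` (which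
does not depend on the point `x = 0` and also equals the entry of `T` when `λ` is real). -/
def scatteringA (q : ℝ → ℂ) (l : ℂ) : ℂ :=
  if l.im = 0 then scatteringMatrix q l.re 0 0
  else Matrix.det !![psiPlus q l 0 0 0, psiMinus q l 0 0 1; psiPlus q l 0 1 0, psiMinus q l 0 1 1]

/-- The coefficient `b(λ)`, `λ` real: the lower left entry of `T(λ)`. -/
def scatteringB (q : ℝ → ℂ) (l : ℝ) : ℂ := scatteringMatrix q l 1 0

end WKI

end

/-! ### Calculus of locally absolutely continuous functions -/

namespace WKI

open Filter Topology Set ComplexConjugate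

/-! The matrix `iσ₃ - ℳ` has eigenvalues `±ip` with `p = √(1 + |q|²)`. Diagonalising it pointwise by
the matrix with columns `(E, ρE)` and `(-conj (ρE), conj E)`, and taking a phase `z` with `z' = p`,
turns the spectral problem into `α' = fβ`, `β' = -2iλpβ + gα`. The factor `E` is chosen so that the
new potential has no diagonal part. Its remaining entries do not contain `λ` and satisfy `|f|, |g| ≤
|q'|` (`exists_gauge`). So the factor `λ` in front of the potential is gone, and a small `X_1` norm
gives `∫|q'| ≤ 1/4` by Cauchy–Schwarz against `⟨x⟩⁻¹`.

Then the transformed Volterra equations are solved by contraction, with `|α - 1|, |β| ≤ 1/3` for all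
`Im λ ≥ 0` at once (`exists_isGaugeJost`). Undoing the gauge gives the first column of `m⁽⁺⁾`; the
same construction for `conj (q (-x))` gives the second column of `m⁽⁻⁾`. For `Im λ > 0`, `a` is a
nonzero multiple of `αα' - ββ'`, where now `α', β'` belong to the reflected problem, and this cannot
vanish. For real `λ`, `a = κ(1 - ∫ fβ)` and `b = -κ ∫ e^{2iλz} gα` with the same `κ ≠ 0`, so `b/a`
is a quotient whose denominator has modulus at least `1/2`.

For `H¹`: since `z' ≥ 1`, the map `h ↦ ∫ e^{2iλz} h` is bounded on `L²`
(`eLpNorm_integral_phase_le`), and the Volterra equations carry this over to amplitudes multiplied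
by `α`. Translating `λ` by `t` costs a factor `|t|` and one weight `z`, which is comparable to `x`
and paid for by the weighted spaces. Numerator and denominator are therefore Lipschitz under
translation in `L²`, and so is the quotient, which gives `H¹` (`memH1_of_shift_le`).

Powers of `λ` come from integration by parts against `e^{2iλz}` (`Gauge.mul_integral_osc`): each
factor `λ` costs one derivative of the amplitude. As `g` involves `q'`, it has `n` derivatives when
`q` has `n + 1`. Read backwards, the same identity shows that `∫ e^{2iλz} gα` is itself `λ` times
the integral with amplitude `2ipρE`, which accounts for `λ⁻¹`. -/

/-- `F` is locally absolutely continuous with almost everywhere derivative `f`. -/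
structure HasPrim (F f : ℝ → ℂ) : Prop where
  locInt : LocallyIntegrable f
  ac : ∀ a b, AbsolutelyContinuousOnInterval F a b
  deriv : ∀ᵐ x, HasDerivAt F (f x) x

theorem intervalIntegrable_of_locallyIntegrable {f : ℝ → ℂ} (hf : LocallyIntegrable f) (a b : ℝ) :
    IntervalIntegrable f volume a b :=
  intervalIntegrable_iff.mpr <|
    (hf.integrableOn_isCompact isCompact_uIcc).mono_set uIoc_subset_uIcc

/-- The sums defining absolute continuity are compared termwise. It is applied with `H` a primitive
of `‖f‖`, and to Lipschitz images of an absolutely continuous function. -/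
theorem absolutelyContinuousOnInterval_of_dist_le {X Y : Type*} [PseudoMetricSpace X]
    [PseudoMetricSpace Y] {F : ℝ → X} {H : ℝ → Y} {a b C : ℝ}
    (hH : AbsolutelyContinuousOnInterval H a b)
    (h : ∀ x ∈ uIcc a b, ∀ y ∈ uIcc a b, dist (F x) (F y) ≤ C * dist (H x) (H y)) :
    AbsolutelyContinuousOnInterval F a b := by
  unfold AbsolutelyContinuousOnInterval at hH ⊢
  refine squeeze_zero' (.of_forall fun E => Finset.sum_nonneg fun i _ => dist_nonneg) ?_
    (by simpa using hH.const_mul C)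
  rw [eventually_inf_principal]
  filter_upwards with E hE
  rw [Finset.mul_sum]
  exact Finset.sum_le_sum fun i hi => h _ (hE.1 i hi).1 _ (hE.1 i hi).2

theorem locallyIntegrable_mul_continuous {f F : ℝ → ℂ} (hf : LocallyIntegrable f)
    (hF : Continuous F) : LocallyIntegrable fun x => f x * F x := by
  rw [locallyIntegrable_iff]
  intro K hK
  exact (hf.integrableOn_isCompact hK).mul_continuousOn hF.continuousOn hK

theorem locallyIntegrable_comp_neg {f : ℝ → ℂ} (hf : LocallyIntegrable f) :
    LocallyIntegrable fun x => f (-x) := by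
  intro x
  obtain ⟨s, hs, h⟩ := hf (-x)
  refine ⟨Neg.neg ⁻¹' s, continuous_neg.continuousAt.preimage_mem_nhds hs, ?_⟩
  exact ((Measure.measurePreserving_neg volume).integrableOn_comp_preimage
    (Homeomorph.neg ℝ).measurableEmbedding).2 h

namespace HasPrim

variable {F G f g : ℝ → ℂ}

theorem continuous (h : HasPrim F f) : Continuous F := by
  rw [continuous_iff_continuousAt]
  intro x
  have := (h.ac (x - 1) (x + 1)).continuousOn
  rw [uIcc_of_le (by linarith)] at this
  exact this.continuousAt (Icc_mem_nhds (by linarith) (by linarith))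

theorem of_locallyIntegrable (hf : LocallyIntegrable f) (c : ℝ) :
    HasPrim (fun x => ∫ t in c..x, f t) f := by
  have hi := intervalIntegrable_of_locallyIntegrable hf
  refine ⟨hf, fun a b => ?_, ?_⟩
  · have h1 : IntervalIntegrable (fun x => ‖f x‖) volume a b := (hi a b).norm
    refine absolutelyContinuousOnInterval_of_dist_le (C := 1)
      (h1.absolutelyContinuousOnInterval_intervalIntegral (c := a) (by simp)) ?_
    intro x _ y _
    rw [dist_comm, dist_comm (∫ v in a..x, ‖f v‖), dist_eq_norm, Real.dist_eq,
      intervalIntegral.integral_interval_sub_left (hi _ _) (hi _ _),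
      intervalIntegral.integral_interval_sub_left (hi _ _).norm (hi _ _).norm, one_mul]
    exact intervalIntegral.norm_integral_le_abs_integral_norm
  · filter_upwards [_root_.LocallyIntegrable.ae_hasDerivAt_integral hf] with x hx using hx c

theorem neg (h : HasPrim F f) : HasPrim (fun x => -F x) (fun x => -f x) :=
  ⟨h.locInt.neg, fun a b => (h.ac a b).neg, h.deriv.mono fun _ hx => hx.neg⟩

theorem add (h : HasPrim F f) (h' : HasPrim G g) :
    HasPrim (fun x => F x + G x) (fun x => f x + g x) :=
  ⟨h.locInt.add h'.locInt, fun a b => (h.ac a b).add (h'.ac a b), by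
    filter_upwards [h.deriv, h'.deriv] with x hx hx' using hx.add hx'⟩

theorem sub (h : HasPrim F f) (h' : HasPrim G g) :
    HasPrim (fun x => F x - G x) (fun x => f x - g x) := by
  simpa only [sub_eq_add_neg] using h.add h'.neg

theorem const (c : ℂ) : HasPrim (fun _ => c) (fun _ => 0) :=
  ⟨by simpa using (locallyIntegrable_const (0 : ℂ)),
    fun a b => (LipschitzOnWith.of_dist_le_mul (K := 0)
      (by simp)).absolutelyContinuousOnInterval,
    .of_forall fun x => hasDerivAt_const x c⟩

theorem mul (h : HasPrim F f) (h' : HasPrim G g) :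
    HasPrim (fun x => F x * G x) (fun x => f x * G x + F x * g x) := by
  refine ⟨?_, fun a b => (h.ac a b).smul (h'.ac a b), ?_⟩
  · refine LocallyIntegrable.add ?_ ?_
    · exact locallyIntegrable_mul_continuous h.locInt h'.continuous
    · simpa only [mul_comm] using locallyIntegrable_mul_continuous h'.locInt h.continuous
  · filter_upwards [h.deriv, h'.deriv] with x hx hx' using hx.mul hx'

theorem congr (h : HasPrim F f) (hg : f =ᵐ[volume] g) : HasPrim F g :=
  ⟨h.locInt.congr hg, h.ac, by
    filter_upwards [h.deriv, hg] with x hx hx'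
    rwa [← hx']⟩

theorem congr' (h : HasPrim F f) (hg : ∀ x, f x = g x) : HasPrim F g :=
  h.congr (.of_forall hg)

theorem congr_left (h : HasPrim F f) (hF : ∀ x, F x = G x) : HasPrim G f := by
  rwa [← funext hF]

theorem const_mul (c : ℂ) (h : HasPrim F f) : HasPrim (fun x => c * F x) (fun x => c * f x) :=
  ((const c).mul h).congr' fun x => by ring

/-- The fundamental theorem of calculus. -/
theorem integral_eq (h : HasPrim F f) (a b : ℝ) : ∫ x in a..b, f x = F b - F a := by
  -- The difference is absolutely continuous with derivative zero almost everywhere, hence constant.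
  have h1 := (of_locallyIntegrable h.locInt a).sub h
  obtain ⟨C, hC⟩ := (h1.ac a b).const_of_ae_hasDerivAt_zero (by
    filter_upwards [h1.deriv] with x hx _
    simpa using hx)
  have ha := hC a (by simp)
  have hb := hC b (by simp)
  simp only [intervalIntegral.integral_same] at ha
  rw [← ha] at hb
  linear_combination hb

theorem ae_unique (h : HasPrim F f) (h' : HasPrim F g) : f =ᵐ[volume] g := by
  filter_upwards [h.deriv, h'.deriv] with x hx hx' using hx.unique hx'

theorem of_integral_eq (hf : LocallyIntegrable f) (c : ℝ)
    (h : ∀ x, F x = F c + ∫ t in c..x, f t) : HasPrim F f := by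
  have := ((const (F c)).add (of_locallyIntegrable hf c)).congr' (g := f) (by simp)
  rwa [← funext h] at this

theorem conjugate (h : HasPrim F f) : HasPrim (fun x => conj (F x)) (fun x => conj (f x)) := by
  refine ⟨?_, fun a b => absolutelyContinuousOnInterval_of_dist_le (C := 1) (h.ac a b) ?_, ?_⟩
  · rw [locallyIntegrable_iff]
    intro K hK
    exact (Complex.conjCLE.toContinuousLinearMap).integrable_comp (h.locInt.integrableOn_isCompact hK)
  · intro x _ y _
    rw [one_mul, dist_eq_norm, dist_eq_norm, ← map_sub, RCLike.norm_conj]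
  · filter_upwards [h.deriv] with x hx
    exact (Complex.conjCLE.toContinuousLinearMap.hasFDerivAt).comp_hasDerivAt x hx

theorem comp_neg (h : HasPrim F f) : HasPrim (fun x => F (-x)) (fun x => -f (-x)) := by
  have hl : LocallyIntegrable fun x => -f (-x) := (locallyIntegrable_comp_neg h.locInt).neg
  refine of_integral_eq hl 0 fun x => ?_
  rw [intervalIntegral.integral_neg, intervalIntegral.integral_comp_neg, h.integral_eq]
  simp

/-- Composition with a continuously differentiable function. -/
theorem comp_contDiff (h : HasPrim F f) {φ : ℂ → ℂ} (hφ : ContDiff ℝ 1 φ) :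
    HasPrim (fun x => φ (F x)) (fun x => fderiv ℝ φ (F x) (f x)) := by
  refine ⟨?_, fun a b => ?_, ?_⟩
  · have hc : Continuous fun x => fderiv ℝ φ (F x) :=
      (hφ.continuous_fderiv one_ne_zero).comp h.continuous
    refine (locallyIntegrable_mul_continuous h.locInt (F := fun x => (‖fderiv ℝ φ (F x)‖ : ℂ))
      (by fun_prop)).mono ?_ (.of_forall fun x => ?_)
    · exact (ContinuousLinearMap.aestronglyMeasurable_comp₂ (ContinuousLinearMap.apply ℝ ℂ).flip
        hc.aestronglyMeasurable h.locInt.aestronglyMeasurable)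
    · rw [norm_mul, Complex.norm_real, norm_norm, mul_comm]
      exact ContinuousLinearMap.le_opNorm _ _
  · obtain ⟨C, hC⟩ := (h.ac a b).exists_bound
    -- A `C¹` map is Lipschitz on a closed ball containing the values of `F` on the interval.
    obtain ⟨K, hK⟩ := (hφ.contDiffOn (s := Metric.closedBall 0 C)).exists_lipschitzOnWith
      (by decide) (convex_closedBall _ _) (isCompact_closedBall _ _)
    refine absolutelyContinuousOnInterval_of_dist_le (C := K) (h.ac a b) fun x hx y hy => ?_
    exact hK.dist_le_mul _ (by simpa using hC x hx) _ (by simpa using hC y hy)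
  · filter_upwards [h.deriv] with x hx
    exact ((hφ.differentiable one_ne_zero).differentiableAt.hasFDerivAt).comp_hasDerivAt x hx

/-- The chain rule for real-differentiable maps gives a Fréchet derivative; almost everywhere
uniqueness of derivatives replaces it by the product. -/
theorem cexp (h : HasPrim F f) :
    HasPrim (fun x => Complex.exp (F x)) (fun x => f x * Complex.exp (F x)) := by
  refine (h.comp_contDiff (φ := Complex.exp) Complex.contDiff_exp).congr ?_
  filter_upwards [h.deriv, (h.comp_contDiff (φ := Complex.exp) Complex.contDiff_exp).deriv]
    with x hx hx'
  rw [hx'.unique hx.cexp, mul_comm]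

theorem of_continuous_deriv (hf : Continuous f) (h : ∀ x, HasDerivAt F (f x) x) : HasPrim F f :=
  of_integral_eq hf.locallyIntegrable 0 fun x => by
    rw [intervalIntegral.integral_eq_sub_of_hasDerivAt (fun y _ => h y)
      (hf.intervalIntegrable _ _)]
    ring

end HasPrim

end WKI

namespace WKI

open Filter Topology Set ComplexConjugate

/-! ### Integrals over half lines -/

namespace HasPrim

variable {F G f g : ℝ → ℂ}

theorem integral_Ioi (h : HasPrim F f) {a : ℝ} (hf : IntegrableOn f (Ioi a)) {L : ℂ}
    (hL : Tendsto F atTop (𝓝 L)) : ∫ x in Ioi a, f x = L - F a := by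
  refine tendsto_nhds_unique (intervalIntegral_tendsto_integral_Ioi a hf tendsto_id) ?_
  simp only [h.integral_eq]
  exact hL.sub_const _

theorem integral_Iic (h : HasPrim F f) {a : ℝ} (hf : IntegrableOn f (Iic a)) {L : ℂ}
    (hL : Tendsto F atBot (𝓝 L)) : ∫ x in Iic a, f x = F a - L := by
  refine tendsto_nhds_unique (intervalIntegral_tendsto_integral_Iic a hf tendsto_id) ?_
  simp only [h.integral_eq]
  exact hL.const_sub _

theorem tendsto_atTop (h : HasPrim F f) (hf : Integrable f) :
    Tendsto F atTop (𝓝 (F 0 + ∫ x in Ioi 0, f x)) := by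
  have := intervalIntegral_tendsto_integral_Ioi 0 hf.integrableOn tendsto_id
  simpa [h.integral_eq] using this.const_add (F 0)

theorem tendsto_atBot (h : HasPrim F f) (hf : Integrable f) :
    Tendsto F atBot (𝓝 (F 0 - ∫ x in Iic 0, f x)) := by
  have := intervalIntegral_tendsto_integral_Iic 0 hf.integrableOn tendsto_id
  simpa [h.integral_eq] using this.const_sub (F 0)

theorem integral_eq_sub (h : HasPrim F f) (hf : Integrable f) {L M : ℂ}
    (hL : Tendsto F atTop (𝓝 L)) (hM : Tendsto F atBot (𝓝 M)) : ∫ x, f x = L - M := by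
  have h1 := h.integral_Ioi (a := 0) hf.integrableOn hL
  have h2 := h.integral_Iic (a := 0) hf.integrableOn hM
  rw [← intervalIntegral.integral_Iic_add_Ioi (b := 0) hf.integrableOn hf.integrableOn, h1, h2]
  ring

/-- Integrability is only asked near `+∞`: it will be applied to `e^{2iλz} gα`, whose exponential
grows at `-∞` when `Im λ > 0`. -/
theorem of_integral_Ioi' (hf : LocallyIntegrable f) (hi : ∀ a, IntegrableOn f (Ioi a)) :
    HasPrim (fun x => ∫ y in Ioi x, f y) (fun x => -f x) := by
  refine of_integral_eq hf.neg 0 fun x => ?_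
  rw [← intervalIntegral.integral_interval_add_Ioi (a := x) (b := 0) (hi x) (hi 0),
    intervalIntegral.integral_neg, intervalIntegral.integral_symm]
  ring

theorem of_integral_Ioi (hf : Integrable f) :
    HasPrim (fun x => ∫ y in Ioi x, f y) (fun x => -f x) :=
  of_integral_Ioi' hf.locallyIntegrable fun _ => hf.integrableOn

theorem of_integral_Iic (hf : Integrable f) : HasPrim (fun x => ∫ y in Iic x, f y) f := by
  refine of_integral_eq hf.locallyIntegrable 0 fun x => ?_
  have := intervalIntegral.integral_Iic_sub_Iic (a := 0) (b := x) hf.integrableOn hf.integrableOn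
  rw [← this]
  ring

end HasPrim

theorem tendsto_integral_Ioi_atTop {f : ℝ → ℂ} (hf : Integrable f) :
    Tendsto (fun x => ∫ y in Ioi x, f y) atTop (𝓝 0) := by
  have := (HasPrim.of_integral_Ioi hf).tendsto_atTop hf.neg
  simpa [integral_neg] using this

theorem tendsto_integral_Iic_atBot {f : ℝ → ℂ} (hf : Integrable f) :
    Tendsto (fun x => ∫ y in Iic x, f y) atBot (𝓝 0) := by
  have := (HasPrim.of_integral_Iic hf).tendsto_atBot hf
  simpa using this

theorem tendsto_integral_Ioi_atBot {f : ℝ → ℂ} (hf : Integrable f) :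
    Tendsto (fun x => ∫ y in Ioi x, f y) atBot (𝓝 (∫ y, f y)) := by
  have := (HasPrim.of_integral_Ioi hf).tendsto_atBot hf.neg
  rwa [integral_neg, sub_neg_eq_add, add_comm,
    intervalIntegral.integral_Iic_add_Ioi (b := 0) hf.integrableOn hf.integrableOn] at this

theorem tendsto_integral_Iic_atTop {f : ℝ → ℂ} (hf : Integrable f) :
    Tendsto (fun x => ∫ y in Iic x, f y) atTop (𝓝 (∫ y, f y)) := by
  have := (HasPrim.of_integral_Iic hf).tendsto_atTop hf
  rwa [intervalIntegral.integral_Iic_add_Ioi (b := 0) hf.integrableOn hf.integrableOn] at this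

/-! ### Weighted spaces -/

theorem bracket_pos (x : ℝ) : 0 < bracket x := Real.sqrt_pos.2 (by positivity)

theorem one_le_bracket (x : ℝ) : 1 ≤ bracket x :=
  Real.one_le_sqrt.2 (by nlinarith [sq_nonneg x])

theorem abs_le_bracket (x : ℝ) : |x| ≤ bracket x := Real.abs_le_sqrt (by linarith)

theorem continuous_bracket : Continuous bracket := by unfold bracket; fun_prop

theorem memLp_inv_bracket : MemLp (fun x => (bracket x)⁻¹) 2 := by
  have hc : Continuous fun x => (bracket x)⁻¹ :=
    continuous_bracket.inv₀ fun x => (bracket_pos x).ne'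
  refine (memLp_two_iff_integrable_sq hc.aestronglyMeasurable).2 ?_
  refine integrable_inv_one_add_sq.congr (.of_forall fun x => ?_)
  simp only [bracket, inv_pow]
  rw [Real.sq_sqrt (by positivity)]

/-- The functions with `k` (strong) derivatives in the weighted space `⟨x⟩⁻¹ L²`. -/
def MemW : ℕ → (ℝ → ℂ) → Prop
  | 0, f => MemLp (fun x => bracket x • f x) 2
  | k + 1, f => MemLp (fun x => bracket x • f x) 2 ∧ ∃ f', HasPrim f f' ∧ MemW k f'

/-- The bounded functions `c` which, for `k ≠ 0`, have a derivative in `MemW (k - 1)`. -/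
def MemB : ℕ → (ℝ → ℂ) → Prop
  | 0, c => (∃ C : ℝ, ∀ x, ‖c x‖ ≤ C) ∧ AEStronglyMeasurable c
  | k + 1, c => (∃ C : ℝ, ∀ x, ‖c x‖ ≤ C) ∧ ∃ c', HasPrim c c' ∧ MemW k c'

variable {k : ℕ} {f g c d : ℝ → ℂ}

theorem MemW.memLp_bracket (h : MemW k f) : MemLp (fun x => bracket x • f x) 2 := by
  cases k with
  | zero => exact h
  | succ k => exact h.1

theorem MemW.congr_fun (h : MemW k f) (he : ∀ x, f x = g x) : MemW k g := by
  rwa [← funext he]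

theorem MemB.congr_fun (h : MemB k f) (he : ∀ x, f x = g x) : MemB k g := by
  rwa [← funext he]

theorem MemW.memW_zero (h : MemW k f) : MemW 0 f := h.memLp_bracket

theorem eq_inv_bracket_smul (f : ℝ → ℂ) :
    f = fun x => (bracket x)⁻¹ • (bracket x • f x) := by
  funext x
  rw [smul_smul, inv_mul_cancel₀ (bracket_pos x).ne', one_smul]

theorem MemW.integrable (h : MemW k f) : Integrable f := by
  have h1 : MemLp (fun x => (bracket x)⁻¹ • (bracket x • f x)) 1 :=
    MemLp.smul (p := 2) (q := 2) h.memLp_bracket memLp_inv_bracket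
  rw [← eq_inv_bracket_smul f] at h1
  exact memLp_one_iff_integrable.1 h1

/-- Cauchy–Schwarz for `f = ⟨x⟩⁻¹ · ⟨x⟩f`. The constant `‖⟨x⟩⁻¹‖` determines the final `δ`. -/
theorem lintegral_enorm_le_eLpNorm_bracket (h : MemLp (fun x => bracket x • f x) 2 volume) :
    ∫⁻ x, ‖f x‖ₑ ≤ eLpNorm (fun x => (bracket x)⁻¹) 2 * eLpNorm (fun x => bracket x • f x) 2 := by
  have h1 := eLpNorm_smul_le_mul_eLpNorm (p := 2) (q := 2) (r := 1) h.1 memLp_inv_bracket.1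
  rwa [show ((fun x => (bracket x)⁻¹) • fun x => bracket x • f x) = f from
    (eq_inv_bracket_smul f).symm, eLpNorm_one_eq_lintegral_enorm] at h1

theorem MemW.memLp_mul (h : MemW k f) : MemLp (fun x : ℝ => (x : ℂ) * f x) 2 := by
  refine h.memLp_bracket.mono ?_ (.of_forall fun x => ?_)
  · exact AEStronglyMeasurable.mul (f := fun x : ℝ => (x : ℂ))
      Complex.continuous_ofReal.aestronglyMeasurable h.integrable.1
  · rw [norm_mul, norm_smul, Complex.norm_real, Real.norm_eq_abs, Real.norm_eq_abs,
      abs_of_pos (bracket_pos x)]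
    exact mul_le_mul_of_nonneg_right (abs_le_bracket x) (norm_nonneg _)

theorem MemW.memLp (h : MemW k f) : MemLp f 2 := by
  refine h.memLp_bracket.mono h.integrable.1 (.of_forall fun x => ?_)
  rw [norm_smul, Real.norm_eq_abs, abs_of_pos (bracket_pos x)]
  exact le_mul_of_one_le_left (norm_nonneg _) (one_le_bracket x)

theorem MemW.of_succ : ∀ {k f}, MemW (k + 1) f → MemW k f
  | 0, _, h => h.1
  | _ + 1, _, ⟨h, f', hf, h'⟩ => ⟨h, f', hf, h'.of_succ⟩

theorem MemW.mono {j : ℕ} (hj : j ≤ k) (h : MemW k f) : MemW j f :=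
  Nat.decreasingInduction (fun _ _ h => h.of_succ) h hj

theorem MemB.bounded (h : MemB k c) : ∃ C : ℝ, ∀ x, ‖c x‖ ≤ C := by
  cases k <;> exact h.1

theorem MemB.aestronglyMeasurable (h : MemB k c) : AEStronglyMeasurable c := by
  cases k with
  | zero => exact h.2
  | succ k =>
    obtain ⟨_, _, h, _⟩ := h
    exact h.continuous.aestronglyMeasurable

theorem MemB.of_succ : ∀ {k c}, MemB (k + 1) c → MemB k c
  | 0, _, h => ⟨h.1, h.aestronglyMeasurable⟩
  | _ + 1, _, ⟨h, f', hf, h'⟩ => ⟨h, f', hf, h'.of_succ⟩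

theorem MemB.mono {j : ℕ} (hj : j ≤ k) (h : MemB k f) : MemB j f :=
  Nat.decreasingInduction (fun _ _ h => h.of_succ) h hj

theorem HasPrim.bounded (h : HasPrim f g) (hg : Integrable g) : ∃ C : ℝ, ∀ x, ‖f x‖ ≤ C := by
  refine ⟨‖f 0‖ + ∫ x, ‖g x‖, fun x => ?_⟩
  have : f x = f 0 + ∫ t in (0 : ℝ)..x, g t := by rw [h.integral_eq]; ring
  rw [this]
  refine (norm_add_le _ _).trans (add_le_add le_rfl ?_)
  refine intervalIntegral.norm_integral_le_integral_norm_uIoc.trans ?_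
  exact setIntegral_le_integral hg.norm (.of_forall fun _ => norm_nonneg _)

theorem MemW.memB (h : MemW (k + 1) f) : MemB (k + 1) f := by
  obtain ⟨_, f', hf, h'⟩ := h
  exact ⟨hf.bounded h'.integrable, f', hf, h'⟩

theorem MemW.add : ∀ {k f g}, MemW k f → MemW k g → MemW k fun x => f x + g x
  | 0, _, _, h, h' => by
    have h2 := MemLp.add (p := 2) h h'
    rw [MemW]
    simp only [smul_add]
    exact h2
  | _ + 1, _, _, ⟨h, f', hf, hf'⟩, ⟨h', g', hg, hg'⟩ =>
    ⟨MemW.add (k := 0) h h', _, hf.add hg, hf'.add hg'⟩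

theorem MemW.zero : ∀ {k}, MemW k fun _ => 0
  | 0 => by simp [MemW]
  | _ + 1 => ⟨by simp, _, .const 0, MemW.zero⟩

theorem MemB.const (a : ℂ) : ∀ {k}, MemB k fun _ => a
  | 0 => ⟨⟨_, fun _ => le_rfl⟩, aestronglyMeasurable_const⟩
  | _ + 1 => ⟨⟨_, fun _ => le_rfl⟩, _, .const a, MemW.zero⟩

theorem MemB.add (h : MemB k c) (h' : MemB k d) : MemB k fun x => c x + d x := by
  obtain ⟨C, hC⟩ := h.bounded
  obtain ⟨C', hC'⟩ := h'.bounded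
  have hb : ∃ C : ℝ, ∀ x, ‖c x + d x‖ ≤ C :=
    ⟨C + C', fun x => (norm_add_le _ _).trans (add_le_add (hC x) (hC' x))⟩
  cases k with
  | zero => exact ⟨hb, h.2.add h'.2⟩
  | succ k =>
    obtain ⟨_, f', hf, hf'⟩ := h
    obtain ⟨_, g', hg, hg'⟩ := h'
    exact ⟨hb, _, hf.add hg, hf'.add hg'⟩

/-- Induction through the Leibniz rule. In the term `c' f` the roles are exchanged: `c'` is in the
weighted class and `f`, being bounded, serves as the coefficient. -/
theorem MemB.mul_memW : ∀ {k c f}, MemB k c → MemW k f → MemW k fun x => c x * f x := by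
  have h0 : ∀ {c f : ℝ → ℂ}, (∃ C : ℝ, ∀ x, ‖c x‖ ≤ C) → AEStronglyMeasurable c → MemW 0 f →
      MemW 0 fun x => c x * f x := by
    rintro c f ⟨C, hC⟩ hm hf
    refine (MemLp.of_le_mul (c := C) hf.memLp_bracket ?_ (.of_forall fun x => ?_))
    · exact continuous_bracket.aestronglyMeasurable.smul (hm.mul hf.integrable.1)
    · rw [norm_smul, norm_smul, norm_mul, mul_left_comm]
      gcongr
      exact hC x
  intro k
  induction k with
  | zero => exact fun h hf => h0 h.1 h.2 hf
  | succ k ih =>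
    intro c f h hf
    refine ⟨h0 h.bounded h.aestronglyMeasurable hf.memW_zero, ?_⟩
    have hB := hf.memB.of_succ
    have hc := h.of_succ
    obtain ⟨_, c', hc1, hc'⟩ := h
    obtain ⟨_, f', hf1, hf'⟩ := hf
    refine ⟨_, hc1.mul hf1, MemW.add ?_ (ih hc hf')⟩
    simpa only [mul_comm] using ih hB hc'

theorem MemB.mul (h : MemB k c) (h' : MemB k d) : MemB k fun x => c x * d x := by
  obtain ⟨C, hC⟩ := h.bounded
  obtain ⟨C', hC'⟩ := h'.bounded
  have hb : ∃ C : ℝ, ∀ x, ‖c x * d x‖ ≤ C :=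
    ⟨C * C', fun x => (norm_mul_le _ _).trans (mul_le_mul (hC x) (hC' x) (norm_nonneg _)
      ((norm_nonneg _).trans (hC x)))⟩
  cases k with
  | zero => exact ⟨hb, h.2.mul h'.2⟩
  | succ k =>
    have hc := h.of_succ
    have hd := h'.of_succ
    obtain ⟨_, f', hf, hf'⟩ := h
    obtain ⟨_, g', hg, hg'⟩ := h'
    refine ⟨hb, _, hf.mul hg, MemW.add ?_ (hc.mul_memW hg')⟩
    simpa only [mul_comm] using hd.mul_memW hf'

theorem MemW.mul (h : MemW (k + 1) f) (h' : MemW k g) : MemW k fun x => f x * g x :=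
  h.memB.of_succ.mul_memW h'

theorem MemW.const_mul (a : ℂ) (h : MemW k f) : MemW k fun x => a * f x :=
  (MemB.const a).mul_memW h

theorem MemW.conjugate : ∀ {k f}, MemW k f → MemW k fun x => conj (f x) := by
  have h0 : ∀ {f}, MemW 0 f → MemW 0 fun x => conj (f x) := fun {f} h => by
    refine (MemLp.congr_norm h ?_ (.of_forall fun x => by simp))
    exact continuous_bracket.aestronglyMeasurable.smul
      (Complex.continuous_conj.comp_aestronglyMeasurable h.integrable.1)
  intro k
  induction k with
  | zero => exact h0
  | succ k ih =>
    rintro f ⟨h, f', hf, h'⟩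
    exact ⟨h0 h, _, hf.conjugate, ih h'⟩

theorem MemB.conjugate (h : MemB k c) : MemB k fun x => conj (c x) := by
  obtain ⟨C, hC⟩ := h.bounded
  have hb : ∃ C : ℝ, ∀ x, ‖conj (c x)‖ ≤ C := ⟨C, fun x => by simpa using hC x⟩
  cases k with
  | zero => exact ⟨hb, Complex.continuous_conj.comp_aestronglyMeasurable h.2⟩
  | succ k =>
    obtain ⟨_, f', hf, hf'⟩ := h
    exact ⟨hb, _, hf.conjugate, hf'.conjugate⟩

/-- Regularity of the solution of a differential equation. -/
theorem MemB.of_hasPrim {n : ℕ} (hc : ∃ C : ℝ, ∀ x, ‖c x‖ ≤ C) (h : HasPrim c d)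
    (H : ∀ k ≤ n, MemB k c → MemW k d) : MemB (n + 1) c := by
  -- Bootstrap: regularity of `c` at one level gives that of its derivative `d`, which is regularity
  -- of `c` at the next level.
  have : ∀ k ≤ n + 1, MemB k c := by
    intro k
    induction k with
    | zero => exact fun _ => ⟨hc, h.continuous.aestronglyMeasurable⟩
    | succ k ih => exact fun hk => ⟨hc, d, h, H k (by omega) (ih (by omega))⟩
  exact this _ le_rfl

/-- Limits exist because the derivative is integrable; they vanish because `f` is integrable and
half lines have infinite measure. -/
theorem MemW.tendsto_zero (h : MemW (k + 1) f) :
    Tendsto f atTop (𝓝 0) ∧ Tendsto f atBot (𝓝 0) := by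
  have hi := h.integrable
  obtain ⟨_, f', hf, h'⟩ := h
  have h1 := hf.tendsto_atTop h'.integrable
  have h2 := hf.tendsto_atBot h'.integrable
  have e1 := IntegrableAtFilter.eq_zero_of_tendsto (l := atTop) ⟨univ, univ_mem, by simpa using hi⟩
    (fun s hs => ?_) h1
  have e2 := IntegrableAtFilter.eq_zero_of_tendsto (l := atBot) ⟨univ, univ_mem, by simpa using hi⟩
    (fun s hs => ?_) h2
  · rw [e1] at h1
    rw [e2] at h2
    exact ⟨h1, h2⟩
  · obtain ⟨b, hb⟩ := mem_atBot_sets.1 hs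
    exact top_unique ((Real.volume_Iic (a := b)).symm.le.trans (measure_mono fun x hx => hb x hx))
  · obtain ⟨b, hb⟩ := mem_atTop_sets.1 hs
    exact top_unique ((Real.volume_Ici (a := b)).symm.le.trans (measure_mono fun x hx => hb x hx))

end WKI

namespace WKI

open Filter Topology Set ComplexConjugate

/-! ### Weak derivatives and absolute continuity -/

theorem HasPrim.integral_eq_zero_of_compactSupport {F f : ℝ → ℂ} (h : HasPrim F f) {R : ℝ}
    (hF : ∀ x, R ≤ |x| → F x = 0) (hf : ∀ x, R ≤ |x| → f x = 0) (hR : 0 ≤ R) : ∫ x, f x = 0 := by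
  have h1 : ∫ x, f x = ∫ x in (-R)..R, f x := by
    rw [intervalIntegral.integral_eq_integral_of_support_subset]
    intro x hx
    have hx' : |x| < R := not_le.1 fun hx' => hx (hf x hx')
    exact ⟨(abs_lt.1 hx').1, (abs_lt.1 hx').2.le⟩
  rw [h1, h.integral_eq, hF R (by simp [abs_of_nonneg hR]),
    hF (-R) (by simp [abs_of_nonneg hR]), sub_zero]

theorem HasCompactSupport.exists_abs_bound {φ : ℝ → ℝ} (h : HasCompactSupport φ) :
    ∃ R : ℝ, 0 ≤ R ∧ ∀ x, R ≤ |x| → φ x = 0 ∧ deriv φ x = 0 := by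
  obtain ⟨R, hR⟩ := (h.isCompact.isBounded.union h.deriv.isCompact.isBounded).subset_closedBall 0
  refine ⟨|R| + 1, by positivity, fun x hx => ?_⟩
  have hx' : x ∉ tsupport φ ∪ tsupport (deriv φ) := by
    intro hm
    have := hR hm
    rw [Metric.mem_closedBall, dist_zero_right, Real.norm_eq_abs] at this
    linarith [le_abs_self R]
  rw [mem_union, not_or] at hx'
  exact ⟨image_eq_zero_of_notMem_tsupport hx'.1, image_eq_zero_of_notMem_tsupport hx'.2⟩

theorem hasPrim_ofReal {φ : ℝ → ℝ} (hφ : ContDiff ℝ 1 φ) :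
    HasPrim (fun x => (φ x : ℂ)) (fun x => ((deriv φ x : ℝ) : ℂ)) :=
  .of_continuous_deriv (Complex.continuous_ofReal.comp (hφ.continuous_deriv le_rfl)) fun _ =>
    ((hφ.differentiable one_ne_zero).differentiableAt.hasDerivAt).ofReal_comp

theorem integrable_test_smul {φ : ℝ → ℝ} (hφ : Continuous φ) (hc : HasCompactSupport φ)
    {f : ℝ → ℂ} (hf : LocallyIntegrable f) : Integrable fun x => φ x • f x :=
  hf.integrable_smul_left_of_hasCompactSupport hφ hc

theorem HasPrim.isWeakDeriv {F f : ℝ → ℂ} (h : HasPrim F f) : IsWeakDeriv 1 F f := by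
  refine ⟨h.continuous.locallyIntegrable, h.locInt, fun φ hφ hc => ?_⟩
  have hφ1 : ContDiff ℝ 1 φ := hφ.of_le (by exact_mod_cast le_top)
  obtain ⟨R, hR, hz⟩ := HasCompactSupport.exists_abs_bound hc
  have := ((hasPrim_ofReal hφ1).mul h).integral_eq_zero_of_compactSupport (R := R)
    (fun x hx => by simp [(hz x hx).1]) (fun x hx => by simp [(hz x hx).1, (hz x hx).2]) hR
  have i1 := integrable_test_smul (hφ1.continuous_deriv le_rfl) hc.deriv h.continuous.locallyIntegrable
  have i2 := integrable_test_smul hφ.continuous hc h.locInt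
  simp only [Complex.real_smul] at i1 i2
  rw [integral_add i1 i2] at this
  simp only [iteratedDeriv_one, Complex.real_smul]
  linear_combination this

/-- A locally integrable function with vanishing weak derivative is constant. -/
theorem ae_eq_const_of_weakDeriv_zero {d : ℝ → ℂ} (hd : LocallyIntegrable d)
    (h : ∀ φ : ℝ → ℝ, ContDiff ℝ (⊤ : ℕ∞) φ → HasCompactSupport φ → ∫ x, deriv φ x • d x = 0) :
    ∃ c : ℂ, d =ᵐ[volume] fun _ => c := by
  obtain ⟨η, hη, hηc, hη1⟩ : ∃ η : ℝ → ℝ, ContDiff ℝ (⊤ : ℕ∞) η ∧ HasCompactSupport η ∧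
      ∫ x, η x = 1 := by
    let b : ContDiffBump (0 : ℝ) := ⟨1, 2, one_pos, one_lt_two⟩
    exact ⟨b.normed (volume : Measure ℝ), b.contDiff_normed, b.hasCompactSupport_normed,
      b.integral_normed⟩
  refine ⟨∫ x, η x • d x, ae_eq_of_integral_contDiff_smul_eq hd (locallyIntegrable_const _) ?_⟩
  intro φ hφ hφc
  set m := ∫ x, φ x with hm
  have iφ := hφ.continuous.integrable_of_hasCompactSupport (μ := volume) hφc
  have iη := hη.continuous.integrable_of_hasCompactSupport (μ := volume) hηc
  -- Subtracting `m η` makes the mean zero, so the primitive of `θ` from `-∞` has compact support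
  -- and is an admissible test function.
  set θ : ℝ → ℝ := fun x => φ x - m * η x with hθ
  have cθ : Continuous θ := hφ.continuous.sub (continuous_const.mul hη.continuous)
  have iθ : Integrable θ := iφ.sub (iη.const_mul m)
  have hθ0 : ∫ x, θ x = 0 := by
    rw [hθ, integral_sub iφ (iη.const_mul m), integral_const_mul, hη1, ← hm]; ring
  set ψ : ℝ → ℝ := fun x => ∫ t in Iic x, θ t with hψ
  have hderiv : ∀ x, HasDerivAt ψ (θ x) x := by
    intro x
    have h1 : ψ = fun y => (∫ t in Iic (0 : ℝ), θ t) + ∫ t in (0 : ℝ)..y, θ t := by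
      funext y
      rw [← intervalIntegral.integral_Iic_sub_Iic iθ.integrableOn iθ.integrableOn]
      ring
    rw [h1]
    exact (intervalIntegral.integral_hasDerivAt_right (cθ.intervalIntegrable _ _)
      (cθ.stronglyMeasurableAtFilter _ _) cθ.continuousAt).const_add _
  have hψ' : deriv ψ = θ := funext fun x => (hderiv x).deriv
  have hθs : ContDiff ℝ (⊤ : ℕ∞) θ := hφ.sub (contDiff_const.mul hη)
  have hψs : ContDiff ℝ (⊤ : ℕ∞) ψ := by
    refine contDiff_infty_iff_deriv.2 ⟨fun x => (hderiv x).differentiableAt, ?_⟩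
    rw [hψ']; exact hθs
  have hψc : HasCompactSupport ψ := by
    obtain ⟨R, hR, hz⟩ := HasCompactSupport.exists_abs_bound hφc
    obtain ⟨R', hR', hz'⟩ := HasCompactSupport.exists_abs_bound hηc
    have hθz : ∀ x, max R R' ≤ |x| → θ x = 0 := fun x hx => by
      simp [hθ, (hz x ((le_max_left _ _).trans hx)).1, (hz' x ((le_max_right _ _).trans hx)).1]
    have hS : 0 ≤ max R R' := hR.trans (le_max_left _ _)
    refine HasCompactSupport.intro (isCompact_Icc (a := -max R R') (b := max R R')) fun x hx => ?_
    rw [mem_Icc, not_and_or, not_le, not_le] at hx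
    rcases hx with hx | hx
    · refine setIntegral_eq_zero_of_forall_eq_zero fun t ht => hθz t ?_
      rw [mem_Iic] at ht
      rw [abs_of_neg (by linarith)]; linarith
    · have h2 : ∫ t in Ioi x, θ t = 0 := setIntegral_eq_zero_of_forall_eq_zero fun t ht => hθz t (by
        rw [mem_Ioi] at ht
        rw [abs_of_pos (by linarith)]; linarith)
      have h3 := intervalIntegral.integral_Iic_add_Ioi (b := x) iθ.integrableOn iθ.integrableOn
      rw [h2, hθ0, add_zero] at h3
      exact h3
  have key := h ψ hψs hψc
  rw [hψ'] at key
  have e : ∀ x, θ x • d x = φ x • d x - m • (η x • d x) := fun x => by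
    simp only [hθ, sub_smul, mul_smul]
  have i1 := integrable_test_smul hφ.continuous hφc hd
  have i2 := integrable_test_smul hη.continuous hηc hd
  simp only [e] at key
  have i3 : Integrable fun x => m • (η x • d x) := i2.smul m
  rw [integral_sub i1 i3, integral_smul, sub_eq_zero] at key
  rw [key, integral_smul_const, ← hm]

/-- A primitive of `g` has the same weak derivative as `f`, so the two differ by a constant almost
everywhere. -/
theorem IsWeakDeriv.exists_hasPrim {f g : ℝ → ℂ} (h : IsWeakDeriv 1 f g) :
    ∃ F, F =ᵐ[volume] f ∧ HasPrim F g := by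
  have h0 := HasPrim.of_locallyIntegrable h.2.1 0
  have hw := h0.isWeakDeriv
  obtain ⟨c, hc⟩ := ae_eq_const_of_weakDeriv_zero (h.1.sub hw.1) (fun φ hφ hφc => by
    have e1 := h.2.2 φ hφ hφc
    have e2 := hw.2.2 φ hφ hφc
    have hφ1 : ContDiff ℝ 1 φ := hφ.of_le (by exact_mod_cast le_top)
    have i1 := integrable_test_smul (hφ1.continuous_deriv le_rfl) hφc.deriv h.1
    have i2 := integrable_test_smul (hφ1.continuous_deriv le_rfl) hφc.deriv hw.1
    simp only [iteratedDeriv_one] at e1 e2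
    simp only [Pi.sub_apply, smul_sub]
    rw [integral_sub i1 i2, e1, e2, sub_self])
  refine ⟨_, ?_, (h0.add (.const c)).congr' fun x => add_zero _⟩
  filter_upwards [hc] with x hx
  simp only [Pi.sub_apply] at hx
  rw [← hx]; ring

theorem IsWeakDeriv.succ {j : ℕ} {f g g' : ℝ → ℂ} (h : IsWeakDeriv j f g)
    (h' : IsWeakDeriv (j + 1) f g') : IsWeakDeriv 1 g g' := by
  refine ⟨h.2.1, h'.2.1, fun φ hφ hφc => ?_⟩
  have e1 := h.2.2 (deriv φ) (contDiff_infty_iff_deriv.1 hφ).2 hφc.deriv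
  have e2 := h'.2.2 φ hφ hφc
  rw [← iteratedDeriv_succ', e2, pow_succ] at e1
  rw [iteratedDeriv_one]
  have hj : ((-1 : ℂ) ^ j) ≠ 0 := pow_ne_zero _ (by norm_num)
  apply mul_left_cancel₀ hj
  rw [← e1]; ring

theorem IsWeakDeriv.ae_unique {j : ℕ} {f g g' : ℝ → ℂ} (h : IsWeakDeriv j f g)
    (h' : IsWeakDeriv j f g') : g =ᵐ[volume] g' := by
  refine ae_eq_of_integral_contDiff_smul_eq h.2.1 h'.2.1 fun φ hφ hφc => ?_
  have hj : ((-1 : ℂ) ^ j) ≠ 0 := pow_ne_zero _ (by norm_num)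
  apply mul_left_cancel₀ hj
  rw [← h.2.2 φ hφ hφc, ← h'.2.2 φ hφ hφc]

theorem IsWeakDeriv.ae_eq_self {f g : ℝ → ℂ} (h : IsWeakDeriv 0 f g) : g =ᵐ[volume] f := by
  refine ae_eq_of_integral_contDiff_smul_eq h.2.1 h.1 fun φ hφ hφc => ?_
  have := h.2.2 φ hφ hφc
  simpa using this.symm

theorem IsWeakDeriv.ae_eq_weakDeriv {j : ℕ} {f g : ℝ → ℂ} (h : IsWeakDeriv j f g) :
    weakDeriv j f =ᵐ[volume] g := by
  have hex : ∃ g, IsWeakDeriv j f g := ⟨g, h⟩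
  rw [weakDeriv, dif_pos hex]
  exact hex.choose_spec.ae_unique h

/-- The regular representatives are built from the highest derivative downwards; each lower one is
replaced by its absolutely continuous version. -/
theorem exists_memW_of_chain : ∀ {k : ℕ} {g : ℕ → ℝ → ℂ},
    (∀ j ≤ k, MemLp (fun x => bracket x • g j x) 2) → (∀ j < k, IsWeakDeriv 1 (g j) (g (j + 1))) →
    ∃ F, F =ᵐ[volume] g 0 ∧ MemW k F
  | 0, g, h, _ => ⟨g 0, .rfl, h 0 le_rfl⟩
  | k + 1, g, h, h' => by
    obtain ⟨F₁, e₁, hF₁⟩ := exists_memW_of_chain (k := k) (g := fun j => g (j + 1))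
      (fun j hj => h (j + 1) (by omega)) (fun j hj => h' (j + 1) (by omega))
    obtain ⟨F, e, hF⟩ := (h' 0 (by omega)).exists_hasPrim
    refine ⟨F, e, (memLp_congr_ae ?_).1 (h 0 (by omega)), F₁, hF.congr e₁.symm, hF₁⟩
    filter_upwards [e] with x hx
    rw [hx]

/-- Everything later works with the absolutely continuous representative `Q`. The last bound is the
only way the smallness of `q` enters the proof. -/
theorem MemX.exists_memW {n : ℕ} {q : ℝ → ℂ} (h : MemX (n + 1) q) :
    ∃ Q Q', Q =ᵐ[volume] q ∧ HasPrim Q Q' ∧ MemW (n + 1) Q ∧ MemW n Q' ∧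
      ∫⁻ x, ‖Q' x‖ₑ ≤ eLpNorm (fun x => (bracket x)⁻¹) 2 * normX 1 q := by
  choose! g hg hg' using h.2
  obtain ⟨Q, e, hQ⟩ := exists_memW_of_chain (k := n + 1) (g := g) hg'
    (fun j hj => (hg j hj.le).succ (hg (j + 1) (by omega)))
  have eQ : Q =ᵐ[volume] q := e.trans (hg 0 (by omega)).ae_eq_self
  obtain ⟨hQ0, Q', hp, hQ'⟩ := id hQ
  refine ⟨Q, Q', eQ, hp, hQ, hQ', ?_⟩
  refine (lintegral_enorm_le_eLpNorm_bracket hQ'.memLp_bracket).trans ?_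
  gcongr
  have e1 : weakDeriv 1 q =ᵐ[volume] Q' := by
    have h1 := hg 1 (by omega)
    obtain ⟨F, eF, hF⟩ := ((hg 0 (by omega)).succ h1).exists_hasPrim
    -- Continuous functions that agree almost everywhere are equal, so the weak derivative of `q` is
    -- the derivative of `Q`.
    have h2 : F = Q := (hF.continuous.ae_eq_iff_eq volume hp.continuous).1
      (eF.trans e.symm)
    rw [h2] at hF
    exact h1.ae_eq_weakDeriv.trans (hF.ae_unique hp)
  have e2 : (fun x => bracket x • Q' x) =ᵐ[volume] fun x => bracket x • weakDeriv 1 q x := by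
    filter_upwards [e1] with x hx
    rw [hx]
  rw [eLpNorm_congr_ae e2, normX, Finset.sum_range_succ]
  exact le_add_self

end WKI

namespace WKI

open Filter Topology Set ComplexConjugate

/-! ### The gauge transformation -/

/-- The data of a gauge transformation with columns `(E, ρE)` and `(-conj (ρE), conj E)`,
which diagonalises `iσ₃ - ℳ` pointwise with eigenvalues `±ip`; the functions `f` and `g` are the
off-diagonal entries of the transformed potential, and `z` is the new phase. -/
structure Gauge (q : ℝ → ℂ) where
  (ρ E s f g : ℝ → ℂ)
  (p z : ℝ → ℝ)
  q_int : Integrable q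
  f_int : Integrable f
  g_int : Integrable g
  E_ne : ∀ x, E x ≠ 0
  E_bdd : ∃ C : ℝ, ∀ x, ‖E x‖ ≤ C
  ρ_bdd : ∃ C : ℝ, ∀ x, ‖ρ x‖ ≤ C
  hasPrim_E : HasPrim E (fun x => -(conj (ρ x) * s x * E x))
  hasPrim_ρE : HasPrim (fun x => ρ x * E x) (fun x => s x * E x)
  f_mul : ∀ x, f x * E x = conj (s x) * conj (E x)
  g_mul : ∀ x, g x * conj (E x) = -(s x * E x)
  p_cont : Continuous p
  one_le_p : ∀ x, 1 ≤ p x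
  z_deriv : ∀ x, HasDerivAt z (p x) x
  q_mul : ∀ x, q x * ρ x = -(Complex.I * (p x - 1))
  conj_q : ∀ x, conj (q x) = Complex.I * ρ x * (1 + p x)
  ρ_top : Tendsto ρ atTop (𝓝 0)
  ρ_bot : Tendsto ρ atBot (𝓝 0)
  E_top : ∃ e : ℂ, e ≠ 0 ∧ Tendsto E atTop (𝓝 e)
  E_bot : ∃ e : ℂ, e ≠ 0 ∧ Tendsto E atBot (𝓝 e)
  z_bdd : ∃ C : ℝ, ∀ x, |z x - x| ≤ C
  z_top : ∃ c : ℝ, Tendsto (fun x => z x - x) atTop (𝓝 c)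
  z_bot : ∃ c : ℝ, Tendsto (fun x => z x - x) atBot (𝓝 c)

/-- The gauge transformation of the reflected potential. -/
def Gauge.reflect {q : ℝ → ℂ} (G : Gauge q) : Gauge (fun x => conj (q (-x))) where
  ρ x := -conj (G.ρ (-x))
  E x := conj (G.E (-x))
  s x := conj (G.s (-x))
  f x := -G.g (-x)
  g x := -G.f (-x)
  p x := G.p (-x)
  z x := -G.z (-x)
  q_int := Complex.conjCLE.toContinuousLinearMap.integrable_comp G.q_int.comp_neg
  f_int := G.g_int.comp_neg.neg
  g_int := G.f_int.comp_neg.neg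
  E_ne x := by simpa using G.E_ne (-x)
  E_bdd := by
    obtain ⟨C, hC⟩ := G.E_bdd
    exact ⟨C, fun x => by simpa using hC (-x)⟩
  ρ_bdd := by
    obtain ⟨C, hC⟩ := G.ρ_bdd
    exact ⟨C, fun x => by simpa using hC (-x)⟩
  hasPrim_E := G.hasPrim_E.conjugate.comp_neg.congr' fun x => by
    simp
  hasPrim_ρE := by
    have := (G.hasPrim_ρE.conjugate.comp_neg.neg).congr' (g := fun x => conj (G.s (-x)) * conj (G.E (-x)))
      fun x => by simp
    simpa [neg_mul] using this
  f_mul x := by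
    have := congrArg conj (G.g_mul (-x))
    simp only [map_mul, map_neg, Complex.conj_conj] at this ⊢
    linear_combination -G.g_mul (-x)
  g_mul x := by
    simp only [Complex.conj_conj]
    linear_combination -G.f_mul (-x)
  p_cont := G.p_cont.comp continuous_neg
  one_le_p x := G.one_le_p _
  z_deriv x := by
    have := (HasDerivAt.comp x (G.z_deriv (-x)) (hasDerivAt_neg x)).neg
    rw [mul_neg, mul_one, neg_neg] at this
    exact this
  q_mul x := by
    have := congrArg conj (G.q_mul (-x))
    simp only [map_mul, map_neg, map_sub, map_one, Complex.conj_I, Complex.conj_ofReal] at this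
    linear_combination -this
  conj_q x := by
    have := congrArg conj (G.conj_q (-x))
    simp only [map_mul, map_add, map_one, Complex.conj_I, Complex.conj_ofReal,
      Complex.conj_conj] at this
    rw [Complex.conj_conj, this]
    ring
  ρ_top := by
    simpa using ((Complex.continuous_conj.tendsto _).comp (G.ρ_bot.comp tendsto_neg_atTop_atBot)).neg
  ρ_bot := by
    simpa using ((Complex.continuous_conj.tendsto _).comp (G.ρ_top.comp tendsto_neg_atBot_atTop)).neg
  E_top := by
    obtain ⟨e, he, h⟩ := G.E_bot
    exact ⟨conj e, by simpa using he, (Complex.continuous_conj.tendsto _).comp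
      (h.comp tendsto_neg_atTop_atBot)⟩
  E_bot := by
    obtain ⟨e, he, h⟩ := G.E_top
    exact ⟨conj e, by simpa using he, (Complex.continuous_conj.tendsto _).comp
      (h.comp tendsto_neg_atBot_atTop)⟩
  z_bdd := by
    obtain ⟨C, hC⟩ := G.z_bdd
    refine ⟨C, fun x => ?_⟩
    have := hC (-x)
    rwa [← abs_neg, show -(-G.z (-x) - x) = G.z (-x) - -x by ring]
  z_top := by
    obtain ⟨c, h⟩ := G.z_bot
    refine ⟨-c, (h.comp tendsto_neg_atTop_atBot).neg.congr fun x => ?_⟩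
    simp only [Function.comp]; ring
  z_bot := by
    obtain ⟨c, h⟩ := G.z_top
    refine ⟨-c, (h.comp tendsto_neg_atBot_atTop).neg.congr fun x => ?_⟩
    simp only [Function.comp]; ring

/-- `√(1 + |q|²)`. -/
noncomputable def arc (w : ℂ) : ℝ := Real.sqrt (1 + ‖w‖ ^ 2)

theorem one_le_arc (w : ℂ) : 1 ≤ arc w := Real.one_le_sqrt.2 (by nlinarith [sq_nonneg ‖w‖])

theorem arc_sq (w : ℂ) : arc w ^ 2 = 1 + ‖w‖ ^ 2 := Real.sq_sqrt (by positivity)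

theorem norm_le_arc (w : ℂ) : ‖w‖ ≤ arc w := Real.le_sqrt_of_sq_le (by linarith)

theorem arc_sub_one_le (w : ℂ) : arc w - 1 ≤ ‖w‖ := by
  have := arc_sq w
  nlinarith [one_le_arc w, norm_nonneg w]

theorem contDiff_arc : ContDiff ℝ 1 arc := by
  unfold arc
  exact ContDiff.sqrt (contDiff_const.add (contDiff_norm_sq ℝ)) fun x => by positivity

theorem ofReal_arc_sq (w : ℂ) : (arc w : ℂ) ^ 2 = 1 + w * conj w := by
  rw [Complex.mul_conj, Complex.normSq_eq_norm_sq, ← Complex.ofReal_pow, arc_sq]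
  push_cast; rfl

variable {Q Q' : ℝ → ℂ}

/-- Smoothness of `arc` shows that an almost everywhere derivative exists. Its value is found by
differentiating the identity `(1/p)² (1 + Q conj Q) = 1` and solving. -/
theorem hasPrim_inv_arc (h : HasPrim Q Q') :
    HasPrim (fun x => ((arc (Q x))⁻¹ : ℂ)) (fun x => -(1 / 2) *
      ((Q' x * conj (Q x) + Q x * conj (Q' x)) * (arc (Q x) : ℂ)⁻¹ ^ 3)) := by
  have hφ : ContDiff ℝ 1 fun w : ℂ => ((arc w)⁻¹ : ℂ) := by
    have := Complex.ofRealCLM.contDiff.comp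
      (contDiff_arc.inv fun w => (zero_lt_one.trans_le (one_le_arc w)).ne')
    convert this using 1
    funext w
    simp
  have h1 := h.comp_contDiff hφ
  refine h1.congr ?_
  have hc := (HasPrim.const 1).add (h.mul h.conjugate)
  have e : ∀ x, ((arc (Q x))⁻¹ : ℂ) * ((arc (Q x))⁻¹ : ℂ) * (1 + Q x * conj (Q x)) = 1 := fun x => by
    rw [← ofReal_arc_sq]
    have : (arc (Q x) : ℂ) ≠ 0 :=
      Complex.ofReal_ne_zero.2 (zero_lt_one.trans_le (one_le_arc _)).ne'
    field_simp
  have h3 := ((h1.mul h1).mul hc).congr_left e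
  filter_upwards [h3.ae_unique (.const 1)] with x hx
  have ex := e x
  linear_combination (-fderiv ℝ (fun w : ℂ => ((arc w)⁻¹ : ℂ)) (Q x) (Q' x)) * ex +
    ((arc (Q x))⁻¹ : ℂ) / 2 * hx


theorem hasPrim_arc (h : HasPrim Q Q') :
    HasPrim (fun x => (arc (Q x) : ℂ)) (fun x => 1 / 2 *
      ((Q' x * conj (Q x) + Q x * conj (Q' x)) * (arc (Q x) : ℂ)⁻¹)) := by
  have hc := (HasPrim.const 1).add (h.mul h.conjugate)
  have h0 : ∀ x, (arc (Q x) : ℂ) ≠ 0 := fun x =>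
    Complex.ofReal_ne_zero.2 (zero_lt_one.trans_le (one_le_arc _)).ne'
  refine ((hc.mul (hasPrim_inv_arc h)).congr_left fun x => ?_).congr' fun x => ?_
  · rw [← ofReal_arc_sq]
    field_simp [h0 x]
  · rw [← ofReal_arc_sq]
    field_simp [h0 x]
    ring

theorem hasPrim_inv_one_add_arc (h : HasPrim Q Q') :
    HasPrim (fun x => ((1 + arc (Q x))⁻¹ : ℂ)) (fun x => -(1 / 2 *
      ((Q' x * conj (Q x) + Q x * conj (Q' x)) * (arc (Q x) : ℂ)⁻¹) *
        ((1 + arc (Q x))⁻¹ : ℂ) ^ 2)) := by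
  have hφ : ContDiff ℝ 1 fun w : ℂ => ((1 + arc w)⁻¹ : ℂ) := by
    have := Complex.ofRealCLM.contDiff.comp ((contDiff_const.add contDiff_arc).inv
      fun w => (zero_lt_one.trans_le ((one_le_arc w).trans (le_add_of_nonneg_left zero_le_one))).ne')
    convert this using 1
    funext w
    simp
  have h1 := h.comp_contDiff hφ
  refine h1.congr ?_
  have e : ∀ x, ((1 + arc (Q x))⁻¹ : ℂ) * (1 + arc (Q x)) = 1 := fun x => by
    have : (1 + arc (Q x) : ℂ) ≠ 0 := by
      exact_mod_cast (by linarith [one_le_arc (Q x)] : (1 + arc (Q x)) ≠ 0)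
    field_simp
  have h3 := (h1.mul ((HasPrim.const 1).add (hasPrim_arc h))).congr_left e
  filter_upwards [h3.ae_unique (.const 1)] with x hx
  have ex := e x
  linear_combination (-fderiv ℝ (fun w : ℂ => ((1 + arc w)⁻¹ : ℂ)) (Q x) (Q' x)) * ex +
    ((1 + arc (Q x))⁻¹ : ℂ) * hx

end WKI

/-! ### Construction of the gauge -/

namespace WKI

open Filter Topology Set ComplexConjugate

variable {Q Q' : ℝ → ℂ}

theorem tendsto_real_of_integrable {w : ℝ → ℝ} (hw : Integrable w) :
    Tendsto (fun x => ∫ y in Iic x, w y) atTop (𝓝 (∫ y, w y)) ∧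
      Tendsto (fun x => ∫ y in Iic x, w y) atBot (𝓝 0) := by
  have h1 := tendsto_integral_Iic_atTop (f := fun y => (w y : ℂ)) hw.ofReal
  have h2 := tendsto_integral_Iic_atBot (f := fun y => (w y : ℂ)) hw.ofReal
  have e : ∀ x, ∫ y in Iic x, (w y : ℂ) = ((∫ y in Iic x, w y : ℝ) : ℂ) := fun x => integral_ofReal
  have e' : ∫ y, (w y : ℂ) = ((∫ y, w y : ℝ) : ℂ) := integral_ofReal
  simp only [e, e'] at h1 h2
  exact ⟨(Complex.continuous_re.tendsto _).comp h1,
    (Complex.continuous_re.tendsto _).comp (h2 : Tendsto _ _ (𝓝 ((0 : ℝ) : ℂ)))⟩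

/-- The exponential of the primitive of an integrable function. -/
theorem bounded_cexp_primitive {d D : ℝ → ℂ} (h : HasPrim D d) (hd : Integrable d) :
    ∃ C : ℝ, ∀ x, ‖Complex.exp (D x)‖ ≤ C := by
  obtain ⟨C, hC⟩ := h.bounded hd
  refine ⟨Real.exp C, fun x => ?_⟩
  rw [Complex.norm_exp]
  exact Real.exp_le_exp.2 ((Complex.re_le_norm _).trans (hC x))

theorem MemB.cexp {n : ℕ} {d D : ℝ → ℂ} (h : HasPrim D d) (hd : MemW n d) :
    MemB (n + 1) fun x => Complex.exp (D x) := by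
  refine MemB.of_hasPrim (bounded_cexp_primitive h hd.integrable) h.cexp fun k hk hc => ?_
  simpa only [mul_comm] using hc.mul_memW (hd.mono hk)

/-- For `ρ = -i conj Q / (1 + p)` the vectors `(1, ρ)` and `(-conj ρ, 1)` are eigenvectors of `iσ₃ -
ℳ`. With `s = ρ'/(1 + |ρ|²)`, the equation `E' = -conj ρ s E` gives `(ρE)' = sE` and removes the
diagonal of the transformed potential. Normalising `E → 1` and `z - x → 0` at `-∞` makes the
scattering data readable there. The last conjunct is the amplitude used for `λ⁻¹`. -/
theorem exists_gauge {n : ℕ} (h : HasPrim Q Q') (hQ : MemW (n + 1) Q) (hQ' : MemW n Q') :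
    ∃ G : Gauge Q, Tendsto G.E atBot (𝓝 1) ∧ Tendsto (fun x => G.z x - x) atBot (𝓝 0) ∧
      (∀ x, ‖G.f x‖ ≤ ‖Q' x‖) ∧ (∀ x, ‖G.g x‖ ≤ ‖Q' x‖) ∧ MemW n G.f ∧ MemW n G.g ∧
      MemB (n + 1) (fun x => ((G.p x)⁻¹ : ℂ)) ∧
      MemW (n + 1) (fun x => 2 * Complex.I * G.p x * G.ρ x * G.E x) := by
  set p : ℝ → ℝ := fun x => arc (Q x) with hp
  have p1 : ∀ x, 1 ≤ p x := fun x => one_le_arc _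
  have p0 : ∀ x, (p x : ℂ) ≠ 0 := fun x =>
    Complex.ofReal_ne_zero.2 (zero_lt_one.trans_le (p1 x)).ne'
  have p0' : ∀ x, (1 + p x : ℂ) ≠ 0 := fun x => by
    exact_mod_cast (by linarith [p1 x] : (1 + p x) ≠ 0)
  have psq : ∀ x, (p x : ℂ) ^ 2 = 1 + Q x * conj (Q x) := fun x => ofReal_arc_sq _
  set k : ℝ → ℂ := fun x => ((1 + p x)⁻¹ : ℂ) with hk
  set i : ℝ → ℂ := fun x => ((p x)⁻¹ : ℂ) with hi
  set c₁ : ℝ → ℂ := fun x => Q' x * conj (Q x) + Q x * conj (Q' x) with hc₁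
  have pi : HasPrim i (fun x => -(1 / 2) * (c₁ x * i x ^ 3)) := hasPrim_inv_arc h
  have pp : HasPrim (fun x => (p x : ℂ)) (fun x => 1 / 2 * (c₁ x * i x)) := hasPrim_arc h
  have pk : HasPrim k (fun x => -(1 / 2 * (c₁ x * i x) * k x ^ 2)) := hasPrim_inv_one_add_arc h
  have nk : ∀ x, ‖k x‖ ≤ 1 := fun x => by
    simp only [hk]
    rw [norm_inv]
    refine inv_le_one_of_one_le₀ ?_
    rw [show (1 + p x : ℂ) = ((1 + p x : ℝ) : ℂ) by push_cast; rfl, Complex.norm_real,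
      Real.norm_of_nonneg (by linarith [p1 x])]
    linarith [p1 x]
  have ni : ∀ x, ‖i x‖ ≤ 1 := fun x => by
    simp only [hi]
    rw [norm_inv, Complex.norm_real, Real.norm_of_nonneg (by linarith [p1 x])]
    exact inv_le_one_of_one_le₀ (p1 x)
  have wc : MemW n c₁ := by
    refine MemW.add ?_ ?_
    · simpa only [mul_comm] using hQ.conjugate.mul hQ'
    · exact hQ.mul hQ'.conjugate
  -- The derivative of `1/p` is cubic in `1/p`, so the bootstrap applies.
  have bi : MemB (n + 1) i := by
    refine MemB.of_hasPrim ⟨1, ni⟩ pi fun j hj hB => MemW.const_mul _ ?_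
    simpa only [pow_succ, pow_zero, one_mul, mul_comm] using
      ((hB.mul hB).mul hB).mul_memW (wc.mono hj)
  have bk : MemB (n + 1) k := by
    refine MemB.of_hasPrim ⟨1, nk⟩ pk fun j hj hB => ?_
    refine (((hB.mul hB).mul (bi.mono (by omega))).mul_memW
      (MemW.const_mul (-(1 / 2)) (wc.mono hj))).congr_fun fun x => ?_
    ring
  have bQ := hQ.memB
  set ρ : ℝ → ℂ := fun x => -Complex.I * (conj (Q x) * k x) with hρ
  -- This is `ρ'/(1 + |ρ|²)`, simplified with `1 + |ρ|² = 2p/(1 + p)`.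
  set s : ℝ → ℂ := fun x => -Complex.I / 2 * (i x * (conj (Q' x) -
    conj (Q x) * (1 / 2 * (c₁ x * i x)) * k x)) with hs
  have wρ : MemW (n + 1) ρ := by
    refine MemW.const_mul _ ?_
    simpa only [mul_comm] using bk.mul_memW hQ.conjugate
  have cQ := bQ.of_succ
  have ci := bi.of_succ
  have ck := bk.of_succ
  have ws : MemW n s := by
    refine MemW.const_mul _ (ci.mul_memW ?_)
    have := hQ'.conjugate.add (((cQ.conjugate.mul (ci.mul ck)).mul_memW (wc.const_mul (-(1 / 2)))))
    exact this.congr_fun fun x => by ring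
  have conj_p : ∀ x, conj (p x : ℂ) = p x := fun x => Complex.conj_ofReal _
  have conj_k : ∀ x, conj (k x) = k x := fun x => by simp [hk]
  have hip : ∀ x, i x * p x = 1 := fun x => inv_mul_cancel₀ (p0 x)
  have hkp : ∀ x, k x * (1 + p x) = 1 := fun x => inv_mul_cancel₀ (p0' x)
  have nQp : ∀ x, ‖Q x‖ * ‖i x‖ ≤ 1 := fun x => by
    simp only [hi]
    rw [norm_inv, Complex.norm_real, Real.norm_of_nonneg (by linarith [p1 x]), ← div_eq_mul_inv]
    exact div_le_one_of_le₀ (norm_le_arc _) (by linarith [p1 x])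
  have nQk : ∀ x, ‖Q x‖ * ‖k x‖ ≤ 1 := fun x => by
    simp only [hk]
    rw [norm_inv, show (1 + p x : ℂ) = ((1 + p x : ℝ) : ℂ) by push_cast; rfl, Complex.norm_real,
      Real.norm_of_nonneg (by linarith [p1 x]), ← div_eq_mul_inv]
    exact div_le_one_of_le₀ ((norm_le_arc _).trans (by simp [hp])) (by linarith [p1 x])
  have nρ : ∀ x, ‖ρ x‖ ≤ ‖Q x‖ := fun x => by
    simp only [hρ, norm_mul, norm_neg, Complex.norm_I, one_mul, RCLike.norm_conj]
    exact mul_le_of_le_one_right (norm_nonneg _) (nk x)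
  -- The bound uses only `|Q| ≤ p`. As `|f| = |g| = |s|`, it passes the smallness of `∫|Q'|` on to
  -- `f` and `g`.
  have ns : ∀ x, ‖s x‖ ≤ ‖Q' x‖ := fun x => by
    have e1 : ‖c₁ x‖ ≤ 2 * (‖Q' x‖ * ‖Q x‖) := by
      refine (norm_add_le _ _).trans ?_
      simp only [norm_mul, RCLike.norm_conj]
      linarith
    have e2 : ‖conj (Q' x) - conj (Q x) * (1 / 2 * (c₁ x * i x)) * k x‖ ≤ 2 * ‖Q' x‖ := by
      refine (norm_sub_le _ _).trans ?_
      simp only [norm_mul, RCLike.norm_conj, norm_div, norm_one, RCLike.norm_ofNat]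
      have : ‖Q x‖ * (1 / 2 * (‖c₁ x‖ * ‖i x‖)) * ‖k x‖ ≤ ‖Q' x‖ := calc
        _ = 1 / 2 * ‖c₁ x‖ * ‖i x‖ * (‖Q x‖ * ‖k x‖) := by ring
        _ ≤ 1 / 2 * ‖c₁ x‖ * ‖i x‖ * 1 := by gcongr; exact nQk x
        _ ≤ 1 / 2 * (2 * (‖Q' x‖ * ‖Q x‖)) * ‖i x‖ * 1 := by gcongr
        _ = ‖Q' x‖ * (‖Q x‖ * ‖i x‖) := by ring
        _ ≤ ‖Q' x‖ * 1 := by gcongr; exact nQp x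
        _ = ‖Q' x‖ := mul_one _
      linarith
    simp only [hs] at e2 ⊢
    rw [norm_mul, norm_mul, norm_div, norm_neg, Complex.norm_I, RCLike.norm_ofNat]
    calc _ ≤ 1 / 2 * (1 * (2 * ‖Q' x‖)) := by gcongr; exact ni x
      _ = ‖Q' x‖ := by ring
  set d : ℝ → ℂ := fun x => -(conj (ρ x) * s x) with hd
  have wd : MemW n d := by
    have := (wρ.conjugate.memB.of_succ).mul_memW (ws.const_mul (-1))
    exact this.congr_fun fun x => by simp only [hd]; ring
  set D : ℝ → ℂ := fun x => ∫ y in Iic x, d y with hD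
  have pD : HasPrim D d := .of_integral_Iic wd.integrable
  set E : ℝ → ℂ := fun x => Complex.exp (D x) with hE
  have bE : MemB (n + 1) E := .cexp pD wd
  have wn : MemW n fun x => -d x := (wd.const_mul (-1)).congr_fun fun x => by ring
  have bE' : MemB (n + 1) fun x => Complex.exp (-D x) := .cexp pD.neg wn
  have hEE : ∀ x, Complex.exp (-D x) * E x = 1 := fun x => by
    rw [hE, ← Complex.exp_add, neg_add_cancel, Complex.exp_zero]
  have nE : ∀ x, ‖E x‖ * ‖Complex.exp (-D x)‖ = 1 := fun x => by
    rw [← norm_mul, mul_comm, hEE, norm_one]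
  -- Since `1/E = exp (-D)`, the factors `conj E / E` and `E / conj E` are unimodular elements of
  -- `MemB`.
  set f : ℝ → ℂ := fun x => conj (E x) * Complex.exp (-D x) * conj (s x) with hf
  set g : ℝ → ℂ := fun x => E x * conj (Complex.exp (-D x)) * -s x with hg
  have wf : MemW n f := (bE.of_succ.conjugate.mul bE'.of_succ).mul_memW ws.conjugate
  have wg : MemW n g := (bE.of_succ.mul bE'.of_succ.conjugate).mul_memW
    ((ws.const_mul (-1)).congr_fun fun x => by ring)
  have nf : ∀ x, ‖f x‖ ≤ ‖Q' x‖ := fun x => by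
    simp only [hf, norm_mul, RCLike.norm_conj, nE, one_mul, ns]
  have ng : ∀ x, ‖g x‖ ≤ ‖Q' x‖ := fun x => by
    simp only [hg, norm_mul, RCLike.norm_conj, norm_neg, nE, one_mul, ns]
  have hpE : HasPrim E (fun x => -(conj (ρ x) * s x * E x)) :=
    pD.cexp.congr' fun x => by simp only [hd, hE]; ring
  have hkρ : HasPrim ρ (fun x => s x * (1 + ρ x * conj (ρ x))) := by
    refine (HasPrim.const_mul (-Complex.I) (h.conjugate.mul pk)).congr' fun x => ?_
    have e1 : conj (ρ x) = Complex.I * (Q x * k x) := by simp [hρ, conj_k]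
    have e2 : ρ x * conj (ρ x) = (p x - 1) * k x := by
      rw [e1]
      simp only [hρ]
      linear_combination (-(Q x * conj (Q x) * k x ^ 2)) * Complex.I_mul_I - k x ^ 2 * psq x +
        (p x - 1) * k x * hkp x
    have e3 : (1 + ρ x * conj (ρ x)) * i x = 2 * k x := by
      rw [e2]
      linear_combination (-i x) * hkp x + 2 * k x * hip x
    simp only [hs]
    linear_combination (Complex.I / 2 * (conj (Q' x) -
      conj (Q x) * (1 / 2 * (c₁ x * i x)) * k x)) * e3
  have ip : Integrable fun x => p x - 1 := by
    have hc : Continuous fun x => p x - 1 :=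
      (contDiff_arc.continuous.comp h.continuous).sub continuous_const
    refine hQ.integrable.mono hc.aestronglyMeasurable (.of_forall fun x => ?_)
    rw [Real.norm_of_nonneg (by linarith [p1 x])]
    exact arc_sub_one_le _
  have pc : Continuous p := contDiff_arc.continuous.comp h.continuous
  -- Since `0 ≤ p - 1 ≤ |Q|` is integrable, `z - x` is bounded, has limits at both ends, and
  -- vanishes at `-∞`.
  set z : ℝ → ℝ := fun x => x + ∫ y in Iic x, (p y - 1) with hz
  have ez : ∀ x, z x - x = ∫ y in Iic x, (p y - 1) := fun x => add_sub_cancel_left _ _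
  obtain ⟨zt, zb⟩ := tendsto_real_of_integrable ip
  have hzd : ∀ x, HasDerivAt z (p x) x := fun x => by
    have h1 : z = fun y => y + ((∫ t in Iic (0 : ℝ), (p t - 1)) + ∫ t in (0 : ℝ)..y, (p t - 1)) := by
      funext y
      rw [hz, ← intervalIntegral.integral_Iic_sub_Iic ip.integrableOn ip.integrableOn]
      ring
    have hc : Continuous fun x => p x - 1 := pc.sub continuous_const
    rw [h1]
    have := (hasDerivAt_id x).add ((intervalIntegral.integral_hasDerivAt_right
      (hc.intervalIntegrable 0 x) (hc.stronglyMeasurableAtFilter _ _) hc.continuousAt).const_add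
        (∫ t in Iic (0 : ℝ), (p t - 1)))
    rwa [add_sub_cancel] at this
  have Et := (Complex.continuous_exp.tendsto _).comp (pD.tendsto_atTop wd.integrable)
  have Eb : Tendsto E atBot (𝓝 1) := by
    have := (Complex.continuous_exp.tendsto _).comp (tendsto_integral_Iic_atBot wd.integrable)
    rwa [Complex.exp_zero] at this
  refine ⟨{
    ρ := ρ, E := E, s := s, f := f, g := g, p := p, z := z
    q_int := hQ.integrable
    f_int := wf.integrable
    g_int := wg.integrable
    E_ne := fun x => Complex.exp_ne_zero _
    E_bdd := bE.bounded
    ρ_bdd := wρ.memB.bounded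
    hasPrim_E := hpE
    hasPrim_ρE := (hkρ.mul hpE).congr' fun x => by ring
    f_mul := fun x => by
      simp only [hf]
      linear_combination (conj (E x) * conj (s x)) * hEE x
    g_mul := fun x => by
      have := congrArg conj (hEE x)
      simp only [map_mul, map_one] at this
      simp only [hg]
      linear_combination (-(E x * s x)) * this
    p_cont := pc
    one_le_p := p1
    z_deriv := hzd
    q_mul := fun x => by
      simp only [hρ]
      linear_combination (Complex.I * k x) * psq x - Complex.I * (p x - 1) * hkp x
    conj_q := fun x => by
      simp only [hρ]
      linear_combination (conj (Q x) * k x * (1 + p x)) * Complex.I_mul_I - conj (Q x) * hkp x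
    ρ_top := squeeze_zero_norm nρ (by simpa using hQ.tendsto_zero.1.norm)
    ρ_bot := squeeze_zero_norm nρ (by simpa using hQ.tendsto_zero.2.norm)
    E_top := ⟨_, Complex.exp_ne_zero _, Et⟩
    E_bot := ⟨1, one_ne_zero, Eb⟩
    z_bdd := ⟨∫ x, ‖p x - 1‖, fun x => by
      rw [ez, ← Real.norm_eq_abs]
      exact (norm_integral_le_integral_norm _).trans
        (setIntegral_le_integral ip.norm (.of_forall fun _ => norm_nonneg _))⟩
    z_top := ⟨_, by simpa only [ez] using zt⟩
    z_bot := ⟨0, by simpa only [ez] using zb⟩ }, Eb, by simpa only [ez] using zb, nf, ng, wf, wg,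
      bi, ?_⟩
  -- From `p = (1 + Q conj Q) · (1/p)`.
  have bp : MemB (n + 1) fun x => (p x : ℂ) := by
    refine (((MemB.const 1).add (bQ.mul bQ.conjugate)).mul bi).congr_fun fun x => ?_
    linear_combination (-i x) * psq x + p x * hip x
  have := ((bp.mul bE).mul_memW wρ).const_mul (2 * Complex.I)
  exact this.congr_fun fun x => by ring

end WKI

namespace WKI

open Filter Topology Set ComplexConjugate

/-! ### The Jost solutions of the transformed problem -/

/-- Dominated convergence: for given `y` the truncated integrand jumps only when the endpoint
crosses `y`, and at a given parameter this concerns a single `y`. -/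
theorem continuous_setIntegral_Ioi {Λ : Type*} [TopologicalSpace Λ] [FirstCountableTopology Λ]
    {H : ℝ × Λ → ℝ → ℂ} {b : ℝ → ℝ} (hm : ∀ p, AEStronglyMeasurable (H p))
    (hb : ∀ p y, p.1 < y → ‖H p y‖ ≤ b y) (hbi : Integrable b) (hb0 : ∀ y, 0 ≤ b y)
    (hc : ∀ y, Continuous fun p => H p y) :
    Continuous fun p : ℝ × Λ => ∫ y in Ioi p.1, H p y := by
  simp only [← integral_indicator measurableSet_Ioi]
  refine continuous_iff_continuousAt.2 fun p₀ => continuousAt_of_dominated (bound := b)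
    (.of_forall fun p => (hm p).indicator measurableSet_Ioi) (.of_forall fun p => .of_forall
      fun y => ?_) hbi ?_
  · by_cases hy : y ∈ Ioi p.1
    · rw [indicator_of_mem hy]
      exact hb p y hy
    · rw [indicator_of_notMem hy, norm_zero]
      exact hb0 y
  · have : ∀ᵐ y : ℝ, y ≠ p₀.1 := by simp [ae_iff, measure_singleton]
    filter_upwards [this] with y hy
    rcases hy.lt_or_gt with hy | hy
    · have : (fun p : ℝ × Λ => indicator (Ioi p.1) (H p) y) =ᶠ[𝓝 p₀] fun _ => 0 := by
        filter_upwards [(isOpen_lt continuous_const continuous_fst).mem_nhds hy] with p hp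
        exact indicator_of_notMem (by simpa using (show y < p.1 from hp).le) _
      exact (continuousAt_congr this).2 continuousAt_const
    · have : (fun p : ℝ × Λ => indicator (Ioi p.1) (H p) y) =ᶠ[𝓝 p₀] fun p => H p y := by
        filter_upwards [(isOpen_lt continuous_fst continuous_const).mem_nhds hy] with p hp
        exact indicator_of_mem (by simpa using hp) _
      exact (continuousAt_congr this).2 (hc y).continuousAt

/-- The projection of the complex plane to the closed upper half plane. -/
noncomputable def upper (l : ℂ) : ℂ := l.re + Complex.I * (max l.im 0 : ℝ)

theorem upper_eq {l : ℂ} (h : 0 ≤ l.im) : upper l = l := by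
  rw [upper, max_eq_left h, mul_comm, Complex.re_add_im]

theorem continuous_upper : Continuous upper := by unfold upper; fun_prop

theorem norm_cexp_phase_le {l : ℂ} (h : 0 ≤ l.im) {t : ℝ} (ht : 0 ≤ t) :
    ‖Complex.exp (2 * Complex.I * l * t)‖ ≤ 1 := by
  rw [Complex.norm_exp, Real.exp_le_one_iff]
  simp only [Complex.mul_re, Complex.mul_im, Complex.I_re, Complex.I_im, Complex.re_ofNat,
    Complex.im_ofNat, Complex.ofReal_re, Complex.ofReal_im]
  nlinarith [mul_nonneg h ht]

theorem upper_im_nonneg (l : ℂ) : 0 ≤ (upper l).im := by simp [upper]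

/-- `(α, β)` is the Jost solution at `+∞` of `α' = fβ`, `β' = -2iλz'β + gα`. -/
structure IsGaugeJost (f g : ℝ → ℂ) (z : ℝ → ℝ) (α β : ℝ → ℂ → ℂ) : Prop where
  cont_α : Continuous fun p : ℝ × ℂ => α p.1 p.2
  cont_β : Continuous fun p : ℝ × ℂ => β p.1 p.2
  α_bd : ∀ x l, ‖α x l - 1‖ ≤ 1 / 3
  β_bd : ∀ x l, ‖β x l‖ ≤ 1 / 3
  α_eq : ∀ x l, 0 ≤ l.im → α x l = 1 - ∫ y in Ioi x, f y * β y l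
  β_eq : ∀ x l, 0 ≤ l.im → β x l =
    -∫ y in Ioi x, Complex.exp (2 * Complex.I * l * (z y - z x : ℝ)) * (g y * α y l)

open scoped BoundedContinuousFunction in
theorem norm_volterra_integrand_le (k : ℝ → ℂ) (κ : ℝ × ℂ → ℝ → ℂ)
    (hκ1 : ∀ p y, p.1 < y → ‖κ p y‖ ≤ 1) (u : (ℝ × ℂ) →ᵇ ℂ) (p : ℝ × ℂ) (y : ℝ) (hy : p.1 < y) :
    ‖κ p y * (k y * u (y, p.2))‖ ≤ ‖k y‖ * ‖u‖ := by
  rw [norm_mul, norm_mul]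
  calc _ ≤ 1 * (‖k y‖ * ‖u‖) := by
          gcongr
          · exact hκ1 p y hy
          · exact u.norm_coe_le_norm _
    _ = _ := one_mul _

open scoped BoundedContinuousFunction in
theorem norm_integral_volterra_le (k : ℝ → ℂ) (hk : Integrable k) (κ : ℝ × ℂ → ℝ → ℂ)
    (hκ1 : ∀ p y, p.1 < y → ‖κ p y‖ ≤ 1) (u : (ℝ × ℂ) →ᵇ ℂ) (p : ℝ × ℂ) :
    ‖∫ y in Ioi p.1, κ p y * (k y * u (y, p.2))‖ ≤ (∫ y, ‖k y‖) * ‖u‖ := by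
  rw [← integral_mul_const]
  refine (norm_integral_le_of_norm_le (hk.norm.mul_const _).integrableOn
    ((ae_restrict_mem measurableSet_Ioi).mono fun y hy =>
      norm_volterra_integrand_le k κ hκ1 u p y hy)).trans ?_
  exact setIntegral_le_integral (hk.norm.mul_const _) (.of_forall fun y => by positivity)

open scoped BoundedContinuousFunction in
/-- The Volterra operator with weight `k` and kernel `κ`. -/
noncomputable def volterra (k : ℝ → ℂ) (hk : Integrable k) (κ : ℝ × ℂ → ℝ → ℂ)
    (hκ : Continuous fun p : (ℝ × ℂ) × ℝ => κ p.1 p.2) (hκ1 : ∀ p y, p.1 < y → ‖κ p y‖ ≤ 1)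
    (u : (ℝ × ℂ) →ᵇ ℂ) : (ℝ × ℂ) →ᵇ ℂ :=
  BoundedContinuousFunction.ofNormedAddCommGroup
    (fun p => ∫ y in Ioi p.1, κ p y * (k y * u (y, p.2)))
    (continuous_setIntegral_Ioi (b := fun y => ‖k y‖ * ‖u‖)
      (fun p => (by fun_prop : Continuous fun y => κ p y).aestronglyMeasurable.mul
        (hk.1.mul (by fun_prop : Continuous fun y => u (y, p.2)).aestronglyMeasurable))
      (norm_volterra_integrand_le k κ hκ1 u) (hk.norm.mul_const _) (fun y => by positivity) (fun y => by fun_prop))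
    ((∫ y, ‖k y‖) * ‖u‖) (norm_integral_volterra_le k hk κ hκ1 u)

open scoped BoundedContinuousFunction in
theorem volterra_sub (k : ℝ → ℂ) (hk : Integrable k) (κ : ℝ × ℂ → ℝ → ℂ)
    (hκ : Continuous fun p : (ℝ × ℂ) × ℝ => κ p.1 p.2) (hκ1 : ∀ p y, p.1 < y → ‖κ p y‖ ≤ 1)
    (u v : (ℝ × ℂ) →ᵇ ℂ) : volterra k hk κ hκ hκ1 u - volterra k hk κ hκ hκ1 v =
      volterra k hk κ hκ hκ1 (u - v) := by
  have hi : ∀ (u : (ℝ × ℂ) →ᵇ ℂ) (p : ℝ × ℂ),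
      IntegrableOn (fun y => κ p y * (k y * u (y, p.2))) (Ioi p.1) := fun u p => by
    refine Integrable.mono' (hk.norm.mul_const ‖u‖).integrableOn ?_
      ((ae_restrict_mem measurableSet_Ioi).mono fun y hy =>
        norm_volterra_integrand_le k κ hκ1 u p y hy)
    exact ((by fun_prop : Continuous fun y => κ p y).aestronglyMeasurable.mul
        (hk.1.mul (by fun_prop : Continuous fun y => u (y, p.2)).aestronglyMeasurable)).restrict
  ext p
  simp only [volterra, BoundedContinuousFunction.coe_sub, Pi.sub_apply,
    BoundedContinuousFunction.coe_ofNormedAddCommGroup]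
  rw [← integral_sub (hi u p) (hi v p)]
  congr 1
  funext y
  ring

open scoped BoundedContinuousFunction in
theorem norm_volterra_le (k : ℝ → ℂ) (hk : Integrable k) (κ : ℝ × ℂ → ℝ → ℂ)
    (hκ : Continuous fun p : (ℝ × ℂ) × ℝ => κ p.1 p.2) (hκ1 : ∀ p y, p.1 < y → ‖κ p y‖ ≤ 1)
    (u : (ℝ × ℂ) →ᵇ ℂ) : ‖volterra k hk κ hκ hκ1 u‖ ≤ (∫ y, ‖k y‖) * ‖u‖ :=
  BoundedContinuousFunction.norm_ofNormedAddCommGroup_le _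
    (mul_nonneg (integral_nonneg fun _ => norm_nonneg _) (norm_nonneg _))
    (norm_integral_volterra_le k hk κ hκ1 u)

-- Both Volterra operators have norm at most `1/4`, so the pair of equations is a contraction. From
-- `‖α - 1‖ ≤ ‖β‖/4` and `‖β‖ ≤ ‖α‖/4` follow `‖β‖ ≤ 4/15` and `‖α - 1‖ ≤ 1/15`, both below `1/3`.
open scoped BoundedContinuousFunction in
theorem exists_isGaugeJost {f g : ℝ → ℂ} {z : ℝ → ℝ} (hf : Integrable f) (hg : Integrable g)
    (hf4 : ∫ x, ‖f x‖ ≤ 1 / 4) (hg4 : ∫ x, ‖g x‖ ≤ 1 / 4) (hz : Continuous z) (hmono : Monotone z) :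
    ∃ α β, IsGaugeJost f g z α β := by
  -- Composing with `upper` keeps the kernel bounded by `1` for every complex `l`. One fixed point
  -- in the bounded continuous functions on `ℝ × ℂ` then treats all parameters together and is
  -- jointly continuous.
  let κ : ℝ × ℂ → ℝ → ℂ := fun p y => Complex.exp (2 * Complex.I * upper p.2 * (z y - z p.1 : ℝ))
  have hκ : Continuous fun p : (ℝ × ℂ) × ℝ => κ p.1 p.2 := by
    have := continuous_upper
    fun_prop
  have hκ1 : ∀ (p : ℝ × ℂ) y, p.1 < y → ‖κ p y‖ ≤ 1 := fun p y hy =>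
    norm_cexp_phase_le (upper_im_nonneg _) (sub_nonneg.2 (hmono hy.le))
  let T₁ := volterra f hf (fun _ _ => 1) continuous_const (by simp)
  let T₂ := volterra g hg κ hκ hκ1
  have n₁ : ∀ u, ‖T₁ u‖ ≤ 1 / 4 * ‖u‖ := fun u =>
    (norm_volterra_le _ _ _ _ _ _).trans (by gcongr)
  have n₂ : ∀ u, ‖T₂ u‖ ≤ 1 / 4 * ‖u‖ := fun u =>
    (norm_volterra_le _ _ _ _ _ _).trans (by gcongr)
  let Φ : ((ℝ × ℂ) →ᵇ ℂ) × ((ℝ × ℂ) →ᵇ ℂ) → ((ℝ × ℂ) →ᵇ ℂ) × ((ℝ × ℂ) →ᵇ ℂ) :=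
    fun w => (1 - T₁ w.2, -T₂ w.1)
  have hΦ : ContractingWith (1 / 4) Φ := by
    refine ⟨by rw [← NNReal.coe_lt_coe]; norm_num, LipschitzWith.of_dist_le_mul fun w w' => ?_⟩
    rw [Prod.dist_eq, Prod.dist_eq]
    refine max_le ?_ ?_
    · rw [dist_eq_norm, sub_sub_sub_cancel_left, volterra_sub]
      refine (n₁ _).trans ?_
      rw [← dist_eq_norm, dist_comm]
      simp
    · rw [dist_eq_norm, neg_sub_neg, volterra_sub]
      refine (n₂ _).trans ?_
      rw [← dist_eq_norm, dist_comm]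
      simp
  obtain ⟨w, hw⟩ : ∃ w, Φ w = w := ⟨_, hΦ.fixedPoint_isFixedPt⟩
  have e₁ : 1 - T₁ w.2 = w.1 := congrArg Prod.fst hw
  have e₂ : -T₂ w.1 = w.2 := congrArg Prod.snd hw
  have b₁ : ‖w.1 - 1‖ ≤ 1 / 4 * ‖w.2‖ := by
    rw [← e₁, sub_sub_cancel_left, norm_neg]
    exact n₁ _
  have b₂ : ‖w.2‖ ≤ 1 / 4 * ‖w.1‖ := by
    rw [← e₂, norm_neg]
    exact n₂ _
  have b₃ : ‖w.1‖ ≤ ‖w.1 - 1‖ + 1 := by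
    have := norm_add_le (w.1 - 1) 1
    rwa [sub_add_cancel, norm_one] at this
  refine ⟨fun x l => w.1 (x, l), fun x l => w.2 (x, l), ⟨w.1.continuous, w.2.continuous,
    fun x l => ?_, fun x l => ?_, fun x l hl => ?_, fun x l hl => ?_⟩⟩
  · exact ((w.1 - 1).norm_coe_le_norm (x, l)).trans (by linarith)
  · exact (w.2.norm_coe_le_norm (x, l)).trans (by linarith)
  · refine (DFunLike.congr_fun e₁ (x, l)).symm.trans ?_
    simp [T₁, volterra]
  · refine (DFunLike.congr_fun e₂ (x, l)).symm.trans ?_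
    simp [T₂, volterra, κ, upper_eq hl]

end WKI

namespace WKI

open Filter Topology Set ComplexConjugate

/-! ### Uniqueness for Volterra equations -/

theorem integral_Ioi_mul_exp {k : ℝ → ℝ} (hk : Integrable k) (x : ℝ) :
    ∫ y in Ioi x, k y * Real.exp (2 * ∫ t in Ioi y, k t) =
      (Real.exp (2 * ∫ t in Ioi x, k t) - 1) / 2 := by
  have hkc : Integrable fun y => (k y : ℂ) := hk.ofReal
  have h1 := ((HasPrim.of_integral_Ioi hkc).const_mul 2).cexp
  obtain ⟨C, hC⟩ := bounded_cexp_primitive ((HasPrim.of_integral_Ioi hkc).const_mul 2)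
    (hkc.neg.const_mul 2)
  have hi : Integrable fun x => 2 * -(k x : ℂ) * Complex.exp (2 * ∫ y in Ioi x, (k y : ℂ)) :=
    (hkc.neg.const_mul 2).mul_bdd h1.continuous.aestronglyMeasurable (.of_forall hC)
  have hlim := (Complex.continuous_exp.tendsto _).comp
    ((tendsto_integral_Ioi_atTop hkc).const_mul 2)
  rw [mul_zero, Complex.exp_zero] at hlim
  have h2 := h1.integral_Ioi (a := x) hi.integrableOn hlim
  have e : ∀ y, ∫ t in Ioi y, (k t : ℂ) = ((∫ t in Ioi y, k t : ℝ) : ℂ) := fun y => integral_ofReal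
  have e3 : ∀ y, 2 * -(k y : ℂ) * Complex.exp (2 * ((∫ t in Ioi y, k t : ℝ) : ℂ)) =
      ((-2 * (k y * Real.exp (2 * ∫ t in Ioi y, k t)) : ℝ) : ℂ) := fun y => by
    push_cast; ring
  simp only [e, e3] at h2
  rw [integral_complex_ofReal, integral_const_mul] at h2
  have h4 : -2 * ∫ y in Ioi x, k y * Real.exp (2 * ∫ t in Ioi y, k t) =
      1 - Real.exp (2 * ∫ t in Ioi x, k t) := by exact_mod_cast h2
  linarith

/-- A Gronwall argument with weight `e^{2K}`: since `∫ₓ^∞ k e^{2K} = (e^{2K(x)} - 1)/2`, each use of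
the inequality halves the constant in `φ ≤ M e^{2K}`. No smallness of `k` is needed. -/
theorem eq_zero_of_le_integral_Ioi {k φ : ℝ → ℝ} (hk : Integrable k) (hk0 : ∀ x, 0 ≤ k x)
    (hφ0 : ∀ x, 0 ≤ φ x) (hb : ∃ C, ∀ x, φ x ≤ C)
    (h : ∀ x, φ x ≤ ∫ y in Ioi x, k y * φ y) (x : ℝ) : φ x = 0 := by
  obtain ⟨C, hC⟩ := hb
  set K : ℝ → ℝ := fun x => ∫ t in Ioi x, k t with hK
  have hK0 : ∀ x, 0 ≤ K x := fun x => integral_nonneg hk0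
  have hKle : ∀ x, K x ≤ ∫ t, k t := fun x => setIntegral_le_integral hk (.of_forall hk0)
  have hKc : Continuous K := by
    have h1 := (HasPrim.of_integral_Ioi (f := fun y => (k y : ℂ)) hk.ofReal).continuous
    have h2 := Complex.continuous_re.comp h1
    refine h2.congr fun x => ?_
    simp only [Function.comp, hK]
    rw [integral_complex_ofReal, Complex.ofReal_re]
  have hi : Integrable fun y => k y * Real.exp (2 * K y) := by
    refine hk.mul_bdd (c := Real.exp (2 * ∫ t, k t))
      (by fun_prop : Continuous fun y => Real.exp (2 * K y)).aestronglyMeasurable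
      (.of_forall fun y => ?_)
    rw [Real.norm_of_nonneg (Real.exp_pos _).le]
    exact Real.exp_le_exp.2 (by linarith [hKle y])
  have step : ∀ M, 0 ≤ M → (∀ y, φ y ≤ M * Real.exp (2 * K y)) →
      ∀ y, φ y ≤ M / 2 * Real.exp (2 * K y) := fun M hM hle y => calc
    φ y ≤ ∫ t in Ioi y, k t * φ t := h y
    _ ≤ ∫ t in Ioi y, M * (k t * Real.exp (2 * K t)) := by
      refine integral_mono_of_nonneg (.of_forall fun t => mul_nonneg (hk0 t) (hφ0 t))
        (hi.const_mul M).integrableOn (.of_forall fun t => ?_)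
      have := mul_le_mul_of_nonneg_left (hle t) (hk0 t)
      simp only
      linarith
    _ = M * ((Real.exp (2 * K y) - 1) / 2) := by
      rw [integral_const_mul, integral_Ioi_mul_exp hk]
    _ ≤ M / 2 * Real.exp (2 * K y) := by nlinarith
  have hC0 : 0 ≤ C := (hφ0 0).trans (hC 0)
  have all : ∀ (n : ℕ) y, φ y ≤ C / 2 ^ n * Real.exp (2 * K y) := by
    intro n
    induction n with
    | zero =>
      intro y
      have : 1 ≤ Real.exp (2 * K y) := Real.one_le_exp (by linarith [hK0 y])
      simpa using (hC y).trans (le_mul_of_one_le_right hC0 this)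
    | succ n ih =>
      have := step _ (by positivity) ih
      intro y
      rw [pow_succ, ← div_div]
      exact this y
  have hlim : Tendsto (fun n : ℕ => C / 2 ^ n * Real.exp (2 * K x)) atTop (𝓝 0) := by
    have := (tendsto_pow_atTop_nhds_zero_of_lt_one (r := (1 / 2 : ℝ)) (by norm_num)
      (by norm_num)).const_mul (C * Real.exp (2 * K x))
    rw [mul_zero] at this
    refine this.congr fun n => ?_
    rw [one_div, inv_pow]; ring
  exact le_antisymm (ge_of_tendsto' hlim fun n => all n x) (hφ0 x)

/-- A bounded solution of a homogeneous Volterra equation at `+∞` vanishes. -/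
theorem eq_zero_of_volterra_Ioi {V : Type*} [NormedAddCommGroup V] [NormedSpace ℝ V]
    {D : ℝ → V} {N : ℝ → ℝ → V} {k : ℝ → ℝ} (hk : Integrable k) (hk0 : ∀ x, 0 ≤ k x)
    (hD : Continuous D) (hb : ∃ C : ℝ, ∀ x, ‖D x‖ ≤ C) (hN : ∀ x y, x < y → ‖N x y‖ ≤ k y * ‖D y‖)
    (h : ∀ x, D x = ∫ y in Ioi x, N x y) (x : ℝ) : D x = 0 := by
  rw [← norm_eq_zero]
  refine eq_zero_of_le_integral_Ioi hk hk0 (fun _ => norm_nonneg _) hb (fun x => ?_) x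
  obtain ⟨C, hC⟩ := hb
  conv_lhs => rw [h x]
  refine norm_integral_le_of_norm_le ?_ ((ae_restrict_mem measurableSet_Ioi).mono (hN x))
  exact (hk.mul_bdd hD.norm.aestronglyMeasurable (.of_forall fun y => by simpa using hC y)).integrableOn

theorem eq_zero_of_volterra_Iic {V : Type*} [NormedAddCommGroup V] [NormedSpace ℝ V]
    {D : ℝ → V} {N : ℝ → ℝ → V} {k : ℝ → ℝ} (hk : Integrable k) (hk0 : ∀ x, 0 ≤ k x)
    (hD : Continuous D) (hb : ∃ C : ℝ, ∀ x, ‖D x‖ ≤ C) (hN : ∀ x y, y < x → ‖N x y‖ ≤ k y * ‖D y‖)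
    (h : ∀ x, D x = ∫ y in Iic x, N x y) (x : ℝ) : D x = 0 := by
  obtain ⟨C, hC⟩ := hb
  have := eq_zero_of_volterra_Ioi (D := fun x => D (-x)) (N := fun x y => N (-x) (-y))
    hk.comp_neg (fun x => hk0 (-x)) (hD.comp continuous_neg) ⟨C, fun x => hC (-x)⟩
    (fun x y hxy => hN _ _ (neg_lt_neg hxy)) (fun x => by
      rw [integral_comp_neg_Ioi x (fun y => N (-x) y)]
      exact h (-x)) (-x)
  rwa [neg_neg] at this

/-! ### The kernel of the Jost equations -/

/-- Only one entry keeps an exponential. For the first column it is `e^{2iλ(y - x)}`, bounded for `y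
> x` and `Im λ ≥ 0`; for the second column the sign is reversed, which suits `y < x`. This is why
exactly these columns of `m⁽⁺⁾` and `m⁽⁻⁾` extend to the upper half plane. -/
theorem kernelColumn_zero (q : ℝ → ℂ) (l : ℂ) (x y : ℝ) (v : Fin 2 → ℂ) :
    kernelColumn q l 0 x y v =
      ![q y * v 1, -(Complex.exp (2 * Complex.I * l * (y - x : ℝ)) * (conj (q y) * v 0))] := by
  have e1 : Complex.exp (Complex.I * l * (-(x - y) : ℝ)) * Complex.exp (Complex.I * l * (x - y : ℝ)) = 1 := by
    rw [← Complex.exp_add, ← Complex.exp_zero]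
    congr 1; push_cast; ring
  have e2 : Complex.exp (Complex.I * l * (-(x - y) : ℝ)) * Complex.exp (-(Complex.I * l * (x - y : ℝ))) =
      Complex.exp (2 * Complex.I * l * (y - x : ℝ)) := by
    rw [← Complex.exp_add]
    congr 1; push_cast; ring
  funext i
  fin_cases i
  · simp [kernelColumn, expSigma, potential, Matrix.mul_apply, Fin.sum_univ_two] at e1 ⊢
    linear_combination (q y * v 1) * e1
  · simp [kernelColumn, expSigma, potential, Matrix.mul_apply, Fin.sum_univ_two] at e2 ⊢
    linear_combination (conj (q y) * v 0) * e2

theorem kernelColumn_one (q : ℝ → ℂ) (l : ℂ) (x y : ℝ) (v : Fin 2 → ℂ) :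
    kernelColumn q l 1 x y v =
      ![Complex.exp (2 * Complex.I * l * (x - y : ℝ)) * (q y * v 1), -(conj (q y) * v 0)] := by
  have e1 : Complex.exp (-(Complex.I * l * (-(x - y) : ℝ))) * Complex.exp (-(Complex.I * l * (x - y : ℝ))) = 1 := by
    rw [← Complex.exp_add, ← Complex.exp_zero]
    congr 1; push_cast; ring
  have e2 : Complex.exp (-(Complex.I * l * (-(x - y) : ℝ))) * Complex.exp (Complex.I * l * (x - y : ℝ)) =
      Complex.exp (2 * Complex.I * l * (x - y : ℝ)) := by
    rw [← Complex.exp_add]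
    congr 1; push_cast; ring
  funext i
  fin_cases i
  · simp [kernelColumn, expSigma, potential, Matrix.mul_apply, Fin.sum_univ_two] at e2 ⊢
    linear_combination (q y * v 1) * e2
  · simp [kernelColumn, expSigma, potential, Matrix.mul_apply, Fin.sum_univ_two] at e1 ⊢
    linear_combination (conj (q y) * v 0) * e1

end WKI

/-! ### Scalar Jost equations: symmetries and uniqueness -/

namespace WKI

open Filter Topology Set ComplexConjugate

theorem integrable_conj {q : ℝ → ℂ} (hq : Integrable q) : Integrable fun y => conj (q y) :=
  Complex.conjCLE.toContinuousLinearMap.integrable_comp hq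

theorem integrableOn_kernel {q e φ : ℝ → ℂ} {S : Set ℝ} {C : ℝ} (hq : Integrable q)
    (hS : MeasurableSet S) (he : Continuous e) (he1 : ∀ y ∈ S, ‖e y‖ ≤ 1) (hφ : Continuous φ)
    (hC : ∀ y, ‖φ y‖ ≤ C) : IntegrableOn (fun y => e y * (q y * φ y)) S := by
  refine Integrable.mono' (hq.norm.mul_const C).integrableOn
    (he.aestronglyMeasurable.mul (hq.1.mul hφ.aestronglyMeasurable)).restrict
    ((ae_restrict_mem hS).mono fun y hy => ?_)
  rw [norm_mul, norm_mul]
  calc _ ≤ 1 * (‖q y‖ * C) := by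
        gcongr
        · exact he1 y hy
        · exact hC y
    _ = _ := one_mul _

theorem integrableOn_vec {A B : ℝ → ℂ} {S : Set ℝ} (hA : IntegrableOn A S)
    (hB : IntegrableOn B S) : IntegrableOn (fun y => ![A y, B y]) S := by
  refine Integrable.of_eval fun i => ?_
  fin_cases i
  · exact hA
  · exact hB

theorem integral_vec {A B : ℝ → ℂ} {S : Set ℝ} (hA : IntegrableOn A S)
    (hB : IntegrableOn B S) : ∫ y in S, ![A y, B y] = ![∫ y in S, A y, ∫ y in S, B y] := by
  funext i
  rw [eval_integral]
  · fin_cases i <;> rfl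
  · intro i
    fin_cases i
    · exact hA
    · exact hB

theorem bound_apply {m : ℝ → Fin 2 → ℂ} {C : ℝ} (h : ∀ x, ‖m x‖ ≤ C) (i : Fin 2) (x : ℝ) :
    ‖m x i‖ ≤ C := (norm_le_pi_norm _ i).trans (h x)

theorem continuous_phase (l : ℂ) (x : ℝ) :
    Continuous fun y : ℝ => Complex.exp (2 * Complex.I * l * (y - x : ℝ)) := by fun_prop

theorem continuous_phase' (l : ℂ) (x : ℝ) :
    Continuous fun y : ℝ => Complex.exp (2 * Complex.I * l * (x - y : ℝ)) := by fun_prop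

theorem norm_phase_real {l : ℂ} (hl : l.im = 0) (t : ℝ) :
    ‖Complex.exp (2 * Complex.I * l * t)‖ = 1 := by
  rw [Complex.norm_exp]
  simp [Complex.mul_re, hl]

variable {q : ℝ → ℂ} {l : ℂ} {m : ℝ → Fin 2 → ℂ}

theorem vec_eq_iff {v : Fin 2 → ℂ} {a b : ℂ} : v = ![a, b] ↔ v 0 = a ∧ v 1 = b := by
  rw [funext_iff, Fin.forall_fin_two]; simp

/-- The scalar form of the Jost equations at `+∞` for a column with exponential factors
`e₀`, `e₁` in the kernel. -/
theorem isJostPlus_iff_aux {j : Fin 2} (hq : Integrable q) {e₀ e₁ : ℝ → ℝ → ℂ}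
    (hk : ∀ x y v, kernelColumn q l j x y v =
      ![e₀ x y * (q y * v 1), -(e₁ x y * (conj (q y) * v 0))])
    (c₀ : ∀ x, Continuous (e₀ x)) (c₁ : ∀ x, Continuous (e₁ x))
    (b₀ : ∀ x, ∀ y ∈ Ioi x, ‖e₀ x y‖ ≤ 1) (b₁ : ∀ x, ∀ y ∈ Ioi x, ‖e₁ x y‖ ≤ 1) :
    IsJostPlus q l j m ↔ Continuous m ∧ (∃ C : ℝ, ∀ x, ‖m x‖ ≤ C) ∧ ∀ x,
      m x 0 = (Pi.single j 1 : Fin 2 → ℂ) 0 + l * ∫ y in Ioi x, e₀ x y * (q y * m y 1) ∧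
      m x 1 = (Pi.single j 1 : Fin 2 → ℂ) 1 - l * ∫ y in Ioi x, e₁ x y * (conj (q y) * m y 0) := by
  -- For bounded continuous `m` the kernel is automatically integrable, so only the two scalar
  -- equations carry information.
  have main : Continuous m → (∃ C : ℝ, ∀ x, ‖m x‖ ≤ C) → ∀ x,
      IntegrableOn (fun y => kernelColumn q l j x y (m y)) (Ioi x) ∧
      ∫ y in Ioi x, kernelColumn q l j x y (m y) = ![∫ y in Ioi x, e₀ x y * (q y * m y 1),
        -∫ y in Ioi x, e₁ x y * (conj (q y) * m y 0)] := by
    rintro hc ⟨C, hC⟩ x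
    have i0 := integrableOn_kernel hq measurableSet_Ioi (c₀ x) (b₀ x) (continuous_pi_iff.1 hc 1)
      (bound_apply hC 1)
    have i1 := integrableOn_kernel (integrable_conj hq) measurableSet_Ioi (c₁ x) (b₁ x)
      (continuous_pi_iff.1 hc 0) (bound_apply hC 0)
    simp only [hk]
    rw [← integral_neg]
    exact ⟨integrableOn_vec i0 i1.neg, integral_vec i0 i1.neg⟩
  constructor
  · rintro ⟨hc, hb, hi, he⟩
    refine ⟨hc, hb, fun x => ?_⟩
    have := he x
    rw [(main hc hb x).2] at this
    rw [this]
    simp [sub_eq_add_neg]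
  · rintro ⟨hc, hb, he⟩
    refine ⟨hc, hb, fun x => (main hc hb x).1, fun x => ?_⟩
    rw [(main hc hb x).2]
    funext i
    fin_cases i
    · simpa using (he x).1
    · simpa [sub_eq_add_neg] using (he x).2

theorem isJostMinus_iff_aux {j : Fin 2} (hq : Integrable q) {e₀ e₁ : ℝ → ℝ → ℂ}
    (hk : ∀ x y v, kernelColumn q l j x y v =
      ![e₀ x y * (q y * v 1), -(e₁ x y * (conj (q y) * v 0))])
    (c₀ : ∀ x, Continuous (e₀ x)) (c₁ : ∀ x, Continuous (e₁ x))
    (b₀ : ∀ x, ∀ y ∈ Iic x, ‖e₀ x y‖ ≤ 1) (b₁ : ∀ x, ∀ y ∈ Iic x, ‖e₁ x y‖ ≤ 1) :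
    IsJostMinus q l j m ↔ Continuous m ∧ (∃ C : ℝ, ∀ x, ‖m x‖ ≤ C) ∧ ∀ x,
      m x 0 = (Pi.single j 1 : Fin 2 → ℂ) 0 - l * ∫ y in Iic x, e₀ x y * (q y * m y 1) ∧
      m x 1 = (Pi.single j 1 : Fin 2 → ℂ) 1 + l * ∫ y in Iic x, e₁ x y * (conj (q y) * m y 0) := by
  have main : Continuous m → (∃ C : ℝ, ∀ x, ‖m x‖ ≤ C) → ∀ x,
      IntegrableOn (fun y => kernelColumn q l j x y (m y)) (Iic x) ∧
      ∫ y in Iic x, kernelColumn q l j x y (m y) = ![∫ y in Iic x, e₀ x y * (q y * m y 1),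
        -∫ y in Iic x, e₁ x y * (conj (q y) * m y 0)] := by
    rintro hc ⟨C, hC⟩ x
    have i0 := integrableOn_kernel hq measurableSet_Iic (c₀ x) (b₀ x) (continuous_pi_iff.1 hc 1)
      (bound_apply hC 1)
    have i1 := integrableOn_kernel (integrable_conj hq) measurableSet_Iic (c₁ x) (b₁ x)
      (continuous_pi_iff.1 hc 0) (bound_apply hC 0)
    simp only [hk]
    rw [← integral_neg]
    exact ⟨integrableOn_vec i0 i1.neg, integral_vec i0 i1.neg⟩
  constructor
  · rintro ⟨hc, hb, hi, he⟩
    refine ⟨hc, hb, fun x => ?_⟩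
    have := he x
    rw [(main hc hb x).2] at this
    rw [this]
    simp [sub_eq_add_neg]
  · rintro ⟨hc, hb, he⟩
    refine ⟨hc, hb, fun x => (main hc hb x).1, fun x => ?_⟩
    rw [(main hc hb x).2]
    funext i
    fin_cases i
    · simpa using (he x).1
    · simpa [sub_eq_add_neg] using (he x).2

theorem isJostPlus_zero_iff (hq : Integrable q) (hl : 0 ≤ l.im) :
    IsJostPlus q l 0 m ↔ Continuous m ∧ (∃ C : ℝ, ∀ x, ‖m x‖ ≤ C) ∧ ∀ x,
      m x 0 = 1 + l * ∫ y in Ioi x, q y * m y 1 ∧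
      m x 1 = -(l * ∫ y in Ioi x,
        Complex.exp (2 * Complex.I * l * (y - x : ℝ)) * (conj (q y) * m y 0)) := by
  rw [isJostPlus_iff_aux hq (e₀ := fun _ _ => 1)
    (e₁ := fun x y => Complex.exp (2 * Complex.I * l * (y - x : ℝ)))
    (fun x y v => by rw [kernelColumn_zero, one_mul])
    (fun _ => continuous_const) (continuous_phase l) (by simp)
    (fun x y hy => norm_cexp_phase_le hl (sub_nonneg.2 (le_of_lt hy)))]
  simp

theorem isJostMinus_one_iff (hq : Integrable q) (hl : 0 ≤ l.im) :
    IsJostMinus q l 1 m ↔ Continuous m ∧ (∃ C : ℝ, ∀ x, ‖m x‖ ≤ C) ∧ ∀ x,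
      m x 0 = -(l * ∫ y in Iic x,
        Complex.exp (2 * Complex.I * l * (x - y : ℝ)) * (q y * m y 1)) ∧
      m x 1 = 1 + l * ∫ y in Iic x, conj (q y) * m y 0 := by
  rw [isJostMinus_iff_aux hq (e₀ := fun x y => Complex.exp (2 * Complex.I * l * (x - y : ℝ)))
    (e₁ := fun _ _ => 1)
    (fun x y v => by rw [kernelColumn_one, one_mul])
    (continuous_phase' l) (fun _ => continuous_const)
    (fun x y hy => norm_cexp_phase_le hl (sub_nonneg.2 hy)) (by simp)]
  simp

/-- Real `λ` is required here: for `y > x` the phase `e^{2iλ(x - y)}` is unbounded when `Im λ > 0`.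
-/
theorem isJostPlus_one_iff (hq : Integrable q) (hl : l.im = 0) :
    IsJostPlus q l 1 m ↔ Continuous m ∧ (∃ C : ℝ, ∀ x, ‖m x‖ ≤ C) ∧ ∀ x,
      m x 0 = l * ∫ y in Ioi x, Complex.exp (2 * Complex.I * l * (x - y : ℝ)) * (q y * m y 1) ∧
      m x 1 = 1 - l * ∫ y in Ioi x, conj (q y) * m y 0 := by
  rw [isJostPlus_iff_aux hq (e₀ := fun x y => Complex.exp (2 * Complex.I * l * (x - y : ℝ)))
    (e₁ := fun _ _ => 1)
    (fun x y v => by rw [kernelColumn_one, one_mul])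
    (continuous_phase' l) (fun _ => continuous_const)
    (fun x y hy => (norm_phase_real hl _).le) (by simp)]
  simp

theorem isJostMinus_zero_iff (hq : Integrable q) (hl : l.im = 0) :
    IsJostMinus q l 0 m ↔ Continuous m ∧ (∃ C : ℝ, ∀ x, ‖m x‖ ≤ C) ∧ ∀ x,
      m x 0 = 1 - l * ∫ y in Iic x, q y * m y 1 ∧
      m x 1 = l * ∫ y in Iic x,
        Complex.exp (2 * Complex.I * l * (y - x : ℝ)) * (conj (q y) * m y 0) := by
  rw [isJostMinus_iff_aux hq (e₀ := fun _ _ => 1)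
    (e₁ := fun x y => Complex.exp (2 * Complex.I * l * (y - x : ℝ)))
    (fun x y v => by rw [kernelColumn_zero, one_mul])
    (fun _ => continuous_const) (continuous_phase l) (by simp)
    (fun x y hy => (norm_phase_real hl _).le)]
  simp

theorem continuous_vec {a b : ℝ → ℂ} (ha : Continuous a) (hb : Continuous b) :
    Continuous fun x => ![a x, b x] := by
  refine continuous_pi fun i => ?_
  fin_cases i
  · exact ha
  · exact hb

theorem bounded_vec {a b : ℝ → ℂ} (ha : ∃ C : ℝ, ∀ x, ‖a x‖ ≤ C) (hb : ∃ C : ℝ, ∀ x, ‖b x‖ ≤ C) :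
    ∃ C : ℝ, ∀ x, ‖![a x, b x]‖ ≤ C := by
  obtain ⟨A, hA⟩ := ha
  obtain ⟨B, hB⟩ := hb
  refine ⟨max A B, fun x => (pi_norm_le_iff_of_nonneg
    ((norm_nonneg _).trans ((hA 0).trans (le_max_left _ _)))).2 fun i => ?_⟩
  fin_cases i
  · exact (hA x).trans (le_max_left _ _)
  · exact (hB x).trans (le_max_right _ _)

/-- Reflection exchanges the Jost equations at `±∞`. -/
theorem isJostMinus_one_reflect (hq : Integrable q) (hl : 0 ≤ l.im)
    (h : IsJostPlus (fun x => conj (q (-x))) l 0 m) :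
    IsJostMinus q l 1 (fun x => ![m (-x) 1, m (-x) 0]) := by
  obtain ⟨hc, ⟨C, hC⟩, he⟩ := (isJostPlus_zero_iff (integrable_conj hq.comp_neg) hl).1 h
  refine (isJostMinus_one_iff hq hl).2 ⟨?_, ?_, fun x => ⟨?_, ?_⟩⟩
  · exact continuous_vec ((continuous_pi_iff.1 hc 1).comp continuous_neg)
      ((continuous_pi_iff.1 hc 0).comp continuous_neg)
  · exact bounded_vec ⟨C, fun x => bound_apply hC 1 _⟩ ⟨C, fun x => bound_apply hC 0 _⟩
  · have := (he (-x)).2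
    simp only [Complex.conj_conj] at this
    rw [← integral_comp_neg_Iic] at this
    simp only [neg_neg] at this
    simpa [add_comm, ← sub_eq_add_neg] using this
  · have := (he (-x)).1
    rw [← integral_comp_neg_Iic] at this
    simpa using this

/-- Complex conjugation exchanges the columns of the Jost solutions for real `λ`. -/
theorem IsJostPlus.conj_column (hq : Integrable q) (hl : l.im = 0) (h : IsJostPlus q l 0 m) :
    IsJostPlus q l 1 (fun x => ![-conj (m x 1), conj (m x 0)]) := by
  obtain ⟨hc, ⟨C, hC⟩, he⟩ := (isJostPlus_zero_iff hq hl.ge).1 h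
  have hlc : conj l = l := Complex.conj_eq_iff_im.2 hl
  refine (isJostPlus_one_iff hq hl).2 ⟨?_, ?_, fun x => ⟨?_, ?_⟩⟩
  · exact continuous_vec ((continuous_pi_iff.1 hc 1).star.neg) ((continuous_pi_iff.1 hc 0).star)
  · exact bounded_vec ⟨C, fun x => by simpa using bound_apply hC 1 x⟩
      ⟨C, fun x => by simpa using bound_apply hC 0 x⟩
  · have := congrArg conj (he x).2
    simp only [map_neg, map_mul, ← integral_conj, ← Complex.exp_conj, hlc, Complex.conj_I,
      Complex.conj_ofReal, Complex.conj_conj, map_ofNat] at this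
    simp only [Matrix.cons_val_zero, Matrix.cons_val_one, this, neg_neg]
    congr 3
    funext y
    congr 2
    push_cast; ring
  · have := congrArg conj (he x).1
    simp only [map_add, map_mul, map_one, ← integral_conj, hlc] at this
    simp only [Matrix.cons_val_zero, Matrix.cons_val_one, this, mul_neg, integral_neg]
    ring

theorem IsJostMinus.conj_column (hq : Integrable q) (hl : l.im = 0) (h : IsJostMinus q l 1 m) :
    IsJostMinus q l 0 (fun x => ![conj (m x 1), -conj (m x 0)]) := by
  obtain ⟨hc, ⟨C, hC⟩, he⟩ := (isJostMinus_one_iff hq hl.ge).1 h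
  have hlc : conj l = l := Complex.conj_eq_iff_im.2 hl
  refine (isJostMinus_zero_iff hq hl).2 ⟨?_, ?_, fun x => ⟨?_, ?_⟩⟩
  · exact continuous_vec ((continuous_pi_iff.1 hc 1).star) ((continuous_pi_iff.1 hc 0).star.neg)
  · exact bounded_vec ⟨C, fun x => by simpa using bound_apply hC 1 x⟩
      ⟨C, fun x => by simpa using bound_apply hC 0 x⟩
  · have := congrArg conj (he x).2
    simp only [map_add, map_mul, map_one, ← integral_conj, hlc, Complex.conj_conj] at this
    simp only [Matrix.cons_val_zero, Matrix.cons_val_one, this, mul_neg, integral_neg]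
    ring
  · have := congrArg conj (he x).1
    simp only [map_neg, map_mul, ← integral_conj, ← Complex.exp_conj, hlc, Complex.conj_I,
      Complex.conj_ofReal, map_ofNat] at this
    simp only [Matrix.cons_val_zero, Matrix.cons_val_one, this, neg_neg]
    congr 3
    funext y
    congr 2
    push_cast; ring

theorem norm_kernel_vec_le {e₀ e₁ a : ℂ} {v : Fin 2 → ℂ} (h₀ : ‖e₀‖ ≤ 1) (h₁ : ‖e₁‖ ≤ 1) :
    ‖![e₀ * (a * v 1), -(e₁ * (conj a * v 0))]‖ ≤ ‖a‖ * ‖v‖ := by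
  refine (pi_norm_le_iff_of_nonneg (by positivity)).2 fun i => ?_
  fin_cases i
  · simp only [Fin.zero_eta, Matrix.cons_val_zero, norm_mul]
    calc _ ≤ 1 * (‖a‖ * ‖v‖) := by gcongr; exact norm_le_pi_norm _ _
      _ = _ := one_mul _
  · simp only [Fin.mk_one, Matrix.cons_val_one, Matrix.cons_val_zero, norm_neg, norm_mul, RCLike.norm_conj]
    calc _ ≤ 1 * (‖a‖ * ‖v‖) := by gcongr; exact norm_le_pi_norm _ _
      _ = _ := one_mul _

theorem kernelColumn_sub (q : ℝ → ℂ) (l : ℂ) (j : Fin 2) (x y : ℝ) (v w : Fin 2 → ℂ) :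
    kernelColumn q l j x y (v - w) = kernelColumn q l j x y v - kernelColumn q l j x y w := by
  simp only [kernelColumn, Matrix.mulVec_sub, smul_sub]

/-- The difference solves the homogeneous Volterra equation with kernel dominated by `|λ||q|`. This
identifies the chosen `mPlus` with the column produced by the gauge. -/
theorem IsJostPlus.unique {m' : ℝ → Fin 2 → ℂ} (hq : Integrable q) (hl : 0 ≤ l.im)
    (h : IsJostPlus q l 0 m) (h' : IsJostPlus q l 0 m') : m = m' := by
  funext x
  obtain ⟨C, hC⟩ := h.bounded
  obtain ⟨C', hC'⟩ := h'.bounded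
  rw [← sub_eq_zero]
  refine eq_zero_of_volterra_Ioi (D := fun x => m x - m' x) (k := fun y => ‖l‖ * ‖q y‖)
    (N := fun x y => l • kernelColumn q l 0 x y (m y - m' y)) (hq.norm.const_mul _)
    (fun _ => by positivity) (h.continuous.sub h'.continuous)
    ⟨C + C', fun x => (norm_sub_le _ _).trans (add_le_add (hC x) (hC' x))⟩ (fun x y hxy => ?_)
    (fun x => ?_) x
  · rw [norm_smul, mul_assoc]
    gcongr
    rw [kernelColumn_zero]
    have := norm_kernel_vec_le (e₀ := 1) (a := q y) (v := m y - m' y) (by simp)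
      (norm_cexp_phase_le hl (sub_nonneg.2 hxy.le))
    rwa [one_mul] at this
  · rw [integral_smul]
    simp only [kernelColumn_sub]
    rw [integral_sub (h.integrable x) (h'.integrable x), smul_sub]
    conv_lhs => rw [h.equation x, h'.equation x]
    abel

theorem IsJostMinus.unique {m' : ℝ → Fin 2 → ℂ} (hq : Integrable q) (hl : 0 ≤ l.im)
    (h : IsJostMinus q l 1 m) (h' : IsJostMinus q l 1 m') : m = m' := by
  funext x
  obtain ⟨C, hC⟩ := h.bounded
  obtain ⟨C', hC'⟩ := h'.bounded
  rw [← sub_eq_zero]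
  refine eq_zero_of_volterra_Iic (D := fun x => m x - m' x) (k := fun y => ‖l‖ * ‖q y‖)
    (N := fun x y => -(l • kernelColumn q l 1 x y (m y - m' y))) (hq.norm.const_mul _)
    (fun _ => by positivity) (h.continuous.sub h'.continuous)
    ⟨C + C', fun x => (norm_sub_le _ _).trans (add_le_add (hC x) (hC' x))⟩ (fun x y hxy => ?_)
    (fun x => ?_) x
  · rw [norm_neg, norm_smul, mul_assoc]
    gcongr
    rw [kernelColumn_one]
    have := norm_kernel_vec_le (e₁ := 1) (a := q y) (v := m y - m' y)
      (norm_cexp_phase_le hl (sub_nonneg.2 hxy.le)) (by simp)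
    rwa [one_mul] at this
  · rw [integral_neg, integral_smul]
    simp only [kernelColumn_sub]
    rw [integral_sub (h.integrable x) (h'.integrable x), smul_sub]
    conv_lhs => rw [h.equation x, h'.equation x]
    abel

end WKI

namespace WKI

open Filter Topology Set ComplexConjugate

/-! ### From the gauge to the original problem -/

theorem Gauge.continuous_z {q : ℝ → ℂ} (G : Gauge q) : Continuous G.z :=
  continuous_iff_continuousAt.2 fun x => (G.z_deriv x).continuousAt

/-- From `z' = p ≥ 1`. The phase expands distances, which is what the `L²` bound for oscillatory
integrals rests on. -/
theorem Gauge.sub_le_z_sub {q : ℝ → ℂ} (G : Gauge q) {x y : ℝ} (h : x ≤ y) :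
    y - x ≤ G.z y - G.z x := by
  have hm : Monotone fun x => G.z x - x :=
    monotone_of_hasDerivAt_nonneg (fun x => (G.z_deriv x).sub (hasDerivAt_id x))
      fun x => sub_nonneg.2 (G.one_le_p x)
  have := hm h
  simp only at this
  linarith

theorem Gauge.monotone_z {q : ℝ → ℂ} (G : Gauge q) : Monotone G.z := fun x y h => by
  linarith [G.sub_le_z_sub h]

theorem Gauge.hasPrim_cexp_z {q : ℝ → ℂ} (G : Gauge q) (a : ℂ) :
    HasPrim (fun x => Complex.exp (a * G.z x)) (fun x => a * G.p x * Complex.exp (a * G.z x)) := by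
  have hc := G.p_cont
  have hz := G.continuous_z
  refine .of_continuous_deriv (by fun_prop) fun x => ?_
  have := ((G.z_deriv x).ofReal_comp.const_mul a).cexp
  rwa [mul_comm] at this

theorem hasPrim_cexp (a : ℂ) :
    HasPrim (fun x : ℝ => Complex.exp (a * x)) (fun x => a * Complex.exp (a * x)) := by
  refine .of_continuous_deriv (by fun_prop) fun x => ?_
  have := ((hasDerivAt_id x).ofReal_comp.const_mul a).cexp
  simpa [mul_comm] using this

namespace IsGaugeJost

variable {f g : ℝ → ℂ} {z : ℝ → ℝ} {α β : ℝ → ℂ → ℂ}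

theorem α_norm (h : IsGaugeJost f g z α β) (x : ℝ) (l : ℂ) : ‖α x l‖ ≤ 4 / 3 := by
  have := norm_add_le (α x l - 1) 1
  rw [sub_add_cancel, norm_one] at this
  linarith [h.α_bd x l]

theorem continuous_α (h : IsGaugeJost f g z α β) (l : ℂ) : Continuous fun x => α x l :=
  h.cont_α.comp (by fun_prop : Continuous fun x : ℝ => (x, l))

theorem continuous_β (h : IsGaugeJost f g z α β) (l : ℂ) : Continuous fun x => β x l :=
  h.cont_β.comp (by fun_prop : Continuous fun x : ℝ => (x, l))

theorem integrable_fβ (h : IsGaugeJost f g z α β) (hf : Integrable f) (l : ℂ) :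
    Integrable fun y => f y * β y l :=
  hf.mul_bdd (h.continuous_β l).aestronglyMeasurable (.of_forall fun y => h.β_bd y l)

theorem integrable_gα (h : IsGaugeJost f g z α β) (hg : Integrable g) (l : ℂ) :
    Integrable fun y => g y * α y l :=
  hg.mul_bdd (h.continuous_α l).aestronglyMeasurable (.of_forall fun y => h.α_norm y l)

theorem hasPrim_α (h : IsGaugeJost f g z α β) (hf : Integrable f) {l : ℂ} (hl : 0 ≤ l.im) :
    HasPrim (fun x => α x l) (fun x => f x * β x l) := by
  refine (((HasPrim.const 1).sub (.of_integral_Ioi (h.integrable_fβ hf l))).congr_left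
    fun x => (h.α_eq x l hl).symm).congr' fun x => by ring

theorem tendsto_α (h : IsGaugeJost f g z α β) (hf : Integrable f) {l : ℂ} (hl : 0 ≤ l.im) :
    Tendsto (fun x => α x l) atTop (𝓝 1) := by
  have := (tendsto_integral_Ioi_atTop (h.integrable_fβ hf l)).const_sub 1
  rw [sub_zero] at this
  exact this.congr fun x => (h.α_eq x l hl).symm

theorem tendsto_β (h : IsGaugeJost f g z α β) (hg : Integrable g) (hz : Monotone z)
    {l : ℂ} (hl : 0 ≤ l.im) : Tendsto (fun x => β x l) atTop (𝓝 0) := by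
  have hn := (h.integrable_gα hg l).norm
  have h1 := tendsto_integral_Ioi_atTop (f := fun y => (‖g y * α y l‖ : ℂ)) hn.ofReal
  refine squeeze_zero_norm (fun x => ?_) (h1.norm.trans (by simp))
  rw [h.β_eq x l hl, norm_neg, integral_complex_ofReal, Complex.norm_real,
    Real.norm_of_nonneg (integral_nonneg fun _ => norm_nonneg _)]
  refine norm_integral_le_of_norm_le hn.integrableOn
    ((ae_restrict_mem measurableSet_Ioi).mono fun y hy => ?_)
  rw [norm_mul]
  exact mul_le_of_le_one_left (norm_nonneg _)
    (norm_cexp_phase_le hl (sub_nonneg.2 (hz (le_of_lt hy))))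

end IsGaugeJost

/-- The integral equation is factored as `β = -e^{-2iλz} ∫ₓ^∞ e^{2iλz} gα` and differentiated as a
product. -/
theorem Gauge.hasPrim_β {q : ℝ → ℂ} (G : Gauge q) {α β : ℝ → ℂ → ℂ}
    (h : IsGaugeJost G.f G.g G.z α β) {l : ℂ} (hl : 0 ≤ l.im) :
    HasPrim (fun x => β x l) (fun x => -(2 * Complex.I * l) * G.p x * β x l + G.g x * α x l) := by
  have hi := h.integrable_gα G.g_int l
  have hz := G.continuous_z
  have hc : Continuous fun y => Complex.exp (2 * Complex.I * l * G.z y) := by fun_prop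
  have hw : LocallyIntegrable fun y => Complex.exp (2 * Complex.I * l * G.z y) * (G.g y * α y l) := by
    simpa only [mul_comm] using locallyIntegrable_mul_continuous hi.locallyIntegrable hc
  have key : ∀ x y : ℝ, Complex.exp (2 * Complex.I * l * G.z y) * (G.g y * α y l) =
      Complex.exp (2 * Complex.I * l * G.z x) *
        (Complex.exp (2 * Complex.I * l * (G.z y - G.z x : ℝ)) * (G.g y * α y l)) := fun x y => by
    have : Complex.exp (2 * Complex.I * l * G.z y) = Complex.exp (2 * Complex.I * l * G.z x) *
        Complex.exp (2 * Complex.I * l * (G.z y - G.z x : ℝ)) := by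
      rw [← Complex.exp_add]
      congr 1; push_cast; ring
    rw [this]; ring
  have hio : ∀ x, IntegrableOn (fun y => Complex.exp (2 * Complex.I * l * G.z y) *
      (G.g y * α y l)) (Ioi x) := fun x => by
    simp only [key x]
    refine Integrable.const_mul ?_ _
    refine Integrable.mono' hi.norm.integrableOn
      ((by fun_prop : Continuous fun y => Complex.exp (2 * Complex.I * l *
        (G.z y - G.z x : ℝ))).aestronglyMeasurable.mul hi.1).restrict
      ((ae_restrict_mem measurableSet_Ioi).mono fun y hy => ?_)
    rw [norm_mul]
    exact mul_le_of_le_one_left (norm_nonneg _)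
      (norm_cexp_phase_le hl (sub_nonneg.2 (G.monotone_z (le_of_lt hy))))
  have hE : ∀ x : ℝ, Complex.exp (-(2 * Complex.I * l) * G.z x) *
      Complex.exp (2 * Complex.I * l * G.z x) = 1 := fun x => by
    rw [← Complex.exp_add, neg_mul, neg_add_cancel, Complex.exp_zero]
  have eβ : ∀ x, Complex.exp (-(2 * Complex.I * l) * G.z x) *
      -(∫ y in Ioi x, Complex.exp (2 * Complex.I * l * G.z y) * (G.g y * α y l)) = β x l := fun x => by
    rw [h.β_eq x l hl]
    simp only [key x]
    rw [integral_const_mul]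
    linear_combination (-(∫ y in Ioi x, Complex.exp (2 * Complex.I * l * (G.z y - G.z x : ℝ)) *
      (G.g y * α y l))) * hE x
  refine (((G.hasPrim_cexp_z (-(2 * Complex.I * l))).mul (HasPrim.of_integral_Ioi' hw hio).neg).congr_left
    eβ).congr' fun x => ?_
  rw [← eβ x]
  linear_combination (G.g x * α x l) * hE x

/-- The column `κ e^{iλ(z - x)} G (α, β)`. -/
noncomputable def Gauge.column {q : ℝ → ℂ} (G : Gauge q) (κ : ℂ) (α β : ℝ → ℂ → ℂ) (l : ℂ) (x : ℝ) :
    Fin 2 → ℂ :=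
  ![κ * (Complex.exp (Complex.I * l * (G.z x - x : ℝ)) *
      (G.E x * α x l - conj (G.ρ x * G.E x) * β x l)),
    κ * (Complex.exp (Complex.I * l * (G.z x - x : ℝ)) *
      (G.ρ x * G.E x * α x l + conj (G.E x) * β x l))]

/-- The eigenvector relations `q_mul` and `conj_q` account for the terms with `λ`; `f_mul` and
`g_mul` account for the derivative of the gauge matrix. -/
theorem Gauge.hasPrim_column {q : ℝ → ℂ} (G : Gauge q) {α β : ℝ → ℂ → ℂ}
    (h : IsGaugeJost G.f G.g G.z α β) {l : ℂ} (hl : 0 ≤ l.im) (κ : ℂ) :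
    HasPrim (fun x => G.column κ α β l x 0) (fun x => -(l * (q x * G.column κ α β l x 1))) ∧
    HasPrim (fun x => G.column κ α β l x 1) (fun x => -(2 * Complex.I * l) * G.column κ α β l x 1 +
      l * (conj (q x) * G.column κ α β l x 0)) := by
  have hα := h.hasPrim_α G.f_int hl
  have hβ := G.hasPrim_β h hl
  have hX : HasPrim (fun x => Complex.exp (Complex.I * l * (G.z x - x : ℝ)))
      (fun x => Complex.I * l * (G.p x - 1) * Complex.exp (Complex.I * l * (G.z x - x : ℝ))) := by
    refine (((G.hasPrim_cexp_z (Complex.I * l)).mul (hasPrim_cexp (-(Complex.I * l)))).congr_left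
      fun x => ?_).congr' fun x => ?_
    · rw [← Complex.exp_add]
      congr 1; push_cast; ring
    · have : Complex.exp (Complex.I * l * (G.z x - x : ℝ)) =
          Complex.exp (Complex.I * l * G.z x) * Complex.exp (-(Complex.I * l) * x) := by
        rw [← Complex.exp_add]
        congr 1; push_cast; ring
      rw [this]; ring
  constructor
  · refine ((hX.mul ((G.hasPrim_E.mul hα).sub (G.hasPrim_ρE.conjugate.mul hβ))).const_mul κ).congr'
      fun x => ?_
    have e1 := G.f_mul x
    have e2 := G.g_mul x
    have e3 := G.q_mul x
    have e4 := congrArg conj (G.conj_q x)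
    simp only [map_mul, map_add, map_one, Complex.conj_I, Complex.conj_ofReal, Complex.conj_conj] at e4
    simp only [Gauge.column, Matrix.cons_val_zero, Matrix.cons_val_one, map_mul]
    set X := Complex.exp (Complex.I * l * (G.z x - x : ℝ))
    linear_combination κ * X * (β x l * e1 - conj (G.ρ x) * α x l * e2 + l * G.E x * α x l * e3 +
      l * conj (G.E x) * β x l * e4)
  · refine ((hX.mul ((G.hasPrim_ρE.mul hα).add (G.hasPrim_E.conjugate.mul hβ))).const_mul κ).congr'
      fun x => ?_
    have e1 := G.f_mul x
    have e2 := G.g_mul x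
    have e3 := congrArg conj (G.q_mul x)
    have e4 := G.conj_q x
    simp only [map_mul, map_neg, map_sub, map_one, Complex.conj_I, Complex.conj_ofReal] at e3
    simp only [Gauge.column, Matrix.cons_val_zero, Matrix.cons_val_one, map_mul, map_neg,
      Complex.conj_conj]
    set X := Complex.exp (Complex.I * l * (G.z x - x : ℝ))
    linear_combination κ * X * (G.ρ x * β x l * e1 + α x l * e2 - l * G.E x * α x l * e4 +
      l * conj (G.E x) * β x l * e3)

theorem Gauge.exists_bound_phase {q : ℝ → ℂ} (G : Gauge q) (l : ℂ) :
    ∃ C : ℝ, ∀ x, ‖Complex.exp (Complex.I * l * (G.z x - x : ℝ))‖ ≤ C := by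
  obtain ⟨C, hC⟩ := G.z_bdd
  refine ⟨Real.exp (‖l‖ * C), fun x => ?_⟩
  rw [Complex.norm_exp]
  refine Real.exp_le_exp.2 ((Complex.re_le_norm _).trans ?_)
  rw [norm_mul, norm_mul, Complex.norm_I, one_mul, Complex.norm_real]
  gcongr
  exact hC x

theorem Gauge.bounded_column {q : ℝ → ℂ} (G : Gauge q) {α β : ℝ → ℂ → ℂ}
    (h : IsGaugeJost G.f G.g G.z α β) (l κ : ℂ) : ∃ C : ℝ, ∀ x, ‖G.column κ α β l x‖ ≤ C := by
  obtain ⟨X, hX⟩ := G.exists_bound_phase l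
  obtain ⟨E, hE⟩ := G.E_bdd
  obtain ⟨R, hR⟩ := G.ρ_bdd
  have hR0 := (norm_nonneg _).trans (hR 0)
  have hX0 := (norm_nonneg _).trans (hX 0)
  have hE0 := (norm_nonneg _).trans (hE 0)
  refine bounded_vec ⟨‖κ‖ * (X * (E * (4 / 3) + R * E * (1 / 3))), fun x => ?_⟩
    ⟨‖κ‖ * (X * (R * E * (4 / 3) + E * (1 / 3))), fun x => ?_⟩
  · rw [norm_mul, norm_mul]
    gcongr
    · exact hX x
    · refine (norm_sub_le _ _).trans ?_
      simp only [norm_mul, RCLike.norm_conj]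
      gcongr
      exacts [hE x, h.α_norm x l, hR x, hE x, h.β_bd x l]
  · rw [norm_mul, norm_mul]
    gcongr
    · exact hX x
    · refine (norm_add_le _ _).trans ?_
      simp only [norm_mul, RCLike.norm_conj]
      gcongr
      exacts [hR x, hE x, h.α_norm x l, hE x, h.β_bd x l]

/-- For a suitable normalisation, the gauge transformation of a Jost solution is the first column
of `m⁽⁺⁾`. -/
theorem Gauge.exists_isJostPlus {q : ℝ → ℂ} (G : Gauge q) {α β : ℝ → ℂ → ℂ}
    (h : IsGaugeJost G.f G.g G.z α β) {l : ℂ} (hl : 0 ≤ l.im) :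
    ∃ κ : ℂ, κ ≠ 0 ∧ IsJostPlus q l 0 (G.column κ α β l) := by
  obtain ⟨e, he, hE⟩ := G.E_top
  obtain ⟨c, hc⟩ := G.z_top
  have he' : Complex.exp (Complex.I * l * c) ≠ 0 := Complex.exp_ne_zero _
  -- The factor cancels the limit of `e^{iλ(z - x)} E` at `+∞`, so that the column tends to `(1,
  -- 0)`.
  refine ⟨(Complex.exp (Complex.I * l * c) * e)⁻¹, inv_ne_zero (mul_ne_zero he' he), ?_⟩
  set κ := (Complex.exp (Complex.I * l * c) * e)⁻¹ with hκ
  obtain ⟨h0, h1⟩ := G.hasPrim_column h hl κ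
  have hb := G.bounded_column h l κ
  have hcont : Continuous (G.column κ α β l) := by
    refine continuous_pi fun i => ?_
    fin_cases i
    · exact h0.continuous
    · exact h1.continuous
  have hα := h.tendsto_α G.f_int hl
  have hβ := h.tendsto_β G.g_int G.monotone_z hl
  have hEc : Tendsto (fun x => conj (G.E x)) atTop (𝓝 (conj e)) :=
    (Complex.continuous_conj.tendsto _).comp hE
  have hρE : Tendsto (fun x => G.ρ x * G.E x) atTop (𝓝 0) := by simpa using G.ρ_top.mul hE
  have hρE' : Tendsto (fun x => conj (G.ρ x * G.E x)) atTop (𝓝 0) := by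
    have := (Complex.continuous_conj.tendsto _).comp hρE
    rwa [map_zero] at this
  have hX : Tendsto (fun x => Complex.exp (Complex.I * l * (G.z x - x : ℝ))) atTop
      (𝓝 (Complex.exp (Complex.I * l * c))) :=
    ((by fun_prop : Continuous fun t : ℝ => Complex.exp (Complex.I * l * t)).tendsto c).comp hc
  have t0 : Tendsto (fun x => G.column κ α β l x 0) atTop (𝓝 1) := by
    have := (hX.mul ((hE.mul hα).sub (hρE'.mul hβ))).const_mul κ
    rwa [mul_one, zero_mul, sub_zero, hκ, inv_mul_cancel₀ (mul_ne_zero he' he)] at this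
  have t1 : Tendsto (fun x => G.column κ α β l x 1) atTop (𝓝 0) := by
    have := (hX.mul ((hρE.mul hα).add (hEc.mul hβ))).const_mul κ
    rwa [zero_mul, mul_zero, add_zero, mul_zero, mul_zero] at this
  refine (isJostPlus_zero_iff G.q_int hl).2 ⟨hcont, hb, fun x => ⟨?_, ?_⟩⟩
  all_goals obtain ⟨C, hC⟩ := hb
  · have hi : IntegrableOn (fun y => -(l * (q y * G.column κ α β l y 1))) (Ioi x) :=
      (((G.q_int.mul_bdd h1.continuous.aestronglyMeasurable
        (.of_forall fun y => bound_apply hC 1 y)).const_mul l).neg).integrableOn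
    have := h0.integral_Ioi hi t0
    rw [integral_neg, integral_const_mul] at this
    linear_combination this
  -- The integrating factor `e^{2iλy}` removes the diagonal term; it is bounded by `1` near `+∞`, so
  -- the boundary term vanishes.
  · have hp := ((hasPrim_cexp (2 * Complex.I * l)).mul h1).congr' (g := fun y =>
      l * (Complex.exp (2 * Complex.I * l * y) * (conj (q y) * G.column κ α β l y 0)))
      fun y => by ring
    have key : ∀ y : ℝ, Complex.exp (2 * Complex.I * l * y) = Complex.exp (2 * Complex.I * l * x) *
        Complex.exp (2 * Complex.I * l * (y - x : ℝ)) := fun y => by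
      rw [← Complex.exp_add]
      congr 1; push_cast; ring
    have hi' := integrableOn_kernel (integrable_conj G.q_int) measurableSet_Ioi (S := Ioi x)
      (continuous_phase l x) (fun y hy => norm_cexp_phase_le hl (sub_nonneg.2 (le_of_lt hy)))
      h0.continuous (bound_apply hC 0)
    have hi : IntegrableOn (fun y : ℝ => l * (Complex.exp (2 * Complex.I * l * y) *
        (conj (q y) * G.column κ α β l y 0))) (Ioi x) := by
      refine ((hi'.const_mul (Complex.exp (2 * Complex.I * l * x))).const_mul l).congr
        (.of_forall fun y => ?_)
      simp only [key y]; ring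
    have ht : Tendsto (fun y : ℝ => Complex.exp (2 * Complex.I * l * y) * G.column κ α β l y 1)
        atTop (𝓝 0) := by
      refine squeeze_zero_norm' ?_ (t1.norm.trans (by simp))
      filter_upwards [eventually_ge_atTop 0] with y hy
      rw [norm_mul]
      exact mul_le_of_le_one_left (norm_nonneg _) (norm_cexp_phase_le hl hy)
    have := hp.integral_Ioi hi ht
    rw [integral_const_mul] at this
    have e2 : ∫ y in Ioi x, Complex.exp (2 * Complex.I * l * y) *
        (conj (q y) * G.column κ α β l y 0) = Complex.exp (2 * Complex.I * l * x) *
          ∫ y in Ioi x, Complex.exp (2 * Complex.I * l * (y - x : ℝ)) *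
            (conj (q y) * G.column κ α β l y 0) := by
      rw [← integral_const_mul]
      congr 1
      funext y
      rw [key y, mul_assoc]
    rw [e2] at this
    apply mul_left_cancel₀ (Complex.exp_ne_zero (2 * Complex.I * l * x))
    linear_combination this

end WKI

namespace WKI

open Filter Topology Set ComplexConjugate

/-! ### The scattering coefficients -/

/-- The Jost equation at `-∞` for the column `V = e^{-iλxσ₃} ψ`, with limit `c` at `-∞`. -/
structure IsInteraction (q : ℝ → ℂ) (l : ℝ) (c : Fin 2 → ℂ) (V : ℝ → Fin 2 → ℂ) : Prop where
  continuous : Continuous V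
  bounded : ∃ C : ℝ, ∀ x, ‖V x‖ ≤ C
  eq_zero : ∀ x, V x 0 = c 0 - l * ∫ y in Iic x,
    Complex.exp (2 * Complex.I * l * (-y : ℝ)) * (q y * V y 1)
  eq_one : ∀ x, V x 1 = c 1 + l * ∫ y in Iic x,
    Complex.exp (2 * Complex.I * l * y) * (conj (q y) * V y 0)

/-- The column `e^{-iλxσ₃} ψ` in terms of the column `m` of `ψ e^{-iλxσ₃}`. -/
noncomputable def interaction (l : ℝ) (j : Fin 2) (m : ℝ → Fin 2 → ℂ) (x : ℝ) : Fin 2 → ℂ :=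
  if j = 0 then ![m x 0, Complex.exp (2 * Complex.I * l * x) * m x 1]
  else ![Complex.exp (2 * Complex.I * l * (-x : ℝ)) * m x 0, m x 1]

variable {q : ℝ → ℂ} {l : ℝ} {m n V W : ℝ → Fin 2 → ℂ} {c d : Fin 2 → ℂ}

theorem norm_phase (l t : ℝ) : ‖Complex.exp (2 * Complex.I * l * t)‖ = 1 :=
  norm_phase_real (Complex.ofReal_im l) t

theorem continuous_interaction (j : Fin 2) (h : Continuous m) : Continuous (interaction l j m) := by
  have h0 := continuous_pi_iff.1 h 0
  have h1 := continuous_pi_iff.1 h 1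
  unfold interaction
  split_ifs
  · exact continuous_vec h0 (by fun_prop)
  · exact continuous_vec (by fun_prop) h1

theorem bounded_interaction (j : Fin 2) (h : ∃ C : ℝ, ∀ x, ‖m x‖ ≤ C) :
    ∃ C : ℝ, ∀ x, ‖interaction l j m x‖ ≤ C := by
  obtain ⟨C, hC⟩ := h
  unfold interaction
  split_ifs
  · refine bounded_vec ⟨C, bound_apply hC 0⟩ ⟨C, fun x => ?_⟩
    rw [norm_mul, norm_phase, one_mul]
    exact bound_apply hC 1 x
  · refine bounded_vec ⟨C, fun x => ?_⟩ ⟨C, bound_apply hC 1⟩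
    rw [norm_mul, norm_phase, one_mul]
    exact bound_apply hC 0 x

theorem integrable_phase_mul (hq : Integrable q) {φ : ℝ → ℂ} {e : ℝ → ℝ} (he : Continuous e)
    (hφ : Continuous φ) {C : ℝ} (hC : ∀ y, ‖φ y‖ ≤ C) :
    Integrable fun y => Complex.exp (2 * Complex.I * l * e y) * (q y * φ y) := by
  have := integrableOn_kernel (S := univ) hq .univ
    (by fun_prop : Continuous fun y => Complex.exp (2 * Complex.I * l * e y))
    (fun y _ => (norm_phase l _).le) hφ hC
  rwa [integrableOn_univ] at this

theorem IsInteraction.integrable_zero (hq : Integrable q) (h : IsInteraction q l c V) :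
    Integrable fun y : ℝ => Complex.exp (2 * Complex.I * l * (-y : ℝ)) * (q y * V y 1) := by
  obtain ⟨C, hC⟩ := h.bounded
  exact integrable_phase_mul hq continuous_neg (continuous_pi_iff.1 h.continuous 1) (bound_apply hC 1)

theorem IsInteraction.integrable_one (hq : Integrable q) (h : IsInteraction q l c V) :
    Integrable fun y : ℝ => Complex.exp (2 * Complex.I * l * y) * (conj (q y) * V y 0) := by
  obtain ⟨C, hC⟩ := h.bounded
  exact integrable_phase_mul (integrable_conj hq) continuous_id
    (continuous_pi_iff.1 h.continuous 0) (bound_apply hC 0)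

theorem IsInteraction.tendsto (hq : Integrable q) (h : IsInteraction q l c V) (i : Fin 2) :
    Tendsto (fun x => V x i) atBot (𝓝 (c i)) := by
  fin_cases i
  · have := ((tendsto_integral_Iic_atBot (h.integrable_zero hq)).const_mul (l : ℂ)).const_sub (c 0)
    rw [mul_zero, sub_zero] at this
    exact this.congr fun x => (h.eq_zero x).symm
  · have := ((tendsto_integral_Iic_atBot (h.integrable_one hq)).const_mul (l : ℂ)).const_add (c 1)
    rw [mul_zero, add_zero] at this
    exact this.congr fun x => (h.eq_one x).symm

theorem IsInteraction.combination (hq : Integrable q) (h : IsInteraction q l c V)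
    (h' : IsInteraction q l d W) (a b : ℂ) :
    IsInteraction q l (a • c + b • d) (fun x => a • V x + b • W x) := by
  obtain ⟨C, hC⟩ := h.bounded
  obtain ⟨C', hC'⟩ := h'.bounded
  refine ⟨(h.continuous.const_smul a).add (h'.continuous.const_smul b),
    ⟨‖a‖ * C + ‖b‖ * C', fun x => (norm_add_le _ _).trans ?_⟩, fun x => ?_, fun x => ?_⟩
  · rw [norm_smul, norm_smul]
    gcongr
    exacts [hC x, hC' x]
  · have e : ∀ y : ℝ, Complex.exp (2 * Complex.I * l * (-y : ℝ)) * (q y * (a • V y + b • W y) 1) =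
        a * (Complex.exp (2 * Complex.I * l * (-y : ℝ)) * (q y * V y 1)) +
        b * (Complex.exp (2 * Complex.I * l * (-y : ℝ)) * (q y * W y 1)) := fun y => by
      simp only [Pi.add_apply, Pi.smul_apply, smul_eq_mul]; ring
    simp only [e]
    rw [integral_add ((h.integrable_zero hq).integrableOn.const_mul _)
      ((h'.integrable_zero hq).integrableOn.const_mul _), integral_const_mul, integral_const_mul]
    simp only [Pi.add_apply, Pi.smul_apply, smul_eq_mul]
    rw [h.eq_zero, h'.eq_zero]
    ring
  · have e : ∀ y : ℝ, Complex.exp (2 * Complex.I * l * y) * (conj (q y) * (a • V y + b • W y) 0) =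
        a * (Complex.exp (2 * Complex.I * l * y) * (conj (q y) * V y 0)) +
        b * (Complex.exp (2 * Complex.I * l * y) * (conj (q y) * W y 0)) := fun y => by
      simp only [Pi.add_apply, Pi.smul_apply, smul_eq_mul]; ring
    simp only [e]
    rw [integral_add ((h.integrable_one hq).integrableOn.const_mul _)
      ((h'.integrable_one hq).integrableOn.const_mul _), integral_const_mul, integral_const_mul]
    simp only [Pi.add_apply, Pi.smul_apply, smul_eq_mul]
    rw [h.eq_one, h'.eq_one]
    ring

theorem IsInteraction.eq_zero_of_zero (hq : Integrable q) (h : IsInteraction q l 0 V) (x : ℝ) :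
    V x = 0 := by
  refine eq_zero_of_volterra_Iic (k := fun y => ‖(l : ℂ)‖ * ‖q y‖)
    (N := fun _ y => -((l : ℂ) • ![Complex.exp (2 * Complex.I * l * (-y : ℝ)) * (q y * V y 1),
      -(Complex.exp (2 * Complex.I * l * y) * (conj (q y) * V y 0))])) (hq.norm.const_mul _)
    (fun _ => by positivity) h.continuous h.bounded (fun x y _ => ?_) (fun x => ?_) x
  · rw [norm_neg, norm_smul]
    refine (mul_le_mul_of_nonneg_left (norm_kernel_vec_le (norm_phase l _).le
      (norm_phase l _).le) (norm_nonneg _)).trans_eq (mul_assoc _ _ _).symm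
  · have i1 : Integrable fun y : ℝ => -(Complex.exp (2 * Complex.I * l * y) *
      (conj (q y) * V y 0)) := (h.integrable_one hq).neg
    rw [integral_neg, integral_smul, integral_vec (h.integrable_zero hq).integrableOn
      i1.integrableOn, vec_eq_iff.2 ⟨h.eq_zero x, h.eq_one x⟩, integral_neg]
    simp

/-- The difference of the two sides solves the equation with limit zero at `-∞`, hence vanishes. -/
theorem IsInteraction.eq_combination {V₀ V₁ : ℝ → Fin 2 → ℂ} (hq : Integrable q)
    (h : IsInteraction q l c V) (h₀ : IsInteraction q l ![1, 0] V₀)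
    (h₁ : IsInteraction q l ![0, 1] V₁) (x : ℝ) : V x = c 0 • V₀ x + c 1 • V₁ x := by
  have h2 := h₀.combination hq h₁ (c 0) (c 1)
  have h3 := h.combination hq h2 1 (-1)
  have e : (1 : ℂ) • c + (-1 : ℂ) • (c 0 • ![1, 0] + c 1 • ![0, 1]) = 0 := by
    funext i
    fin_cases i <;> simp
  rw [e] at h3
  have := h3.eq_zero_of_zero hq x
  rw [one_smul, neg_one_smul, ← sub_eq_add_neg, sub_eq_zero] at this
  exact this

theorem exp_phase_neg_mul (l x : ℝ) : Complex.exp (2 * Complex.I * l * (-x : ℝ)) *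
    Complex.exp (2 * Complex.I * l * x) = 1 := by
  rw [← Complex.exp_add, ← Complex.exp_zero]
  congr 1; push_cast; ring

theorem exp_phase_sub (l x y : ℝ) : Complex.exp (2 * Complex.I * l * (y - x : ℝ)) =
    Complex.exp (2 * Complex.I * l * (-x : ℝ)) * Complex.exp (2 * Complex.I * l * y) := by
  rw [← Complex.exp_add]
  congr 1; push_cast; ring

theorem exp_phase_integral (l x : ℝ) (S : Set ℝ) (φ : ℝ → ℂ) :
    Complex.exp (2 * Complex.I * l * x) *
      ∫ y in S, Complex.exp (2 * Complex.I * l * (y - x : ℝ)) * φ y =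
    ∫ y in S, Complex.exp (2 * Complex.I * l * y) * φ y := by
  rw [← integral_const_mul]
  congr 1
  funext y
  rw [exp_phase_sub]
  linear_combination (Complex.exp (2 * Complex.I * l * y) * φ y) * exp_phase_neg_mul l x

theorem exp_phase_integral' (l x : ℝ) (S : Set ℝ) (φ : ℝ → ℂ) :
    Complex.exp (2 * Complex.I * l * (-x : ℝ)) *
      ∫ y in S, Complex.exp (2 * Complex.I * l * (x - y : ℝ)) * φ y =
    ∫ y in S, Complex.exp (2 * Complex.I * l * (-y : ℝ)) * φ y := by
  rw [← integral_const_mul]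
  congr 1
  funext y
  rw [exp_phase_sub]
  linear_combination (Complex.exp (2 * Complex.I * l * (-y : ℝ)) * φ y) * exp_phase_neg_mul l x

theorem interaction_kernel (l : ℝ) (j : Fin 2) (m : ℝ → Fin 2 → ℂ) (y : ℝ) :
    (Complex.exp (2 * Complex.I * l * (-y : ℝ)) * (q y * interaction l j m y 1) =
      if j = 0 then q y * m y 1 else Complex.exp (2 * Complex.I * l * (-y : ℝ)) * (q y * m y 1)) ∧
    (Complex.exp (2 * Complex.I * l * y) * (conj (q y) * interaction l j m y 0) =
      if j = 0 then Complex.exp (2 * Complex.I * l * y) * (conj (q y) * m y 0)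
      else conj (q y) * m y 0) := by
  have := exp_phase_neg_mul l y
  unfold interaction
  split_ifs
  · refine ⟨?_, by simp⟩
    simp only [Matrix.cons_val_one, Matrix.cons_val_zero]
    linear_combination (q y * m y 1) * this
  · refine ⟨by simp, ?_⟩
    simp only [Matrix.cons_val_zero]
    linear_combination (conj (q y) * m y 0) * this

theorem IsJostMinus.isInteraction_zero (hq : Integrable q) (h : IsJostMinus q l 0 m) :
    IsInteraction q l ![1, 0] (interaction l 0 m) := by
  obtain ⟨hc, hb, he⟩ := (isJostMinus_zero_iff hq (Complex.ofReal_im l)).1 h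
  refine ⟨continuous_interaction 0 hc, bounded_interaction 0 hb, fun x => ?_, fun x => ?_⟩
  · simp only [(interaction_kernel l 0 m _).1]
    simpa [interaction] using (he x).1
  · simp only [(interaction_kernel l 0 m _).2]
    simp only [interaction, if_true, Matrix.cons_val_one, Matrix.cons_val_zero, (he x).2]
    rw [mul_left_comm, exp_phase_integral, zero_add]

theorem IsJostMinus.isInteraction_one (hq : Integrable q) (h : IsJostMinus q l 1 m) :
    IsInteraction q l ![0, 1] (interaction l 1 m) := by
  obtain ⟨hc, hb, he⟩ := (isJostMinus_one_iff hq (Complex.ofReal_im l).ge).1 h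
  refine ⟨continuous_interaction 1 hc, bounded_interaction 1 hb, fun x => ?_, fun x => ?_⟩
  · simp only [(interaction_kernel l 1 m _).1]
    simp only [interaction, one_ne_zero, if_false, Matrix.cons_val_zero, (he x).1]
    rw [mul_neg, mul_left_comm, exp_phase_integral', zero_sub]
  · simp only [(interaction_kernel l 1 m _).2]
    simpa [interaction] using (he x).2

theorem integral_Ioi_eq_sub_Iic {φ : ℝ → ℂ} (h : Integrable φ) (x : ℝ) :
    ∫ y in Ioi x, φ y = (∫ y, φ y) - ∫ y in Iic x, φ y := by
  rw [← intervalIntegral.integral_Iic_add_Ioi (b := x) h.integrableOn h.integrableOn]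
  ring

/-- An integral over `(x, ∞)` is the total integral minus the one over `(-∞, x]`, and the total is
absorbed in `c`. In these variables the phases no longer depend on `x`, which makes this possible.
-/
theorem IsJostPlus.exists_isInteraction (hq : Integrable q) {j : Fin 2} (h : IsJostPlus q l j m) :
    ∃ c, IsInteraction q l c (interaction l j m) := by
  have hc := continuous_interaction (l := l) j h.continuous
  have hb := bounded_interaction (l := l) j h.bounded
  obtain ⟨C, hC⟩ := id hb
  have i0 := integrable_phase_mul (l := l) hq continuous_neg (continuous_pi_iff.1 hc 1)
    (bound_apply hC 1)
  have i1 := integrable_phase_mul (l := l) (integrable_conj hq) continuous_id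
    (continuous_pi_iff.1 hc 0) (bound_apply hC 0)
  simp only [id] at i1
  suffices H : ∃ c : Fin 2 → ℂ, ∀ x, interaction l j m x 0 = c 0 + l * ∫ y in Ioi x,
      Complex.exp (2 * Complex.I * l * (-y : ℝ)) * (q y * interaction l j m y 1) ∧
      interaction l j m x 1 = c 1 - l * ∫ y in Ioi x,
      Complex.exp (2 * Complex.I * l * y) * (conj (q y) * interaction l j m y 0) by
    obtain ⟨c, H⟩ := H
    refine ⟨![c 0 + l * ∫ y : ℝ, Complex.exp (2 * Complex.I * l * (-y : ℝ)) *
      (q y * interaction l j m y 1), c 1 - l * ∫ y : ℝ, Complex.exp (2 * Complex.I * l * y) *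
      (conj (q y) * interaction l j m y 0)], hc, hb, fun x => ?_, fun x => ?_⟩
    · rw [(H x).1, integral_Ioi_eq_sub_Iic i0]
      simp only [Matrix.cons_val_zero]; ring
    · rw [(H x).2, integral_Ioi_eq_sub_Iic i1]
      simp only [Matrix.cons_val_one, Matrix.cons_val_zero]; ring
  fin_cases j
  · obtain ⟨-, -, he⟩ := (isJostPlus_zero_iff hq (Complex.ofReal_im l).ge).1 h
    refine ⟨![1, 0], fun x => ⟨?_, ?_⟩⟩
    · simp only [Fin.zero_eta, (interaction_kernel l 0 m _).1]
      simpa [interaction] using (he x).1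
    · simp only [Fin.zero_eta, (interaction_kernel l 0 m _).2]
      simp only [interaction, if_true, Matrix.cons_val_one, Matrix.cons_val_zero, (he x).2]
      rw [mul_neg, mul_left_comm, exp_phase_integral, zero_sub]
  · obtain ⟨-, -, he⟩ := (isJostPlus_one_iff hq (Complex.ofReal_im l)).1 h
    refine ⟨![0, 1], fun x => ⟨?_, ?_⟩⟩
    · simp only [Fin.mk_one, (interaction_kernel l 1 m _).1]
      simp only [interaction, one_ne_zero, if_false, Matrix.cons_val_zero, (he x).1]
      rw [mul_left_comm, exp_phase_integral', zero_add]
    · simp only [Fin.mk_one, (interaction_kernel l 1 m _).2]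
      simpa [interaction] using (he x).2

theorem IsJostPlus.mPlus_spec {l : ℂ} {j : Fin 2} (h : IsJostPlus q l j m) :
    IsJostPlus q l j (mPlus q l j) := by
  have hex : ∃ m, IsJostPlus q l j m := ⟨m, h⟩
  rw [mPlus, dif_pos hex]
  exact hex.choose_spec

theorem IsJostMinus.mMinus_spec {l : ℂ} {j : Fin 2} (h : IsJostMinus q l j m) :
    IsJostMinus q l j (mMinus q l j) := by
  have hex : ∃ m, IsJostMinus q l j m := ⟨m, h⟩
  rw [mMinus, dif_pos hex]
  exact hex.choose_spec

/-- The factor `e^{iλxσ₃}` stands on the left and is common to all columns, so `ψ₊ = ψ₋ T` is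
equivalent to the same relation between interaction columns. -/
theorem psi_apply (M : ℝ → Fin 2 → Fin 2 → ℂ) (l x : ℝ) (i j : Fin 2) :
    (Matrix.of (fun i j => M x j i) * expSigma l x) i j =
      expSigma l x i i * interaction l j (fun x => M x j) x i := by
  have e1 : Complex.exp (-(Complex.I * l * x)) * Complex.exp (2 * Complex.I * l * x) =
      Complex.exp (Complex.I * l * x) := by
    rw [← Complex.exp_add]; congr 1; ring
  have e2 : Complex.exp (Complex.I * l * x) * Complex.exp (2 * Complex.I * l * (-x : ℝ)) =
      Complex.exp (-(Complex.I * l * x)) := by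
    rw [← Complex.exp_add]; congr 1; push_cast; ring
  rw [expSigma, Matrix.mul_diagonal]
  fin_cases i <;> fin_cases j <;>
    simp only [Fin.zero_eta, Fin.mk_one, interaction, if_true, one_ne_zero, if_false,
      Matrix.cons_val_zero, Matrix.cons_val_one, Matrix.diagonal_apply_eq, Matrix.of_apply]
  · ring
  · linear_combination (-(M x 1 0)) * e2
  · linear_combination (-(M x 0 1)) * e1
  · ring

theorem expSigma_apply_ne_zero (l x : ℝ) (i : Fin 2) : expSigma l x i i ≠ 0 := by
  fin_cases i <;> simp [expSigma, Complex.exp_ne_zero]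

/-- For real `λ`, the first column of `T` is the limit at `-∞` of `e^{-iλxσ₃} ψ₊`. -/
theorem tendsto_scatteringMatrix (hq : Integrable q) (h : IsJostPlus q l 0 m)
    (h' : IsJostMinus q l 1 n) (i : Fin 2) :
    Tendsto (fun x => interaction l 0 (mPlus q l 0) x i) atBot (𝓝 (scatteringMatrix q l i 0)) := by
  have hP : ∀ j, ∃ c, IsInteraction q l c (interaction l j (mPlus q l j)) := by
    intro j
    fin_cases j
    · exact h.mPlus_spec.exists_isInteraction hq
    · exact (h.conj_column hq (Complex.ofReal_im l)).mPlus_spec.exists_isInteraction hq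
  choose c hc using hP
  have hM0 := (h'.conj_column hq (Complex.ofReal_im l)).mMinus_spec.isInteraction_zero hq
  have hM1 := h'.mMinus_spec.isInteraction_one hq
  have hiff : ∀ T : Matrix (Fin 2) (Fin 2) ℂ, (∀ x : ℝ, psiPlus q l x = psiMinus q l x * T) ↔
      ∀ (x : ℝ) (i j : Fin 2), interaction l j (mPlus q l j) x i =
        interaction l 0 (mMinus q l 0) x i * T 0 j + interaction l 1 (mMinus q l 1) x i * T 1 j := by
    intro T
    refine forall_congr' fun x => ?_
    rw [← Matrix.ext_iff]
    refine forall_congr' fun i => forall_congr' fun j => ?_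
    rw [Matrix.mul_apply, Fin.sum_univ_two, psiPlus, psiMinus,
      psi_apply (fun x j => mPlus q l j x), psi_apply (fun x j => mMinus q l j x),
      psi_apply (fun x j => mMinus q l j x), mul_assoc, mul_assoc, ← mul_add,
      mul_right_inj' (expSigma_apply_ne_zero l x i)]
  have hex : ∃ T : Matrix (Fin 2) (Fin 2) ℂ, ∀ x : ℝ, psiPlus q l x = psiMinus q l x * T := by
    refine ⟨Matrix.of fun i j => c j i, (hiff _).2 fun x i j => ?_⟩
    rw [(hc j).eq_combination hq hM0 hM1 x]
    simp [mul_comm]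
  have hT := (hiff _).1 hex.choose_spec
  have hS : scatteringMatrix q l = hex.choose := by rw [scatteringMatrix, dif_pos hex]
  rw [hS]
  -- At `-∞` the columns of `ψ₋` become the standard basis, so every admissible `T` has this first
  -- column and the choice in the definition is harmless.
  have t := ((hM0.tendsto hq i).mul_const (hex.choose 0 0)).add
    ((hM1.tendsto hq i).mul_const (hex.choose 1 0))
  have e : (![1, 0] : Fin 2 → ℂ) i * hex.choose 0 0 + (![0, 1] : Fin 2 → ℂ) i * hex.choose 1 0 =
      hex.choose i 0 := by
    fin_cases i <;> simp
  rw [e] at t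
  exact t.congr fun x => (hT x i 0).symm

end WKI

/-! ### Scattering coefficients through the gauge -/

namespace WKI

open Filter Topology Set ComplexConjugate

variable {q : ℝ → ℂ} {α β α' β' : ℝ → ℂ → ℂ}

theorem Gauge.exists_isJostMinus (G : Gauge q)
    (h' : IsGaugeJost G.reflect.f G.reflect.g G.reflect.z α' β') {l : ℂ} (hl : 0 ≤ l.im) :
    ∃ κ : ℂ, κ ≠ 0 ∧ IsJostMinus q l 1 (fun x =>
      ![G.reflect.column κ α' β' l (-x) 1, G.reflect.column κ α' β' l (-x) 0]) := by
  obtain ⟨κ, hκ, h⟩ := G.reflect.exists_isJostPlus h' hl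
  exact ⟨κ, hκ, isJostMinus_one_reflect G.q_int hl h⟩

/-- The scattering coefficients in terms of the Jost solution of the transformed problem. -/
theorem Gauge.scatteringMatrix_eq (G : Gauge q) (hE : Tendsto G.E atBot (𝓝 1))
    (hz : Tendsto (fun x => G.z x - x) atBot (𝓝 0)) (h : IsGaugeJost G.f G.g G.z α β)
    (h' : IsGaugeJost G.reflect.f G.reflect.g G.reflect.z α' β') (l : ℝ) :
    ∃ κ : ℂ, κ ≠ 0 ∧ scatteringMatrix q l 0 0 = κ * (1 - ∫ y, G.f y * β y l) ∧
      scatteringMatrix q l 1 0 =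
        κ * -∫ y, Complex.exp (2 * Complex.I * l * G.z y) * (G.g y * α y l) := by
  have hl : 0 ≤ (l : ℂ).im := (Complex.ofReal_im l).ge
  obtain ⟨κ, hκ, hJ⟩ := G.exists_isJostPlus h hl
  obtain ⟨κ', -, hJ'⟩ := G.exists_isJostMinus h' hl
  have hm : mPlus q l 0 = G.column κ α β l := hJ.mPlus_spec.unique G.q_int hl hJ
  have key := tendsto_scatteringMatrix G.q_int hJ hJ'
  rw [hm] at key
  have t0 := key 0
  have t1 := key 1
  simp only [interaction, if_true, Matrix.cons_val_zero, Matrix.cons_val_one] at t0 t1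
  refine ⟨κ, hκ, tendsto_nhds_unique t0 ?_, tendsto_nhds_unique t1 ?_⟩
  all_goals
    have hρE : Tendsto (fun x => G.ρ x * G.E x) atBot (𝓝 0) := by simpa using G.ρ_bot.mul hE
    have hX : ∀ a : ℂ, Tendsto (fun x => Complex.exp (a * (G.z x - x : ℝ))) atBot (𝓝 1) := fun a => by
      have := ((by fun_prop : Continuous fun t : ℝ => Complex.exp (a * t)).tendsto 0).comp hz
      rw [Complex.ofReal_zero, mul_zero, Complex.exp_zero] at this
      exact this
    have hzc := G.continuous_z
  · have hα : Tendsto (fun x => α x l) atBot (𝓝 (1 - ∫ y, G.f y * β y l)) :=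
      ((tendsto_integral_Ioi_atBot (h.integrable_fβ G.f_int l)).const_sub 1).congr
        fun x => (h.α_eq x l hl).symm
    -- At `-∞` the function `β` is only bounded; it is `ρE` that tends to zero.
    have hρE' : Tendsto (fun x => conj (G.ρ x * G.E x) * β x l) atBot (𝓝 0) := by
      refine squeeze_zero_norm (a := fun x => ‖G.ρ x * G.E x‖) (fun x => ?_) (by simpa using hρE.norm)
      rw [norm_mul, RCLike.norm_conj]
      exact mul_le_of_le_one_right (norm_nonneg _) ((h.β_bd x l).trans (by norm_num))
    have := ((hX (Complex.I * l)).mul ((hE.mul hα).sub hρE')).const_mul κ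
    rwa [one_mul, one_mul, sub_zero] at this
  · have hEc : Tendsto (fun x => conj (G.E x)) atBot (𝓝 1) := by
      have := (Complex.continuous_conj.tendsto _).comp hE
      rwa [map_one] at this
    have hi := integrableOn_kernel (S := univ) G.g_int .univ
      (by fun_prop : Continuous fun y => Complex.exp (2 * Complex.I * l * G.z y))
      (fun y _ => (norm_phase l _).le) (h.continuous_α l) (fun y => h.α_norm y l)
    rw [integrableOn_univ] at hi
    have hw := (tendsto_integral_Ioi_atBot hi).neg
    have hρE' : Tendsto (fun x : ℝ => Complex.exp (2 * Complex.I * l * x) *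
        (Complex.exp (Complex.I * l * (G.z x - x : ℝ)) * (G.ρ x * G.E x * α x l))) atBot (𝓝 0) := by
      refine squeeze_zero_norm (a := fun x => ‖Complex.exp (Complex.I * l * (G.z x - x : ℝ))‖ *
        (‖G.ρ x * G.E x‖ * (4 / 3))) (fun x => ?_)
        (by simpa using (hX (Complex.I * l)).norm.mul (hρE.norm.mul_const (4 / 3)))
      rw [norm_mul, norm_phase, one_mul, norm_mul, norm_mul (G.ρ x * G.E x)]
      gcongr
      exact h.α_norm x l
    have := (hρE'.add ((hX (-(Complex.I * l))).mul (hEc.mul hw))).const_mul κ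
    rw [one_mul, one_mul, zero_add] at this
    refine this.congr fun x => ?_
    -- The phases are regrouped so that `β` appears only in the convergent product `e^{2iλz} β`,
    -- next to a factor tending to `1`.
    have e1 : Complex.exp (2 * Complex.I * l * x) * Complex.exp (Complex.I * l * (G.z x - x : ℝ)) =
        Complex.exp (-(Complex.I * l) * (G.z x - x : ℝ)) * Complex.exp (2 * Complex.I * l * G.z x) := by
      rw [← Complex.exp_add, ← Complex.exp_add]
      congr 1; push_cast; ring
    have e2 : Complex.exp (2 * Complex.I * l * G.z x) * β x l =
        -∫ y in Ioi x, Complex.exp (2 * Complex.I * l * G.z y) * (G.g y * α y l) := by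
      rw [h.β_eq x l hl, mul_neg, ← integral_const_mul]
      congr 2
      funext y
      rw [exp_phase_sub]
      linear_combination (Complex.exp (2 * Complex.I * l * G.z y) * (G.g y * α y l)) *
        exp_phase_neg_mul l (G.z x)
    simp only [Gauge.column, Matrix.cons_val_one, Matrix.cons_val_zero]
    rw [← e2]
    linear_combination (-(κ * (conj (G.E x) * β x l))) * e1

/-- At `x = 0` the determinant factors into exponentials, the gauge determinant `|E|² (1 + |ρ|²)`,
and `αα' - ββ'`, where `|αα'| ≥ 4/9` and `|ββ'| ≤ 1/9`. -/
theorem Gauge.det_column_ne_zero (G : Gauge q) (h : IsGaugeJost G.f G.g G.z α β)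
    (h' : IsGaugeJost G.reflect.f G.reflect.g G.reflect.z α' β') (l : ℂ) {κ κ' : ℂ}
    (hκ : κ ≠ 0) (hκ' : κ' ≠ 0) :
    G.column κ α β l 0 0 * G.reflect.column κ' α' β' l 0 0 -
      G.reflect.column κ' α' β' l 0 1 * G.column κ α β l 0 1 ≠ 0 := by
  have e : G.column κ α β l 0 0 * G.reflect.column κ' α' β' l 0 0 -
      G.reflect.column κ' α' β' l 0 1 * G.column κ α β l 0 1 =
      κ * κ' * Complex.exp (Complex.I * l * (G.z 0 - 0 : ℝ)) *
        Complex.exp (Complex.I * l * (-G.z (-0) - 0 : ℝ)) *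
        (G.E 0 * conj (G.E 0) * (1 + G.ρ 0 * conj (G.ρ 0))) *
        (α 0 l * α' 0 l - β 0 l * β' 0 l) := by
    simp only [Gauge.column, Gauge.reflect, Matrix.cons_val_one, Matrix.cons_val_zero, neg_zero,
      map_mul, map_neg, Complex.conj_conj]
    ring
  rw [e]
  have h1 : (1 + G.ρ 0 * conj (G.ρ 0)) ≠ 0 := by
    rw [Complex.mul_conj, ← Complex.ofReal_one, ← Complex.ofReal_add, Complex.ofReal_ne_zero]
    have := Complex.normSq_nonneg (G.ρ 0)
    linarith
  have h2 : conj (G.E 0) ≠ 0 := by simpa using G.E_ne 0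
  have h3 : α 0 l * α' 0 l - β 0 l * β' 0 l ≠ 0 := by
    intro h0
    have a1 : 2 / 3 ≤ ‖α 0 l‖ := by
      have := norm_sub_norm_le 1 (1 - α 0 l)
      rw [sub_sub_cancel, norm_one, norm_sub_rev] at this
      linarith [h.α_bd 0 l]
    have a2 : 2 / 3 ≤ ‖α' 0 l‖ := by
      have := norm_sub_norm_le 1 (1 - α' 0 l)
      rw [sub_sub_cancel, norm_one, norm_sub_rev] at this
      linarith [h'.α_bd 0 l]
    have h4 : ‖α 0 l‖ * ‖α' 0 l‖ = ‖β 0 l‖ * ‖β' 0 l‖ := by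
      rw [← norm_mul, ← norm_mul, sub_eq_zero.1 h0]
    have h5 : ‖β 0 l‖ * ‖β' 0 l‖ ≤ 1 / 3 * (1 / 3) :=
      mul_le_mul (h.β_bd _ _) (h'.β_bd _ _) (norm_nonneg _) (by norm_num)
    have h6 : (2 / 3 : ℝ) * (2 / 3) ≤ ‖α 0 l‖ * ‖α' 0 l‖ :=
      mul_le_mul a1 a2 (by norm_num) (norm_nonneg _)
    linarith
  refine mul_ne_zero (mul_ne_zero (mul_ne_zero (mul_ne_zero (mul_ne_zero hκ hκ')
    (Complex.exp_ne_zero _)) (Complex.exp_ne_zero _)) (mul_ne_zero (mul_ne_zero (G.E_ne 0) h2) h1)) h3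

theorem Gauge.scatteringA_ne_zero (G : Gauge q) (h : IsGaugeJost G.f G.g G.z α β)
    (h' : IsGaugeJost G.reflect.f G.reflect.g G.reflect.z α' β') {l : ℂ} (hl : 0 < l.im) :
    scatteringA q l ≠ 0 := by
  obtain ⟨κ, hκ, hJ⟩ := G.exists_isJostPlus h hl.le
  obtain ⟨κ', hκ', hJ'⟩ := G.exists_isJostMinus h' hl.le
  have hm : mPlus q l 0 = _ := hJ.mPlus_spec.unique G.q_int hl.le hJ
  have hn : mMinus q l 1 = _ := hJ'.mMinus_spec.unique G.q_int hl.le hJ'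
  rw [scatteringA, if_neg hl.ne', Matrix.det_fin_two_of]
  have e1 : ∀ i, psiPlus q l 0 i 0 = mPlus q l 0 0 i := fun i => by
    simp [psiPlus, expSigma, Matrix.mul_diagonal]
  have e2 : ∀ i, psiMinus q l 0 i 1 = mMinus q l 1 0 i := fun i => by
    simp [psiMinus, expSigma, Matrix.mul_diagonal]
  rw [e1, e1, e2, e2, hm, hn]
  simpa using G.det_column_ne_zero h h' l hκ hκ'

/-! ### Dependence on the potential up to null sets -/

theorem kernelColumn_congr {Q : ℝ → ℂ} (h : Q =ᵐ[volume] q) (l : ℂ) (j : Fin 2) (x : ℝ)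
    (m : ℝ → Fin 2 → ℂ) : (fun y => kernelColumn Q l j x y (m y)) =ᵐ[volume]
      fun y => kernelColumn q l j x y (m y) := by
  filter_upwards [h] with y hy
  simp only [kernelColumn, potential, hy]

theorem isJostPlus_congr {Q : ℝ → ℂ} (h : Q =ᵐ[volume] q) (l : ℂ) (j : Fin 2) :
    IsJostPlus Q l j = IsJostPlus q l j := by
  have key : ∀ {Q q : ℝ → ℂ}, Q =ᵐ[volume] q → ∀ m, IsJostPlus Q l j m → IsJostPlus q l j m := by
    intro Q q h m hm
    refine ⟨hm.continuous, hm.bounded, fun x => (hm.integrable x).congr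
      (ae_restrict_of_ae (kernelColumn_congr h l j x m)), fun x => ?_⟩
    rw [← integral_congr_ae (ae_restrict_of_ae (kernelColumn_congr h l j x m))]
    exact hm.equation x
  funext m
  exact propext ⟨key h m, key h.symm m⟩

theorem isJostMinus_congr {Q : ℝ → ℂ} (h : Q =ᵐ[volume] q) (l : ℂ) (j : Fin 2) :
    IsJostMinus Q l j = IsJostMinus q l j := by
  have key : ∀ {Q q : ℝ → ℂ}, Q =ᵐ[volume] q → ∀ m, IsJostMinus Q l j m → IsJostMinus q l j m := by
    intro Q q h m hm
    refine ⟨hm.continuous, hm.bounded, fun x => (hm.integrable x).congr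
      (ae_restrict_of_ae (kernelColumn_congr h l j x m)), fun x => ?_⟩
    rw [← integral_congr_ae (ae_restrict_of_ae (kernelColumn_congr h l j x m))]
    exact hm.equation x
  funext m
  exact propext ⟨key h m, key h.symm m⟩

-- The Jost solutions are defined by choice, so equality of the predicates, and not mere equivalence
-- of their solvability, is what makes the chosen objects equal.
open Classical in
theorem dite_choose_congr {X : Type*} (d : X) {P P' : X → Prop} (h : P = P') :
    (if h : ∃ m, P m then h.choose else d) = if h : ∃ m, P' m then h.choose else d := by
  rw [h]

theorem psi_congr {Q : ℝ → ℂ} (h : Q =ᵐ[volume] q) :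
    psiPlus Q = psiPlus q ∧ psiMinus Q = psiMinus q := by
  have h1 : mPlus Q = mPlus q := by
    funext l j
    exact dite_choose_congr 0 (isJostPlus_congr h l j)
  have h2 : mMinus Q = mMinus q := by
    funext l j
    exact dite_choose_congr 0 (isJostMinus_congr h l j)
  constructor
  · funext l x
    rw [psiPlus, psiPlus, h1]
  · funext l x
    rw [psiMinus, psiMinus, h2]

theorem scattering_congr {Q : ℝ → ℂ} (h : Q =ᵐ[volume] q) :
    scatteringA Q = scatteringA q ∧ scatteringB Q = scatteringB q := by
  obtain ⟨h1, h2⟩ := psi_congr h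
  have h3 : scatteringMatrix Q = scatteringMatrix q := by
    funext l
    exact dite_choose_congr 0 (by rw [h1, h2])
  constructor
  · funext l
    rw [scatteringA, scatteringA, h1, h2, h3]
  · funext l
    rw [scatteringB, scatteringB, h3]

end WKI

namespace WKI

open Filter Topology Set ComplexConjugate ENNReal

/-! ### `L²` bounds for oscillatory integrals -/

theorem eLpNorm_two_sq {X : Type*} [MeasurableSpace X] {μ : Measure X} (f : X → ℂ) :
    eLpNorm f 2 μ ^ 2 = ∫⁻ x, ‖f x‖ₑ ^ 2 ∂μ := by
  have := eLpNorm_nnreal_pow_eq_lintegral (μ := μ) (f := f) (p := 2) two_ne_zero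
  simpa using this

theorem eLpNorm_two_le_of_sq_le {X Y : Type*} [MeasurableSpace X] [MeasurableSpace Y]
    {μ : Measure X} {ν : Measure Y} {f : X → ℂ} {g : Y → ℂ} {c : ℝ≥0∞}
    (h : ∫⁻ x, ‖f x‖ₑ ^ 2 ∂μ ≤ c ^ 2 * ∫⁻ y, ‖g y‖ₑ ^ 2 ∂ν) :
    eLpNorm f 2 μ ≤ c * eLpNorm g 2 ν := by
  rw [← eLpNorm_two_sq, ← eLpNorm_two_sq, ← mul_pow] at h
  exact (ENNReal.pow_le_pow_left_iff two_ne_zero).1 h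

theorem mul_le_sq_add_sq (a b : ℝ≥0∞) : a * b ≤ a ^ 2 + b ^ 2 := by
  rcases le_total a b with h | h
  · exact ((mul_le_mul_left h b).trans (sq b).ge).trans le_add_self
  · exact ((mul_le_mul_right h a).trans (sq a).ge).trans le_self_add

/-- Schur's test for a convolution kernel. -/
theorem lintegral_mul_mul_le {h k : ℝ → ℝ≥0∞} (hh : AEMeasurable h) (hk : Measurable k) :
    ∫⁻ p : ℝ × ℝ, k (p.1 - p.2) * (h p.1 * h p.2) ∂(volume.prod volume) ≤
      2 * ((∫⁻ u, k u) * ∫⁻ x, h x ^ 2) := by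
  have h1 : AEMeasurable (fun p : ℝ × ℝ => k (p.1 - p.2) * h p.1 ^ 2) (volume.prod volume) :=
    (hk.comp (measurable_fst.sub measurable_snd)).aemeasurable.mul
      ((hh.comp_quasiMeasurePreserving Measure.quasiMeasurePreserving_fst).pow_const 2)
  have h2 : AEMeasurable (fun p : ℝ × ℝ => k (p.1 - p.2) * h p.2 ^ 2) (volume.prod volume) :=
    (hk.comp (measurable_fst.sub measurable_snd)).aemeasurable.mul
      ((hh.comp_quasiMeasurePreserving Measure.quasiMeasurePreserving_snd).pow_const 2)
  -- The crude inequality `ab ≤ a² + b²` suffices; it is the source of the factor `2`.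
  calc ∫⁻ p : ℝ × ℝ, k (p.1 - p.2) * (h p.1 * h p.2) ∂(volume.prod volume)
      ≤ ∫⁻ p : ℝ × ℝ, (k (p.1 - p.2) * h p.1 ^ 2 + k (p.1 - p.2) * h p.2 ^ 2)
          ∂(volume.prod volume) := by
        refine lintegral_mono fun p => ?_
        rw [← mul_add]
        gcongr
        exact mul_le_sq_add_sq _ _
    _ = (∫⁻ u, k u) * (∫⁻ x, h x ^ 2) + (∫⁻ u, k u) * ∫⁻ x, h x ^ 2 := by
        rw [lintegral_add_left' h1, lintegral_prod _ h1, lintegral_prod_symm _ h2]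
        congr 1
        · rw [← lintegral_const_mul'' _ (hh.pow_const 2)]
          refine lintegral_congr fun x => ?_
          rw [← lintegral_sub_left_eq_self k x]
          exact lintegral_mul_const (μ := volume) (f := fun y => k (x - y)) (h x ^ 2) (by fun_prop)
        · rw [← lintegral_const_mul'' _ (hh.pow_const 2)]
          refine lintegral_congr fun x => ?_
          rw [← lintegral_sub_right_eq_self k x]
          exact lintegral_mul_const (μ := volume) (f := fun y => k (y - x)) (h x ^ 2) (by fun_prop)
    _ = _ := (two_mul _).symm

theorem norm_integral_gaussian {ε : ℝ} (hε : 0 < ε) (d : ℝ) :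
    ‖∫ l : ℝ, Complex.exp (2 * Complex.I * l * d) * Complex.exp (-ε * l ^ 2)‖ =
      √(Real.pi / ε) * Real.exp (-(1 / ε) * d ^ 2) := by
  have := fourierIntegral_gaussian (b := ε) (by simpa using hε) (2 * d)
  have e : ∀ l : ℝ, 2 * Complex.I * l * d = Complex.I * (2 * d) * l := fun l => by ring
  simp only [e]
  rw [this, norm_mul, Complex.norm_exp, ← Complex.ofReal_div,
    Complex.norm_cpow_eq_rpow_re_of_pos (by positivity), Real.sqrt_eq_rpow]
  congr 2
  · norm_num
  · have : -(2 * (d : ℂ)) ^ 2 / (4 * ε) = ((-(1 / ε) * d ^ 2 : ℝ) : ℂ) := by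
      push_cast
      field_simp
      ring
    rw [this, Complex.ofReal_re]

theorem lintegral_gaussian_kernel {ε : ℝ} (hε : 0 < ε) :
    ∫⁻ u : ℝ, ENNReal.ofReal (√(Real.pi / ε) * Real.exp (-(1 / ε) * u ^ 2)) =
      ENNReal.ofReal Real.pi := by
  rw [← ofReal_integral_eq_lintegral_ofReal
    ((integrable_exp_neg_mul_sq (by positivity)).const_mul _)
    (.of_forall fun u => by positivity), integral_const_mul, integral_gaussian,
    ← Real.sqrt_mul (by positivity)]
  congr 1
  rw [Real.sqrt_eq_iff_mul_self_eq (by positivity) (by positivity)]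
  field_simp

/-- The square is expanded and `l` integrated first, which the Gaussian weight makes legitimate. The
result is a Gaussian in `z x - z y`, dominated by the same Gaussian in `x - y` because `z` expands
distances. That kernel has mass `π` for every `ε`, so Schur's test gives `2π ≤ 9`. -/
theorem lintegral_gaussian_phase_le {h : ℝ → ℂ} {z : ℝ → ℝ} (hh : Integrable h) (hz : Continuous z)
    (hexp : ∀ x y, |x - y| ≤ |z x - z y|) {ε : ℝ} (hε : 0 < ε) :
    ∫⁻ l : ℝ, ENNReal.ofReal (Real.exp (-ε * l ^ 2)) *
      ‖∫ x, Complex.exp (2 * Complex.I * l * z x) * h x‖ₑ ^ 2 ≤ 3 ^ 2 * ∫⁻ x, ‖h x‖ₑ ^ 2 := by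
  set H : ℝ → ℂ := fun l => ∫ x, Complex.exp (2 * Complex.I * l * z x) * h x with hH
  have hi : ∀ l : ℝ, Integrable fun x => Complex.exp (2 * Complex.I * l * z x) * h x := fun l =>
    hh.bdd_mul (by fun_prop : Continuous _).aestronglyMeasurable
      (.of_forall fun x => (norm_phase l (z x)).le)
  have hHb : ∀ l, ‖H l‖ ≤ ∫ x, ‖h x‖ := fun l => by
    refine norm_integral_le_of_norm_le hh.norm (.of_forall fun x => ?_)
    rw [norm_mul, norm_phase, one_mul]
  have hHc : Continuous H := by
    refine continuous_of_dominated (fun l => (hi l).1)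
      (fun l => .of_forall fun x => ?_) hh.norm (.of_forall fun x => by fun_prop)
    rw [norm_mul, norm_phase, one_mul]
  have hg := integrable_exp_neg_mul_sq hε
  have e0 : ∀ l : ℝ, Complex.exp (-ε * l ^ 2) = (Real.exp (-ε * l ^ 2) : ℝ) := fun l => by
    push_cast; rfl
  have step1 : ∫⁻ l : ℝ, ENNReal.ofReal (Real.exp (-ε * l ^ 2)) * ‖H l‖ₑ ^ 2 =
      ‖∫ l : ℝ, Complex.exp (-ε * l ^ 2) * (H l * conj (H l))‖ₑ := by
    have e : ∀ l : ℝ, Complex.exp (-ε * l ^ 2) * (H l * conj (H l)) =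
        ((Real.exp (-ε * l ^ 2) * ‖H l‖ ^ 2 : ℝ) : ℂ) := fun l => by
      rw [e0, Complex.mul_conj, Complex.normSq_eq_norm_sq]
      push_cast; rfl
    have hsq : Integrable fun l : ℝ => Real.exp (-ε * l ^ 2) * ‖H l‖ ^ 2 := by
      refine hg.mul_bdd (hHc.norm.pow 2).aestronglyMeasurable (c := (∫ x, ‖h x‖) ^ 2)
        (.of_forall fun l => ?_)
      rw [norm_pow, norm_norm]
      gcongr
      exact hHb l
    simp only [e]
    rw [integral_complex_ofReal, ← ofReal_norm, Complex.norm_real,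
      Real.norm_of_nonneg (integral_nonneg fun l => by positivity),
      ofReal_integral_eq_lintegral_ofReal hsq (.of_forall fun l => by positivity)]
    refine lintegral_congr fun l => ?_
    rw [ENNReal.ofReal_mul (by positivity), ENNReal.ofReal_pow (norm_nonneg _), ofReal_norm]
  have step2 : ∀ l : ℝ, Complex.exp (-ε * l ^ 2) * (H l * conj (H l)) =
      ∫ p : ℝ × ℝ, (Complex.exp (2 * Complex.I * l * (z p.1 - z p.2 : ℝ)) * Complex.exp (-ε * l ^ 2)) *
        (h p.1 * conj (h p.2)) ∂(volume.prod volume) := fun l => by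
    have := integral_prod_mul (μ := volume) (ν := volume)
      (fun x => Complex.exp (2 * Complex.I * l * z x) * h x)
      (fun x => conj (Complex.exp (2 * Complex.I * l * z x) * h x))
    rw [integral_conj] at this
    rw [hH, ← this, ← integral_const_mul]
    congr 1
    funext p
    have e : Complex.exp (2 * Complex.I * l * (z p.1 - z p.2 : ℝ)) =
        Complex.exp (2 * Complex.I * l * z p.1) * conj (Complex.exp (2 * Complex.I * l * z p.2)) := by
      rw [← Complex.exp_conj, ← Complex.exp_add]
      congr 1
      simp only [map_mul, Complex.conj_I, Complex.conj_ofReal, map_ofNat]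
      push_cast; ring
    rw [e, map_mul]
    ring
  have hconj : Integrable fun x => conj (h x) := integrable_conj hh
  have hint : Integrable (Function.uncurry fun (l : ℝ) (p : ℝ × ℝ) =>
      (Complex.exp (2 * Complex.I * l * (z p.1 - z p.2 : ℝ)) * Complex.exp (-ε * l ^ 2)) *
        (h p.1 * conj (h p.2))) (volume.prod (volume.prod volume)) := by
    have i1 := (hg.ofReal (𝕜 := ℂ)).mul_prod (hh.mul_prod hconj)
    refine (i1.bdd_mul (c := 1) (f := fun p : ℝ × ℝ × ℝ =>
      Complex.exp (2 * Complex.I * p.1 * (z p.2.1 - z p.2.2 : ℝ)))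
      (by fun_prop : Continuous _).aestronglyMeasurable
      (.of_forall fun p => (norm_phase p.1 _).le)).congr (.of_forall fun p => ?_)
    simp only [Function.uncurry, e0]
    exact (mul_assoc _ _ _).symm
  rw [step1]
  simp only [step2]
  rw [integral_integral_swap hint]
  simp only [integral_mul_const]
  refine (enorm_integral_le_lintegral_enorm _).trans ?_
  calc ∫⁻ p : ℝ × ℝ, ‖(∫ l : ℝ, Complex.exp (2 * Complex.I * l * (z p.1 - z p.2 : ℝ)) *
        Complex.exp (-ε * l ^ 2)) * (h p.1 * conj (h p.2))‖ₑ ∂(volume.prod volume)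
      ≤ ∫⁻ p : ℝ × ℝ, ENNReal.ofReal (√(Real.pi / ε) * Real.exp (-(1 / ε) * (p.1 - p.2) ^ 2)) *
          (‖h p.1‖ₑ * ‖h p.2‖ₑ) ∂(volume.prod volume) := by
        refine lintegral_mono fun p => ?_
        rw [enorm_mul, enorm_mul, RCLike.enorm_conj, ← ofReal_norm (∫ l : ℝ, _),
          norm_integral_gaussian hε]
        have := sq_le_sq.2 (hexp p.1 p.2)
        have : 1 / ε * (p.1 - p.2) ^ 2 ≤ 1 / ε * (z p.1 - z p.2) ^ 2 := by gcongr
        gcongr ENNReal.ofReal (_ * Real.exp ?_) * _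
        linarith
    _ ≤ 2 * (ENNReal.ofReal Real.pi * ∫⁻ x, ‖h x‖ₑ ^ 2) := by
        rw [← lintegral_gaussian_kernel hε]
        exact lintegral_mul_mul_le hh.1.enorm (by fun_prop)
    _ ≤ 3 ^ 2 * ∫⁻ x, ‖h x‖ₑ ^ 2 := by
        rw [← mul_assoc]
        gcongr
        rw [← ENNReal.ofReal_ofNat, ← ENNReal.ofReal_ofNat, ← ENNReal.ofReal_mul (by norm_num),
          ← ENNReal.ofReal_pow (by norm_num)]
        exact ENNReal.ofReal_le_ofReal (by linarith [Real.pi_le_four])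

/-- A Plancherel bound in the variable `z`, obtained by Fatou's lemma as the Gaussian weight tends
to `1`. -/
theorem eLpNorm_integral_phase_le {h : ℝ → ℂ} {z : ℝ → ℝ} (hh : Integrable h) (hz : Continuous z)
    (hexp : ∀ x y, |x - y| ≤ |z x - z y|) :
    eLpNorm (fun l : ℝ => ∫ x, Complex.exp (2 * Complex.I * l * z x) * h x) 2 ≤
      3 * eLpNorm h 2 := by
  refine eLpNorm_two_le_of_sq_le ?_
  set H : ℝ → ℂ := fun l => ∫ x, Complex.exp (2 * Complex.I * l * z x) * h x with hH
  have hHc : Continuous H := by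
    refine continuous_of_dominated (fun l => (by fun_prop : Continuous _).aestronglyMeasurable.mul hh.1)
      (fun l => .of_forall fun x => ?_) hh.norm (.of_forall fun x => by fun_prop)
    rw [norm_mul, norm_phase, one_mul]
  have hlim : ∀ l : ℝ, Tendsto (fun n : ℕ => ENNReal.ofReal (Real.exp (-(1 / ((n : ℝ) + 1)) * l ^ 2)) *
      ‖H l‖ₑ ^ 2) atTop (𝓝 (‖H l‖ₑ ^ 2)) := fun l => by
    have h1 : Tendsto (fun n : ℕ => Real.exp (-(1 / ((n : ℝ) + 1)) * l ^ 2)) atTop (𝓝 1) := by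
      have := (Real.continuous_exp.tendsto _).comp
        ((tendsto_one_div_add_atTop_nhds_zero_nat (𝕜 := ℝ)).neg.mul_const (l ^ 2))
      rwa [neg_zero, zero_mul, Real.exp_zero] at this
    have h2 := ENNReal.Tendsto.mul_const (b := ‖H l‖ₑ ^ 2) (ENNReal.tendsto_ofReal h1)
      (.inr (by finiteness))
    rwa [ENNReal.ofReal_one, one_mul] at h2
  calc ∫⁻ l, ‖H l‖ₑ ^ 2 = ∫⁻ l, liminf (fun n : ℕ =>
        ENNReal.ofReal (Real.exp (-(1 / ((n : ℝ) + 1)) * l ^ 2)) * ‖H l‖ₑ ^ 2) atTop :=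
        lintegral_congr fun l => (hlim l).liminf_eq.symm
    _ ≤ liminf (fun n : ℕ => ∫⁻ l,
        ENNReal.ofReal (Real.exp (-(1 / ((n : ℝ) + 1)) * l ^ 2)) * ‖H l‖ₑ ^ 2) atTop :=
        lintegral_liminf_le fun n => (by fun_prop)
    _ ≤ 3 ^ 2 * ∫⁻ x, ‖h x‖ₑ ^ 2 := by
        refine (liminf_le_liminf (.of_forall fun n =>
          lintegral_gaussian_phase_le hh hz hexp Nat.one_div_pos_of_nat)).trans ?_
        simp

/-- Minkowski's integral inequality in `L²`. -/
theorem eLpNorm_integral_mul_le {k : ℝ → ℂ} {D : ℝ → ℝ → ℂ} {S : ℝ≥0∞} (hk : AEStronglyMeasurable k)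
    (hD : Measurable (Function.uncurry D)) (hS : ∀ y, eLpNorm (D y) 2 ≤ S) :
    eLpNorm (fun l => ∫ y, k y * D y l) 2 ≤ (∫⁻ y, ‖k y‖ₑ) * S := by
  refine (ENNReal.pow_le_pow_left_iff two_ne_zero).1 ?_
  rw [eLpNorm_two_sq]
  have hDy : ∀ l, Measurable fun y => D y l := fun l => hD.comp (measurable_id.prodMk measurable_const)
  -- Cauchy–Schwarz after splitting `|k|` into two square roots.
  have cs : ∀ l, ‖∫ y, k y * D y l‖ₑ ^ 2 ≤ (∫⁻ y, ‖k y‖ₑ) * ∫⁻ y, ‖k y‖ₑ * ‖D y l‖ₑ ^ 2 := fun l => by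
    have half : ∀ a : ℝ≥0∞, a ^ (1 / 2 : ℝ) * a ^ (1 / 2 : ℝ) = a := fun a => by
      rw [← ENNReal.rpow_add_of_nonneg _ _ (by norm_num) (by norm_num)]
      norm_num
    have := ENNReal.lintegral_mul_le_Lp_mul_Lq volume Real.HolderConjugate.two_two
      (f := fun y => ‖k y‖ₑ ^ (1 / 2 : ℝ)) (g := fun y => ‖k y‖ₑ ^ (1 / 2 : ℝ) * ‖D y l‖ₑ)
      (hk.enorm.pow_const _) ((hk.enorm.pow_const _).mul (hDy l).enorm.aemeasurable)
    simp only [Pi.mul_apply, ← mul_assoc, half, ENNReal.rpow_two, sq] at this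
    simp only [mul_right_comm _ ‖D _ l‖ₑ, half] at this
    have h2 : ‖∫ y, k y * D y l‖ₑ ≤ ∫⁻ y, ‖k y‖ₑ * ‖D y l‖ₑ := by
      refine (enorm_integral_le_lintegral_enorm _).trans (lintegral_mono fun y => ?_)
      rw [enorm_mul]
    calc ‖∫ y, k y * D y l‖ₑ ^ 2 ≤ _ := pow_le_pow_left' (h2.trans this) 2
      _ = _ := by
        rw [mul_pow, sq, sq, half, half]
        simp only [sq, mul_assoc]
  have hm : AEMeasurable (fun p : ℝ × ℝ => ‖k p.2‖ₑ * ‖D p.2 p.1‖ₑ ^ 2) (volume.prod volume) :=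
    hk.comp_snd.enorm.mul ((hD.comp measurable_swap).enorm.pow_const 2).aemeasurable
  calc ∫⁻ l, ‖∫ y, k y * D y l‖ₑ ^ 2
      ≤ ∫⁻ l, (∫⁻ y, ‖k y‖ₑ) * ∫⁻ y, ‖k y‖ₑ * ‖D y l‖ₑ ^ 2 := lintegral_mono cs
    _ = (∫⁻ y, ‖k y‖ₑ) * ∫⁻ y, ∫⁻ l, ‖k y‖ₑ * ‖D y l‖ₑ ^ 2 := by
        rw [lintegral_const_mul'' _ hm.lintegral_prod_right',
          lintegral_lintegral_swap (f := fun l y => ‖k y‖ₑ * ‖D y l‖ₑ ^ 2) hm]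
    _ ≤ (∫⁻ y, ‖k y‖ₑ) * ∫⁻ y, ‖k y‖ₑ * S ^ 2 := by
        gcongr with y
        have hm' : Measurable (D y) := hD.comp measurable_prodMk_left
        rw [lintegral_const_mul _ (hm'.enorm.pow_const 2)]
        gcongr
        rw [← eLpNorm_two_sq]
        exact pow_le_pow_left' (hS y) 2
    _ = ((∫⁻ y, ‖k y‖ₑ) * S) ^ 2 := by
        rw [lintegral_mul_const'' _ hk.enorm]
        ring

end WKI

/-! ### Oscillatory integrals of solutions of Volterra equations -/

namespace WKI

open Filter Topology Set ComplexConjugate ENNReal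

/-- `P = c - ∫ₓ^∞ k Q` with `P` and `Q` continuous and bounded by `C`. -/
structure IsVolterra (P : ℝ → ℝ → ℂ) (c : ℂ) (k : ℝ → ℂ) (Q : ℝ → ℝ → ℂ) (C : ℝ) : Prop where
  cont_P : Continuous (Function.uncurry P)
  cont_Q : Continuous (Function.uncurry Q)
  P_bd : ∀ x l, ‖P x l‖ ≤ C
  Q_bd : ∀ x l, ‖Q x l‖ ≤ C
  eq : ∀ x l, P x l = c - ∫ y in Ioi x, k y * Q y l

theorem aestronglyMeasurable_integral_mul {k : ℝ → ℂ} {D : ℝ → ℝ → ℂ} (hk : AEStronglyMeasurable k)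
    (hD : Measurable (Function.uncurry D)) : AEStronglyMeasurable fun l => ∫ y, k y * D y l :=
  AEStronglyMeasurable.integral_prod_right' (f := fun p : ℝ × ℝ => k p.2 * D p.2 p.1)
    (hk.comp_snd.mul (hD.comp measurable_swap).aestronglyMeasurable)

/-- The oscillating factor `e^{2iλz(x)}`. -/
noncomputable def osc (z : ℝ → ℝ) (x l : ℝ) : ℂ := Complex.exp (2 * Complex.I * l * z x)

theorem continuous_osc {z : ℝ → ℝ} (hz : Continuous z) : Continuous (Function.uncurry (osc z)) := by
  simp only [osc, Function.uncurry_def]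
  fun_prop

theorem continuous_osc_left {z : ℝ → ℝ} (hz : Continuous z) (l : ℝ) : Continuous fun x => osc z x l := by
  simp only [osc]
  fun_prop

theorem norm_osc (z : ℝ → ℝ) (x l : ℝ) : ‖osc z x l‖ = 1 := norm_phase l (z x)

theorem osc_add (z : ℝ → ℝ) (x l t : ℝ) : osc z x (l + t) = osc z x l * osc z x t := by
  rw [osc, osc, osc, ← Complex.exp_add]
  congr 1; push_cast; ring

theorem norm_osc_sub_one_le (z : ℝ → ℝ) (x t : ℝ) : ‖osc z x t - 1‖ ≤ 2 * |t| * ‖(z x : ℂ)‖ := by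
  have h2 : osc z x t = Complex.exp (Complex.I * (2 * t * z x : ℝ)) := by
    rw [osc]
    congr 1; push_cast; ring
  have h1 := Real.norm_exp_I_mul_ofReal_sub_one_le (x := 2 * t * z x)
  rwa [norm_mul, norm_mul, Real.norm_eq_abs t, Real.norm_ofNat, ← Complex.norm_real (z x), ← h2] at h1

theorem integrable_osc_mul {φ : ℝ → ℂ} {z : ℝ → ℝ} {R : ℝ → ℝ → ℂ} {B : ℝ} (hφ : Integrable φ)
    (hz : Continuous z) (hR : Continuous (Function.uncurry R)) (hB : ∀ x l, ‖R x l‖ ≤ B) (l : ℝ) :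
    Integrable fun x => osc z x l * (φ x * R x l) :=
  (hφ.mul_bdd (c := B) (hR.comp (by fun_prop : Continuous fun x : ℝ =>
    (x, l))).aestronglyMeasurable (.of_forall fun x => hB x l)).bdd_mul (c := 1)
    (continuous_osc_left hz l).aestronglyMeasurable (.of_forall fun x => (norm_osc z x l).le)

theorem aestronglyMeasurable_integral_osc_mul {φ : ℝ → ℂ} {z : ℝ → ℝ} {R : ℝ → ℝ → ℂ}
    (hφ : Integrable φ) (hz : Continuous z) (hR : Continuous (Function.uncurry R)) :
    AEStronglyMeasurable fun l => ∫ x, osc z x l * (φ x * R x l) := by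
  have := aestronglyMeasurable_integral_mul hφ.1 (D := fun x l => osc z x l * R x l)
    ((continuous_osc hz).mul hR).measurable
  simpa only [mul_left_comm (φ _)] using this

/-- The oscillatory integral over a half line. -/
noncomputable def oscIio (z : ℝ → ℝ) (h : ℝ → ℂ) (y l : ℝ) : ℂ := ∫ x in Iio y, osc z x l * h x

theorem continuous_oscIio {h : ℝ → ℂ} {z : ℝ → ℝ} (hh : Integrable h) (hz : Continuous z) :
    Continuous (Function.uncurry (oscIio z h)) := by
  have := (continuous_setIntegral_Ioi (Λ := ℝ) (H := fun p x => osc z (-x) p.2 * h (-x))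
    (b := fun x => ‖h (-x)‖) (fun p => ?_) (fun p y _ => ?_) hh.comp_neg.norm
    (fun y => norm_nonneg _) (fun y => ?_)).comp
    (by fun_prop : Continuous fun p : ℝ × ℝ => (-p.1, p.2))
  · refine this.congr fun p => ?_
    simp only [Function.comp_apply, Function.uncurry_def, oscIio]
    rw [integral_comp_neg_Ioi (f := fun x => osc z x p.2 * h x), neg_neg, integral_Iic_eq_integral_Iio]
  · exact ((continuous_osc_left hz p.2).comp continuous_neg).aestronglyMeasurable.mul hh.comp_neg.1
  · rw [norm_mul, norm_osc, one_mul]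
  · exact ((continuous_osc hz).comp (by fun_prop : Continuous fun p : ℝ × ℝ => (-y, p.2))).mul
      continuous_const

theorem eLpNorm_oscIio_le {h : ℝ → ℂ} {z : ℝ → ℝ} (hh : Integrable h) (hz : Continuous z)
    (hexp : ∀ x y, |x - y| ≤ |z x - z y|) (y : ℝ) : eLpNorm (oscIio z h y) 2 ≤ 3 * eLpNorm h 2 := by
  have h1 := eLpNorm_integral_phase_le (hh.indicator (measurableSet_Iio (a := y))) hz hexp
  have e : oscIio z h y = fun l : ℝ =>
      ∫ x, Complex.exp (2 * Complex.I * l * z x) * (Iio y).indicator h x := by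
    funext l
    rw [oscIio, ← integral_indicator measurableSet_Iio]
    congr 1
    funext x
    by_cases hx : x ∈ Iio y
    · simp only [indicator_of_mem hx, osc]
    · simp only [indicator_of_notMem hx, mul_zero]
  rw [e]
  exact h1.trans (by gcongr; exact eLpNorm_indicator_le h)

/-- The Volterra equation is inserted for `P` and Fubini is used on `x < y`. What remains are
oscillatory integrals of `h` alone, to which the `L²` bound applies although `P` depends on `l`. -/
theorem IsVolterra.integral_osc {h k : ℝ → ℂ} {z : ℝ → ℝ} {P Q : ℝ → ℝ → ℂ} {c : ℂ} {C : ℝ}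
    (hP : IsVolterra P c k Q C) (hh : Integrable h) (hk : Integrable k) (hz : Continuous z) (l : ℝ) :
    ∫ x, osc z x l * (h x * P x l) =
      c * (∫ x, osc z x l * h x) - ∫ y, k y * (Q y l * oscIio z h y l) := by
  have i1 : Integrable fun x => osc z x l * h x := hh.bdd_mul (c := 1)
    (continuous_osc_left hz l).aestronglyMeasurable (.of_forall fun x => (norm_osc z x l).le)
  have i2 : Integrable fun y => k y * Q y l := hk.mul_bdd (c := C)
    (hP.cont_Q.comp (by fun_prop : Continuous fun x : ℝ => (x, l))).aestronglyMeasurable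
    (.of_forall fun x => hP.Q_bd x l)
  have hm : MeasurableSet {p : ℝ × ℝ | p.1 < p.2} := measurableSet_lt measurable_fst measurable_snd
  have i3 : Integrable (Function.uncurry fun x y =>
      (Ioi x).indicator (fun y => osc z x l * h x * (k y * Q y l)) y) (volume.prod volume) :=
    ((i1.mul_prod i2).indicator hm).congr (.of_forall fun p => by
      simp only [indicator, mem_ofPred_eq, mem_Ioi, Function.uncurry_def])
  have i4 : Integrable fun x =>
      ∫ y, (Ioi x).indicator (fun y => osc z x l * h x * (k y * Q y l)) y := i3.integral_prod_left
  have e1 : ∀ x, osc z x l * (h x * P x l) = c * (osc z x l * h x) -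
      ∫ y, (Ioi x).indicator (fun y => osc z x l * h x * (k y * Q y l)) y := fun x => by
    rw [integral_indicator measurableSet_Ioi, integral_const_mul, hP.eq x l]
    ring
  have e2 : ∀ y, k y * (Q y l * oscIio z h y l) =
      ∫ x, (Ioi x).indicator (fun y => osc z x l * h x * (k y * Q y l)) y := fun y => by
    rw [oscIio, ← integral_indicator measurableSet_Iio, ← mul_assoc, ← integral_const_mul]
    congr 1
    funext x
    by_cases hx : x < y
    · rw [indicator_of_mem (show x ∈ Iio y from hx), indicator_of_mem (show y ∈ Ioi x from hx)]
      ring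
    · rw [indicator_of_notMem (show x ∉ Iio y from hx), indicator_of_notMem (show y ∉ Ioi x from hx),
        mul_zero]
  simp only [e1, e2]
  rw [integral_sub (i1.const_mul c) i4, integral_const_mul, integral_integral_swap i3]

theorem IsVolterra.eLpNorm_integral_osc_le {h k : ℝ → ℂ} {z : ℝ → ℝ} {P Q : ℝ → ℝ → ℂ} {c : ℂ}
    {C : ℝ} (hP : IsVolterra P c k Q C) (hh : Integrable h) (hk : Integrable k) (hz : Continuous z)
    (hexp : ∀ x y, |x - y| ≤ |z x - z y|) :
    eLpNorm (fun l : ℝ => ∫ x, osc z x l * (h x * P x l)) 2 ≤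
      3 * (‖c‖ₑ + (∫⁻ y, ‖k y‖ₑ) * ENNReal.ofReal C) * eLpNorm h 2 := by
  have hDm : Measurable (Function.uncurry fun y l => Q y l * oscIio z h y l) :=
    (hP.cont_Q.mul (continuous_oscIio hh hz)).measurable
  have hD : ∀ y, eLpNorm (fun l => Q y l * oscIio z h y l) 2 ≤
      ENNReal.ofReal C * (3 * eLpNorm h 2) := fun y => by
    refine (eLpNorm_le_mul_eLpNorm_of_ae_le_mul (c := C) (g := oscIio z h y)
      (.of_forall fun l => ?_) 2).trans ?_
    · rw [norm_mul]
      gcongr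
      exact hP.Q_bd y l
    · gcongr
      exact eLpNorm_oscIio_le hh hz hexp y
  have m1 : AEStronglyMeasurable fun l => c * ∫ x, osc z x l * h x := by
    have := (aestronglyMeasurable_integral_mul hh.1 (continuous_osc hz).measurable).const_mul c
    simpa only [mul_comm (h _)] using this
  simp only [hP.integral_osc hh hk hz]
  refine (eLpNorm_sub_le m1 (aestronglyMeasurable_integral_mul hk.1 hDm) one_le_two).trans ?_
  calc _ ≤ ‖c‖ₑ * (3 * eLpNorm h 2) + (∫⁻ y, ‖k y‖ₑ) * (ENNReal.ofReal C * (3 * eLpNorm h 2)) := by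
        gcongr
        · refine (eLpNorm_const_smul_le (c := c) (f := fun l => ∫ x, osc z x l * h x)).trans ?_
          gcongr
          exact eLpNorm_integral_phase_le hh hz hexp
        · exact eLpNorm_integral_mul_le hk.1 hDm hD
    _ = _ := by ring

/-- The difference splits in two. Changing the phase multiplies `h` by `osc z x t - 1`, of size at
most `2|t||z|`, while `P` stays and is handled by its Volterra equation. Changing `P` to `P₀` is
estimated by Minkowski's inequality with the `L¹` norm of `h`. -/
theorem IsVolterra.eLpNorm_shift_sub_le {h k : ℝ → ℂ} {z : ℝ → ℝ} {P P₀ Q : ℝ → ℝ → ℂ} {c : ℂ}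
    {C C₀ : ℝ} {S : ℝ≥0∞} (hP : IsVolterra P c k Q C) (hh : Integrable h) (hk : Integrable k)
    (hz : Continuous z) (hexp : ∀ x y, |x - y| ≤ |z x - z y|)
    (hP₀ : Continuous (Function.uncurry P₀)) (hC₀ : ∀ x l, ‖P₀ x l‖ ≤ C₀)
    (hS : ∀ y, eLpNorm (fun l => P y l - P₀ y l) 2 ≤ S) (t : ℝ) {U : Set ℝ} (hU : MeasurableSet U) :
    eLpNorm (fun l : ℝ => (∫ x in U, osc z x (l + t) * (h x * P x l)) -
        ∫ x in U, osc z x l * (h x * P₀ x l)) 2 ≤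
      ENNReal.ofReal |t| * (6 * (‖c‖ₑ + (∫⁻ y, ‖k y‖ₑ) * ENNReal.ofReal C) *
        eLpNorm (fun x => z x * h x) 2) + (∫⁻ y, ‖h y‖ₑ) * S := by
  have het := (continuous_osc_left hz t).sub (continuous_const (y := (1 : ℂ)))
  have hi' : Integrable (U.indicator fun x => h x * (osc z x t - 1)) := by
    refine (hh.mul_bdd (c := 2) het.aestronglyMeasurable (.of_forall fun x => ?_)).indicator hU
    refine (norm_sub_le _ _).trans ?_
    rw [norm_osc, norm_one]; norm_num
  have hn' : eLpNorm (U.indicator fun x => h x * (osc z x t - 1)) 2 ≤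
      ENNReal.ofReal (2 * |t|) * eLpNorm (fun x => z x * h x) 2 := by
    refine (eLpNorm_indicator_le _).trans
      (eLpNorm_le_mul_eLpNorm_of_ae_le_mul (.of_forall fun x => ?_) 2)
    rw [norm_mul, norm_mul]
    calc ‖h x‖ * ‖osc z x t - 1‖ ≤ ‖h x‖ * (2 * |t| * ‖(z x : ℂ)‖) := by
          gcongr
          exact norm_osc_sub_one_le z x t
      _ = _ := by ring
  have hDc : Continuous (Function.uncurry fun y l => osc z y l * (P y l - P₀ y l)) :=
    (continuous_osc hz).mul (hP.cont_P.sub hP₀)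
  have hD : ∀ y, eLpNorm (fun l => osc z y l * (P y l - P₀ y l)) 2 ≤ S := fun y => by
    refine (eLpNorm_mono fun l => ?_).trans (hS y)
    rw [norm_mul, norm_osc, one_mul]
  have key : ∀ l : ℝ, (∫ x in U, osc z x (l + t) * (h x * P x l)) -
      ∫ x in U, osc z x l * (h x * P₀ x l) =
      (∫ x, osc z x l * (U.indicator (fun x => h x * (osc z x t - 1)) x * P x l)) +
        ∫ y, U.indicator h y * (osc z y l * (P y l - P₀ y l)) := fun l => by
    have i1 : Integrable fun x => U.indicator h x * (osc z x l * (P x l - P₀ x l)) := by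
      have := (integrable_osc_mul (hh.indicator hU) hz hP.cont_P hP.P_bd l).sub
        (integrable_osc_mul (hh.indicator hU) hz hP₀ hC₀ l)
      refine this.congr (.of_forall fun x => ?_)
      simp only [Pi.sub_apply]
      ring
    have i2 : Integrable fun x => osc z x (l + t) * (h x * P x l) := by
      have := integrable_osc_mul (hh.bdd_mul (c := 1) (continuous_osc_left hz t).aestronglyMeasurable
        (.of_forall fun x => (norm_osc z x t).le)) hz hP.cont_P hP.P_bd l
      refine this.congr (.of_forall fun x => ?_)
      simp only [osc_add]
      ring
    have i3 := integrable_osc_mul hh hz hP₀ hC₀ l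
    rw [← integral_sub i2.integrableOn i3.integrableOn, ← integral_indicator hU,
      ← integral_add (integrable_osc_mul hi' hz hP.cont_P hP.P_bd l) i1]
    congr 1
    funext x
    by_cases hx : x ∈ U
    · simp only [indicator_of_mem hx, osc_add]
      ring
    · simp only [indicator_of_notMem hx]
      ring
  simp only [key]
  refine (eLpNorm_add_le (aestronglyMeasurable_integral_osc_mul hi' hz hP.cont_P)
    (aestronglyMeasurable_integral_mul (hh.indicator hU).1 hDc.measurable) one_le_two).trans
    (add_le_add ?_ ?_)
  · refine (hP.eLpNorm_integral_osc_le hi' hk hz hexp).trans ?_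
    calc _ ≤ 3 * (‖c‖ₑ + (∫⁻ y, ‖k y‖ₑ) * ENNReal.ofReal C) *
          (ENNReal.ofReal (2 * |t|) * eLpNorm (fun x => z x * h x) 2) := by gcongr
      _ = ENNReal.ofReal |t| * ((3 * 2) * (‖c‖ₑ + (∫⁻ y, ‖k y‖ₑ) * ENNReal.ofReal C) *
        eLpNorm (fun x => z x * h x) 2) := by
        rw [ENNReal.ofReal_mul zero_le_two, ENNReal.ofReal_ofNat]
        ring
      _ = _ := by norm_num
  · refine (eLpNorm_integral_mul_le (hh.indicator hU).1 hDc.measurable hD).trans ?_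
    gcongr with y
    exact enorm_indicator_le_enorm_self _ _

end WKI

namespace WKI

open Filter Topology Set ComplexConjugate ENNReal

/-! ### Lipschitz dependence of the Jost solutions on `λ` in `L²` -/

theorem osc_neg_mul (z : ℝ → ℝ) (x l : ℝ) : osc (fun x => -z x) x l * osc z x l = 1 :=
  exp_phase_neg_mul l (z x)

theorem eLpNorm_shift {F : ℝ → ℂ} (hF : AEStronglyMeasurable F) (t : ℝ) :
    eLpNorm (fun l => F (l + t)) 2 = eLpNorm F 2 :=
  eLpNorm_comp_measurePreserving hF (measurePreserving_add_right volume t)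

/-- Absorption of the terms with factor `1/4`; it is only valid because `a` and `b` are known to be
finite. -/
theorem le_of_le_add_quarter_mul {a b x y : ℝ≥0∞} (ha : a ≠ ⊤) (hb : b ≠ ⊤) (h1 : a ≤ x + 4⁻¹ * b)
    (h2 : b ≤ y + 4⁻¹ * a) : a ≤ 2 * (x + y) ∧ b ≤ 2 * (x + y) := by
  rcases eq_or_ne x ⊤ with rfl | hx
  · simp
  rcases eq_or_ne y ⊤ with rfl | hy
  · simp
  have h4 : (4⁻¹ : ℝ≥0∞) ≠ ⊤ := by simp
  have h1' := ENNReal.toReal_mono (by finiteness) h1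
  have h2' := ENNReal.toReal_mono (by finiteness) h2
  rw [ENNReal.toReal_add hx (by finiteness), ENNReal.toReal_mul, ENNReal.toReal_inv,
    ENNReal.toReal_ofNat] at h1'
  rw [ENNReal.toReal_add hy (by finiteness), ENNReal.toReal_mul, ENNReal.toReal_inv,
    ENNReal.toReal_ofNat] at h2'
  have hx0 : 0 ≤ x.toReal := ENNReal.toReal_nonneg
  have hy0 : 0 ≤ y.toReal := ENNReal.toReal_nonneg
  constructor
  all_goals
    rw [← ENNReal.toReal_le_toReal (by assumption) (by finiteness), ENNReal.toReal_mul,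
      ENNReal.toReal_add hx hy, ENNReal.toReal_ofNat]
    linarith

theorem integral_norm_le_quarter {f : ℝ → ℂ} (hf : Integrable f) (h : ∫⁻ x, ‖f x‖ₑ ≤ 4⁻¹) :
    ∫ x, ‖f x‖ ≤ 1 / 4 := by
  have := ENNReal.toReal_mono (by simp) h
  rwa [← integral_norm_eq_lintegral_enorm hf.1, ENNReal.toReal_inv, ENNReal.toReal_ofNat,
    ← one_div] at this

/-- A Jost solution of the transformed problem with small weighted data. -/
structure IsWeightedGaugeJost (f g : ℝ → ℂ) (z : ℝ → ℝ) (α β : ℝ → ℂ → ℂ) : Prop extends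
    IsGaugeJost f g z α β where
  f_int : Integrable f
  g_int : Integrable g
  f_memLp : MemLp f 2
  g_memLp : MemLp g 2
  zf_memLp : MemLp (fun x => z x * f x) 2
  zg_memLp : MemLp (fun x => z x * g x) 2
  f_small : ∫⁻ x, ‖f x‖ₑ ≤ 4⁻¹
  g_small : ∫⁻ x, ‖g x‖ₑ ≤ 4⁻¹
  z_cont : Continuous z
  z_exp : ∀ x y, |x - y| ≤ |z x - z y|

namespace IsWeightedGaugeJost

variable {f g : ℝ → ℂ} {z : ℝ → ℝ} {α β : ℝ → ℂ → ℂ}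

theorem z_exp_neg (h : IsWeightedGaugeJost f g z α β) (x y : ℝ) : |x - y| ≤ |-z x - -z y| := by
  rw [neg_sub_neg, abs_sub_comm (z y)]
  exact h.z_exp x y

theorem z_cont_neg (h : IsWeightedGaugeJost f g z α β) : Continuous fun x => -z x := h.z_cont.neg

theorem zf_memLp_neg (h : IsWeightedGaugeJost f g z α β) : MemLp (fun x => (-z x : ℝ) * f x) 2 :=
  h.zf_memLp.neg.ae_eq (.of_forall fun x => by simp)

theorem continuous_shift_α (h : IsWeightedGaugeJost f g z α β) (t : ℝ) :
    Continuous (Function.uncurry fun x l : ℝ => α x (l + t : ℝ)) :=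
  h.cont_α.comp (by fun_prop : Continuous fun p : ℝ × ℝ => (p.1, ((p.2 + t : ℝ) : ℂ)))

theorem continuous_shift_β (h : IsWeightedGaugeJost f g z α β) (t : ℝ) :
    Continuous (Function.uncurry fun x l : ℝ => β x (l + t : ℝ)) :=
  h.cont_β.comp (by fun_prop : Continuous fun p : ℝ × ℝ => (p.1, ((p.2 + t : ℝ) : ℂ)))

theorem continuous_shift_osc (h : IsWeightedGaugeJost f g z α β) (t : ℝ) :
    Continuous (Function.uncurry fun x l : ℝ => osc z x (l + t)) :=
  (continuous_osc h.z_cont).comp (by fun_prop : Continuous fun p : ℝ × ℝ => (p.1, p.2 + t))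

theorem isVolterra_α (h : IsWeightedGaugeJost f g z α β) (t : ℝ) :
    IsVolterra (fun x l => α x (l + t : ℝ)) 1 f (fun x l => β x (l + t : ℝ)) (4 / 3) where
  cont_P := h.continuous_shift_α t
  cont_Q := h.continuous_shift_β t
  P_bd x l := h.α_norm x _
  Q_bd x l := (h.β_bd x _).trans (by norm_num)
  eq x l := h.α_eq x _ (Complex.ofReal_im _).ge

theorem osc_mul_β (h : IsWeightedGaugeJost f g z α β) (x l : ℝ) :
    osc z x l * β x l = -∫ y in Ioi x, osc z y l * (g y * α y l) := by
  rw [h.β_eq x l (Complex.ofReal_im _).ge, mul_neg, ← integral_const_mul]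
  congr 2
  funext y
  rw [exp_phase_sub]
  simp only [osc]
  linear_combination (Complex.exp (2 * Complex.I * l * z y) * (g y * α y l)) *
    exp_phase_neg_mul l (z x)

theorem isVolterra_β (h : IsWeightedGaugeJost f g z α β) (t : ℝ) :
    IsVolterra (fun x l => osc z x (l + t) * β x (l + t : ℝ)) 0 g
      (fun x l => osc z x (l + t) * α x (l + t : ℝ)) (4 / 3) where
  cont_P := (h.continuous_shift_osc t).mul (h.continuous_shift_β t)
  cont_Q := (h.continuous_shift_osc t).mul (h.continuous_shift_α t)
  P_bd x l := by
    rw [norm_mul, norm_osc, one_mul]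
    exact (h.β_bd x _).trans (by norm_num)
  Q_bd x l := by
    rw [norm_mul, norm_osc, one_mul]
    exact h.α_norm x _
  eq x l := by
    rw [h.osc_mul_β, zero_sub]
    simp only [mul_left_comm (g _)]

/-- Writing `β` through `e^{2iλz} β` turns `∫ fβ` into an oscillatory integral with phase `-z`,
whose amplitude has its own Volterra equation. -/
theorem mul_β_eq (φ : ℝ → ℂ) (y l : ℝ) :
    φ y * β y l = osc (fun x => -z x) y l * (φ y * (osc z y l * β y l)) := by
  linear_combination (-(φ y * β y l)) * osc_neg_mul z y l

theorem α_eq_osc (h : IsWeightedGaugeJost f g z α β) (x l : ℝ) : α x l = 1 - ∫ y in Ioi x,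
    osc (fun x => -z x) y l * (f y * (osc z y l * β y l)) := by
  rw [h.α_eq x _ (Complex.ofReal_im _).ge]
  simp only [← mul_β_eq]

theorem continuous_α_snd (h : IsWeightedGaugeJost f g z α β) (x : ℝ) : Continuous fun l : ℝ => α x l :=
  h.cont_α.comp (by fun_prop : Continuous fun l : ℝ => (x, (l : ℂ)))

theorem continuous_oscβ_snd (h : IsWeightedGaugeJost f g z α β) (x : ℝ) :
    Continuous fun l : ℝ => osc z x l * β x l :=
  ((continuous_osc h.z_cont).comp (by fun_prop : Continuous fun l : ℝ => (x, l))).mul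
    (h.cont_β.comp (by fun_prop : Continuous fun l : ℝ => (x, (l : ℂ))))

theorem setIntegral_osc (z : ℝ → ℝ) (φ : ℝ → ℂ) (R : ℝ → ℝ → ℂ) (x l : ℝ) :
    ∫ y in Ioi x, osc z y l * (φ y * R y l) =
      ∫ y, osc z y l * ((Ioi x).indicator φ y * R y l) := by
  rw [← integral_indicator measurableSet_Ioi]
  congr 1
  funext y
  by_cases hy : y ∈ Ioi x
  · simp only [indicator_of_mem hy]
  · simp only [indicator_of_notMem hy]
    ring

/-- An a priori bound, uniform in `y` because cutting `f` and `g` to a half line does not increase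
their norms. It supplies the finiteness needed for absorption. -/
theorem exists_eLpNorm_le (h : IsWeightedGaugeJost f g z α β) : ∃ M : ℝ≥0∞, M ≠ ⊤ ∧ ∀ y,
    eLpNorm (fun l : ℝ => α y l - 1) 2 ≤ M ∧ eLpNorm (fun l : ℝ => osc z y l * β y l) 2 ≤ M := by
  have hW := h.isVolterra_β 0
  have hA := h.isVolterra_α 0
  simp only [add_zero] at hW hA
  refine ⟨max (3 * (‖(0 : ℂ)‖ₑ + (∫⁻ y, ‖g y‖ₑ) * ENNReal.ofReal (4 / 3)) * eLpNorm f 2)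
    (3 * (‖(1 : ℂ)‖ₑ + (∫⁻ y, ‖f y‖ₑ) * ENNReal.ofReal (4 / 3)) * eLpNorm g 2), ?_, fun y => ⟨?_, ?_⟩⟩
  · have h1 := h.f_memLp.2
    have h2 := h.g_memLp.2
    have h3 := h.f_int.2
    have h4 := h.g_int.2
    rw [HasFiniteIntegral] at h3 h4
    exact (max_lt (by finiteness) (by finiteness)).ne
  · refine le_max_of_le_left ?_
    have := hW.eLpNorm_integral_osc_le (h.f_int.indicator (measurableSet_Ioi (a := y))) h.g_int
      h.z_cont_neg h.z_exp_neg
    have e : (fun l : ℝ => α y l - 1) = -fun l : ℝ => ∫ x, osc (fun x => -z x) x l *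
        ((Ioi y).indicator f x * (osc z x l * β x l)) := by
      funext l
      rw [h.α_eq_osc, setIntegral_osc (fun x => -z x) f (fun x l => osc z x l * β x l), Pi.neg_apply]
      ring
    rw [e, eLpNorm_neg]
    exact this.trans (by gcongr; exact eLpNorm_indicator_le f)
  · refine le_max_of_le_right ?_
    have := hA.eLpNorm_integral_osc_le (h.g_int.indicator (measurableSet_Ioi (a := y))) h.f_int
      h.z_cont h.z_exp
    have e : (fun l : ℝ => osc z y l * β y l) = -fun l : ℝ => ∫ x, osc z x l *
        ((Ioi y).indicator g x * α x l) := by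
      funext l
      rw [h.osc_mul_β, setIntegral_osc z g (fun x l => α x l), Pi.neg_apply]
    rw [e, eLpNorm_neg]
    exact this.trans (by gcongr; exact eLpNorm_indicator_le g)

theorem eLpNorm_shift_α_le (h : IsWeightedGaugeJost f g z α β) {S : ℝ≥0∞} (t : ℝ)
    (hS : ∀ y, eLpNorm (fun l : ℝ => osc z y (l + t) * β y (l + t : ℝ) - osc z y l * β y l) 2 ≤ S)
    (y : ℝ) : eLpNorm (fun l : ℝ => α y (l + t : ℝ) - α y l) 2 ≤
      ENNReal.ofReal |t| * (6 * (‖(0 : ℂ)‖ₑ + (∫⁻ y, ‖g y‖ₑ) * ENNReal.ofReal (4 / 3)) *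
        eLpNorm (fun x => (-z x : ℝ) * f x) 2) + 4⁻¹ * S := by
  have hQ0 := h.isVolterra_β 0
  simp only [add_zero] at hQ0
  have := (h.isVolterra_β t).eLpNorm_shift_sub_le h.f_int h.g_int h.z_cont_neg h.z_exp_neg
    hQ0.cont_P hQ0.P_bd hS t (measurableSet_Ioi (a := y))
  rw [← eLpNorm_neg] at this
  have e : (fun l : ℝ => α y (l + t : ℝ) - α y l) =
      -fun l : ℝ => (∫ x in Ioi y, osc (fun x => -z x) x (l + t) *
        (f x * (osc z x (l + t) * β x (l + t : ℝ)))) -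
        ∫ x in Ioi y, osc (fun x => -z x) x l * (f x * (osc z x l * β x l)) := by
    funext l
    rw [h.α_eq_osc, h.α_eq_osc, Pi.neg_apply]
    ring
  rw [e]
  refine this.trans ?_
  gcongr
  exact h.f_small

theorem eLpNorm_shift_β_le (h : IsWeightedGaugeJost f g z α β) {S : ℝ≥0∞} (t : ℝ)
    (hS : ∀ y, eLpNorm (fun l : ℝ => α y (l + t : ℝ) - α y l) 2 ≤ S) (y : ℝ) :
    eLpNorm (fun l : ℝ => osc z y (l + t) * β y (l + t : ℝ) - osc z y l * β y l) 2 ≤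
      ENNReal.ofReal |t| * (6 * (‖(1 : ℂ)‖ₑ + (∫⁻ y, ‖f y‖ₑ) * ENNReal.ofReal (4 / 3)) *
        eLpNorm (fun x => z x * g x) 2) + 4⁻¹ * S := by
  have hP0 := h.isVolterra_α 0
  simp only [add_zero] at hP0
  have := (h.isVolterra_α t).eLpNorm_shift_sub_le h.g_int h.f_int h.z_cont h.z_exp
    hP0.cont_P hP0.P_bd hS t (measurableSet_Ioi (a := y))
  rw [← eLpNorm_neg] at this
  have e : (fun l : ℝ => osc z y (l + t) * β y (l + t : ℝ) - osc z y l * β y l) =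
      -fun l : ℝ => (∫ x in Ioi y, osc z x (l + t) * (g x * α x (l + t : ℝ))) -
        ∫ x in Ioi y, osc z x l * (g x * α x l) := by
    funext l
    rw [h.osc_mul_β, h.osc_mul_β, Pi.neg_apply]
    ring
  rw [e]
  refine this.trans ?_
  gcongr
  exact h.g_small

theorem eLpNorm_shift_sub_le_two_mul {F : ℝ → ℂ} (hF : Continuous F) (c : ℂ) {M : ℝ≥0∞}
    (hM : eLpNorm (fun l => F l - c) 2 ≤ M) (t : ℝ) : eLpNorm (fun l => F (l + t) - F l) 2 ≤ M + M := by
  have e : (fun l => F (l + t) - F l) = (fun l => F (l + t) - c) - fun l => F l - c := by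
    funext l
    simp
  have h2 : AEStronglyMeasurable (fun l => F l - c) := (hF.sub continuous_const).aestronglyMeasurable
  have h1 : AEStronglyMeasurable (fun l => F (l + t) - c) :=
    ((hF.comp (by fun_prop : Continuous fun l : ℝ => l + t)).sub continuous_const).aestronglyMeasurable
  rw [e]
  refine (eLpNorm_sub_le h1 h2 one_le_two).trans (add_le_add ?_ hM)
  rw [eLpNorm_shift h2 t]
  exact hM

/-- The shift estimates for `α` and for `e^{2iλz} β` involve each other with the factor `1/4` coming
from the small `L¹` norms of `f` and `g`. After suprema over `y`, which are finite, these terms are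
absorbed. -/
theorem exists_shift_le (h : IsWeightedGaugeJost f g z α β) : ∃ K : ℝ≥0∞, K ≠ ⊤ ∧ ∀ t y,
    eLpNorm (fun l : ℝ => α y (l + t : ℝ) - α y l) 2 ≤ ENNReal.ofReal |t| * K ∧
    eLpNorm (fun l : ℝ => osc z y (l + t) * β y (l + t : ℝ) - osc z y l * β y l) 2 ≤
      ENNReal.ofReal |t| * K := by
  obtain ⟨M, hM, hb⟩ := h.exists_eLpNorm_le
  refine ⟨2 * ((6 * (‖(0 : ℂ)‖ₑ + (∫⁻ y, ‖g y‖ₑ) * ENNReal.ofReal (4 / 3)) *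
    eLpNorm (fun x => (-z x : ℝ) * f x) 2) + (6 * (‖(1 : ℂ)‖ₑ + (∫⁻ y, ‖f y‖ₑ) *
    ENNReal.ofReal (4 / 3)) * eLpNorm (fun x => z x * g x) 2)), ?_, fun t => ?_⟩
  · have h1 := h.zf_memLp_neg.2
    have h2 := h.zg_memLp.2
    have h3 := h.f_int.2
    have h4 := h.g_int.2
    rw [HasFiniteIntegral] at h3 h4
    finiteness
  have fA : ⨆ y, eLpNorm (fun l : ℝ => α y (l + t : ℝ) - α y l) 2 ≠ ⊤ :=
    ne_top_of_le_ne_top (ENNReal.add_ne_top.2 ⟨hM, hM⟩) (iSup_le fun y =>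
      eLpNorm_shift_sub_le_two_mul (h.continuous_α_snd y) 1 (hb y).1 t)
  have fW : ⨆ y, eLpNorm (fun l : ℝ => osc z y (l + t) * β y (l + t : ℝ) - osc z y l * β y l) 2 ≠ ⊤ :=
    ne_top_of_le_ne_top (ENNReal.add_ne_top.2 ⟨hM, hM⟩) (iSup_le fun y =>
      eLpNorm_shift_sub_le_two_mul (h.continuous_oscβ_snd y) 0 (by simpa using (hb y).2) t)
  have sA := le_iSup fun y => eLpNorm (fun l : ℝ => α y (l + t : ℝ) - α y l) 2
  have sW := le_iSup fun y =>
    eLpNorm (fun l : ℝ => osc z y (l + t) * β y (l + t : ℝ) - osc z y l * β y l) 2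
  obtain ⟨r1, r2⟩ := le_of_le_add_quarter_mul fA fW (iSup_le (h.eLpNorm_shift_α_le t sW))
    (iSup_le (h.eLpNorm_shift_β_le t sA))
  rw [← mul_add, mul_left_comm] at r1 r2
  exact fun y => ⟨(sA y).trans r1, (sW y).trans r2⟩

/-! ### The scattering integrals -/

theorem norm_integral_osc_α_le (h : IsWeightedGaugeJost f g z α β) {φ : ℝ → ℂ} (hφ : Integrable φ)
    (l : ℝ) : ‖∫ x, osc z x l * (φ x * α x l)‖ ≤ (∫ x, ‖φ x‖) * (4 / 3) := by
  rw [← integral_mul_const]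
  refine norm_integral_le_of_norm_le (hφ.norm.mul_const _) (.of_forall fun x => ?_)
  rw [norm_mul, norm_osc, one_mul, norm_mul]
  gcongr
  exact h.α_norm x _

theorem memLp_integral_osc_α (h : IsWeightedGaugeJost f g z α β) {φ : ℝ → ℂ} (hφ : Integrable φ)
    (hφ2 : MemLp φ 2) : MemLp (fun l : ℝ => ∫ x, osc z x l * (φ x * α x l)) 2 := by
  have hA := h.isVolterra_α 0
  simp only [add_zero] at hA
  refine ⟨aestronglyMeasurable_integral_osc_mul (R := fun x l => α x l) hφ h.z_cont hA.cont_P,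
    (hA.eLpNorm_integral_osc_le hφ h.f_int h.z_cont h.z_exp).trans_lt ?_⟩
  have h1 := hφ2.2
  have h3 := h.f_int.2
  rw [HasFiniteIntegral] at h3
  finiteness

theorem exists_shift_integral_osc_α_le (h : IsWeightedGaugeJost f g z α β) {φ : ℝ → ℂ}
    (hφ : Integrable φ) (hzφ : MemLp (fun x => z x * φ x) 2) : ∃ K : ℝ≥0∞, K ≠ ⊤ ∧ ∀ t,
      eLpNorm (fun l : ℝ => (∫ x, osc z x (l + t) * (φ x * α x (l + t : ℝ))) -
        ∫ x, osc z x l * (φ x * α x l)) 2 ≤ ENNReal.ofReal |t| * K := by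
  obtain ⟨K, hK, hb⟩ := h.exists_shift_le
  have hA := h.isVolterra_α 0
  simp only [add_zero] at hA
  refine ⟨6 * (‖(1 : ℂ)‖ₑ + (∫⁻ y, ‖f y‖ₑ) * ENNReal.ofReal (4 / 3)) *
    eLpNorm (fun x => z x * φ x) 2 + (∫⁻ y, ‖φ y‖ₑ) * K, ?_, fun t => ?_⟩
  · have h1 := hzφ.2
    have h3 := h.f_int.2
    have h4 := hφ.2
    rw [HasFiniteIntegral] at h3 h4
    finiteness
  · have := (h.isVolterra_α t).eLpNorm_shift_sub_le hφ h.f_int h.z_cont h.z_exp hA.cont_P hA.P_bd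
      (fun y => (hb t y).1) t MeasurableSet.univ
    simp only [Measure.restrict_univ] at this
    refine this.trans (le_of_eq ?_)
    ring

theorem exists_shift_integral_fβ_le (h : IsWeightedGaugeJost f g z α β) : ∃ K : ℝ≥0∞, K ≠ ⊤ ∧ ∀ t,
      eLpNorm (fun l : ℝ => (∫ x, f x * β x (l + t : ℝ)) - ∫ x, f x * β x l) 2 ≤
        ENNReal.ofReal |t| * K := by
  obtain ⟨K, hK, hb⟩ := h.exists_shift_le
  have hW := h.isVolterra_β 0
  simp only [add_zero] at hW
  refine ⟨6 * (‖(0 : ℂ)‖ₑ + (∫⁻ y, ‖g y‖ₑ) * ENNReal.ofReal (4 / 3)) *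
    eLpNorm (fun x => (-z x : ℝ) * f x) 2 + (∫⁻ y, ‖f y‖ₑ) * K, ?_, fun t => ?_⟩
  · have h1 := h.zf_memLp_neg.2
    have h3 := h.f_int.2
    have h4 := h.g_int.2
    rw [HasFiniteIntegral] at h3 h4
    finiteness
  · have := (h.isVolterra_β t).eLpNorm_shift_sub_le h.f_int h.g_int h.z_cont_neg h.z_exp_neg
      hW.cont_P hW.P_bd (fun y => (hb t y).2) t MeasurableSet.univ
    simp only [Measure.restrict_univ, ← mul_β_eq] at this
    refine this.trans (le_of_eq ?_)
    ring

theorem norm_integral_fβ_le (h : IsWeightedGaugeJost f g z α β) (l : ℂ) :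
    ‖∫ x, f x * β x l‖ ≤ 1 / 2 := by
  have h1 := integral_norm_le_quarter h.f_int h.f_small
  have h2 : ‖∫ x, f x * β x l‖ ≤ ∫ x, ‖f x‖ := by
    refine norm_integral_le_of_norm_le h.f_int.norm (.of_forall fun x => ?_)
    rw [norm_mul]
    exact mul_le_of_le_one_right (norm_nonneg _) ((h.β_bd x l).trans (by norm_num))
  linarith

end IsWeightedGaugeJost

end WKI

namespace WKI

open Filter Topology Set ComplexConjugate ENNReal

/-! ### A criterion for `H¹` in terms of translations -/

/-- Banach–Alaoglu. A cluster point is enough: wherever the pairings converge, the limit must be the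
value of the cluster point. -/
theorem exists_weak_limit {E : Type*} [NormedAddCommGroup E] [InnerProductSpace ℂ E] [CompleteSpace E]
    {u : ℕ → E} {M : ℝ} (hu : ∀ n, ‖u n‖ ≤ M) :
    ∃ w : E, ∀ (φ : E) (L : ℂ), Tendsto (fun n => inner ℂ (u n) φ) atTop (𝓝 L) → inner ℂ w φ = L := by
  obtain ⟨v, -, hv⟩ := (WeakDual.isCompact_closedBall (0 : StrongDual ℂ E) M).exists_mapClusterPt
    (f := atTop) (u := fun n => StrongDual.toWeakDual (InnerProductSpace.toDual ℂ E (u n))) (by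
      rw [le_principal_iff, mem_map]
      refine univ_mem' fun n => ?_
      change InnerProductSpace.toDual ℂ E (u n) ∈ Metric.closedBall 0 M
      rw [mem_closedBall_zero_iff, LinearIsometryEquiv.norm_map]
      exact hu n)
  refine ⟨(InnerProductSpace.toDual ℂ E).symm (WeakDual.toStrongDual v), fun φ L hL => ?_⟩
  rw [InnerProductSpace.toDual_symm_apply]
  have hcl : MapClusterPt (v φ) atTop fun n => inner ℂ (u n) φ :=
    hv.continuousAt_comp (WeakDual.eval_continuous φ).continuousAt
  have := ClusterPt.mono hcl hL
  exact eq_of_nhds_neBot this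

/-- The integral is a convolution of `φ(-·)` with `F`, so the derivative falls on `φ` and `F` need
only be locally integrable. -/
theorem hasDerivAt_integral_smul_shift {φ : ℝ → ℝ} (hφ : ContDiff ℝ 1 φ) (hc : HasCompactSupport φ)
    {F : ℝ → ℂ} (hF : LocallyIntegrable F) :
    HasDerivAt (fun t => ∫ x, φ x • F (x + t)) (-∫ x, deriv φ x • F x) 0 := by
  have h := (hc.comp_homeomorph (Homeomorph.neg ℝ)).hasDerivAt_convolution_left
    (ContinuousLinearMap.lsmul ℝ ℝ) (μ := volume) (hφ.comp contDiff_neg) hF 0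
  have e1 : convolution (φ ∘ Homeomorph.neg ℝ) F (ContinuousLinearMap.lsmul ℝ ℝ) volume =
      fun t => ∫ x, φ x • F (x + t) := by
    funext t
    rw [convolution, ← integral_neg_eq_self]
    congr 1
    funext x
    simp [add_comm]
  have e2 : convolution (deriv (φ ∘ Homeomorph.neg ℝ)) F (ContinuousLinearMap.lsmul ℝ ℝ) volume 0 =
      -∫ x, deriv φ x • F x := by
    rw [convolution, ← integral_neg_eq_self, ← integral_neg]
    congr 1
    funext x
    have : deriv (φ ∘ Homeomorph.neg ℝ) (-x) = -deriv φ x := by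
      have := deriv_comp_neg φ (-x)
      rw [neg_neg] at this
      exact this
    rw [this]
    simp
  rwa [e1, e2] at h

theorem integrable_test_smul_of_memLp {φ : ℝ → ℝ} (hφ : Continuous φ) (hc : HasCompactSupport φ)
    {F : ℝ → ℂ} (hF : MemLp F 2) : Integrable fun x => φ x • F x :=
  (hF.locallyIntegrable one_le_two).integrable_smul_left_of_hasCompactSupport hφ hc

/-- The difference quotients with steps `1/(n + 1)` are bounded by `K` in `L²`. Their pairing with a
test function converges to `-∫ φ' F`, so a weak cluster point is the weak derivative. -/
theorem memH1_of_shift_le {F : ℝ → ℂ} (hF : MemLp F 2) {K : ℝ≥0∞} (hK : K ≠ ⊤)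
    (h : ∀ t, eLpNorm (fun l => F (l + t) - F l) 2 ≤ ENNReal.ofReal |t| * K) : MemH1 F := by
  have hs : ∀ t, MemLp (fun l => F (l + t)) 2 := fun t =>
    hF.comp_measurePreserving (measurePreserving_add_right volume t)
  set ε : ℕ → ℝ := fun n => 1 / ((n : ℝ) + 1) with hε
  have hε0 : ∀ n, 0 < ε n := fun n => Nat.one_div_pos_of_nat
  have hD : ∀ n, MemLp (fun l => (ε n)⁻¹ • (F (l + ε n) - F l)) 2 := fun n =>
    ((hs (ε n)).sub hF).const_smul (ε n)⁻¹
  obtain ⟨w, hw⟩ := exists_weak_limit (u := fun n => (hD n).toLp) (M := K.toReal) fun n => by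
    rw [Lp.norm_toLp]
    refine ENNReal.toReal_mono hK ?_
    have e : (fun l => (ε n)⁻¹ • (F (l + ε n) - F l)) = (ε n)⁻¹ • fun l => F (l + ε n) - F l := rfl
    rw [e, eLpNorm_const_smul]
    refine (mul_le_mul_right (h (ε n)) _).trans (le_of_eq ?_)
    rw [← ofReal_norm, norm_inv, Real.norm_eq_abs, ← mul_assoc, ← ENNReal.ofReal_mul (by positivity),
      inv_mul_cancel₀ (abs_pos.2 (hε0 n).ne').ne', ENNReal.ofReal_one, one_mul]
  refine ⟨hF, w, ⟨hF.locallyIntegrable one_le_two, (Lp.memLp w).locallyIntegrable one_le_two,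
    fun φ hφ hc => ?_⟩, Lp.memLp w⟩
  have hφ2 : MemLp (fun x => (φ x : ℂ)) 2 :=
    (Complex.continuous_ofReal.comp hφ.continuous).memLp_of_hasCompactSupport
      (hc.comp_left (g := fun t : ℝ => (t : ℂ)) Complex.ofReal_zero)
  have inner_eq : ∀ (G : ℝ → ℂ) (v : Lp ℂ 2), v =ᵐ[volume] G →
      inner ℂ v hφ2.toLp = conj (∫ x, φ x • G x) := fun G v hv => by
    rw [L2.inner_def, ← integral_conj]
    refine integral_congr_ae ?_
    filter_upwards [hv, hφ2.coeFn_toLp] with x h1 h2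
    rw [h1, h2, RCLike.inner_apply, Complex.real_smul, map_mul, Complex.conj_ofReal]
  have hder := hasDerivAt_iff_tendsto_slope_zero.1
    (hasDerivAt_integral_smul_shift (hφ.of_le (by simp)) hc (hF.locallyIntegrable one_le_two))
  have hε' : Tendsto ε atTop (𝓝[≠] 0) := tendsto_nhdsWithin_iff.2
    ⟨tendsto_one_div_add_atTop_nhds_zero_nat, .of_forall fun n => (hε0 n).ne'⟩
  have hlim := (Complex.continuous_conj.tendsto _).comp (hder.comp hε')
  have key := hw hφ2.toLp _ (hlim.congr fun n => by
    rw [inner_eq _ _ (hD n).coeFn_toLp]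
    simp only [Function.comp_apply, zero_add, add_zero]
    congr 1
    rw [← integral_sub (integrable_test_smul_of_memLp hφ.continuous hc (hs _))
      (integrable_test_smul_of_memLp hφ.continuous hc hF), ← integral_smul]
    congr 1
    funext x
    simp only [Complex.real_smul]
    ring)
  rw [inner_eq w w (ae_eq_refl _)] at key
  have := (starRingEnd ℂ).injective key
  rw [this, iteratedDeriv_one]
  ring

theorem eLpNorm_mul_le {F G : ℝ → ℂ} {C : ℝ≥0∞} {c : ℝ} (hc : ∀ l, ‖F l‖ ≤ c)
    (hG : eLpNorm G 2 ≤ C) : eLpNorm (fun l => F l * G l) 2 ≤ ENNReal.ofReal c * C :=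
  (eLpNorm_le_mul_eLpNorm_of_ae_le_mul (g := G) (.of_forall fun l => (norm_mul _ _).trans_le
    (mul_le_mul_of_nonneg_right (hc l) (norm_nonneg _))) 2).trans (by gcongr)

theorem memH1_div {J A : ℝ → ℂ} {K L : ℝ≥0∞} {c : ℝ} (hJ : MemLp J 2) (hA : AEStronglyMeasurable A)
    (hJb : ∀ l, ‖J l‖ ≤ c) (hAb : ∀ l, 1 / 2 ≤ ‖A l‖) (hK : K ≠ ⊤) (hL : L ≠ ⊤)
    (hJs : ∀ t, eLpNorm (fun l => J (l + t) - J l) 2 ≤ ENNReal.ofReal |t| * K)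
    (hAs : ∀ t, eLpNorm (fun l => A (l + t) - A l) 2 ≤ ENNReal.ofReal |t| * L) :
    MemH1 fun l => J l / A l := by
  have hAi : ∀ l, ‖(A l)⁻¹‖ ≤ 2 := fun l => by
    rw [norm_inv]
    exact (inv_anti₀ (by norm_num) (hAb l)).trans (by norm_num)
  have hA0 : ∀ l, A l ≠ 0 := fun l h0 => by
    have := hAb l
    rw [h0, norm_zero] at this
    norm_num at this
  have hc : 0 ≤ c := (norm_nonneg _).trans (hJb 0)
  have hAm : AEStronglyMeasurable fun l => (A l)⁻¹ := hA.aemeasurable.inv.aestronglyMeasurable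
  have hsh := fun t => measurePreserving_add_right (volume : Measure ℝ) t
  refine memH1_of_shift_le (K := 2 * K + ENNReal.ofReal (2 * c * 2) * L) ?_ (by finiteness) fun t => ?_
  · simp only [div_eq_inv_mul]
    refine ⟨hAm.mul hJ.1, (eLpNorm_mul_le hAi le_rfl).trans_lt ?_⟩
    have := hJ.2
    finiteness
  · have hAt : AEStronglyMeasurable fun l => (A (l + t))⁻¹ := hAm.comp_measurePreserving (hsh t)
    have hJt : AEStronglyMeasurable fun l => J (l + t) := hJ.1.comp_measurePreserving (hsh t)
    have hAt' : AEStronglyMeasurable fun l => A (l + t) := hA.comp_measurePreserving (hsh t)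
    -- The discrete quotient rule; all factors besides the two differences are bounded.
    have e : (fun l => J (l + t) / A (l + t) - J l / A l) =
        (fun l => (A (l + t))⁻¹ * (J (l + t) - J l)) -
          fun l => ((A (l + t))⁻¹ * J l * (A l)⁻¹) * (A (l + t) - A l) := by
      funext l
      have h1 := hA0 l
      have h2 := hA0 (l + t)
      simp only [Pi.sub_apply]
      field_simp
      ring
    rw [e]
    refine (eLpNorm_sub_le (hAt.mul (hJt.sub hJ.1)) (((hAt.mul hJ.1).mul hAm).mul (hAt'.sub hA))
      one_le_two).trans ?_
    rw [mul_add, mul_left_comm, mul_left_comm (ENNReal.ofReal |t|)]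
    refine add_le_add ?_ ?_
    · refine (eLpNorm_mul_le (fun l => hAi (l + t)) (hJs t)).trans (le_of_eq ?_)
      rw [ENNReal.ofReal_ofNat]
    · refine eLpNorm_mul_le (fun l => ?_) (hAs t)
      change ‖(A (l + t))⁻¹ * J l * (A l)⁻¹‖ ≤ 2 * c * 2
      rw [norm_mul, norm_mul]
      gcongr
      exacts [hAi _, hJb l, hAi l]

end WKI

namespace WKI

open Filter Topology Set ComplexConjugate ENNReal

/-! ### Powers of `λ` times the scattering integrals -/

section Recursion

variable {q : ℝ → ℂ} {α β : ℝ → ℂ → ℂ} {y y' K φ : ℝ → ℂ}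

/-- Integration by parts in a scattering integral. -/
theorem Gauge.mul_integral_osc (G : Gauge q) (h : IsWeightedGaugeJost G.f G.g G.z α β)
    (hy : HasPrim y y') (hy' : Integrable y') (hpy : Integrable fun x => G.p x * y x)
    (hyt : Tendsto y atTop (𝓝 0)) (hyb : Tendsto y atBot (𝓝 0))
    (hK : HasPrim K fun x => y x * G.f x) {C : ℝ} (hKC : ∀ x, ‖K x‖ ≤ C)
    (hKb : Tendsto K atBot (𝓝 0)) (l : ℝ) :
    l * ∫ x, osc G.z x l * (G.p x * y x * α x l) =
      ∫ x, osc G.z x l * (Complex.I / 2 * (y' x - G.g x * K x) * α x l) := by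
  have hl : 0 ≤ (l : ℂ).im := (Complex.ofReal_im l).ge
  have hγ : HasPrim (fun x => osc G.z x l) _ := G.hasPrim_cexp_z (2 * Complex.I * l)
  have hα := h.hasPrim_α G.f_int hl
  have hβ := G.hasPrim_β h.toIsGaugeJost hl
  have hαc := h.cont_α.comp (by fun_prop : Continuous fun p : ℝ × ℝ => (p.1, (p.2 : ℂ)))
  have i1 : Integrable fun x => osc G.z x l * (G.p x * y x * α x l) :=
    integrable_osc_mul (R := fun x l => α x l) hpy G.continuous_z hαc (fun x l => h.α_norm x l) l
  have hgK : Integrable fun x => G.g x * K x :=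
    G.g_int.mul_bdd hK.continuous.aestronglyMeasurable (.of_forall hKC)
  have i2 : Integrable fun x => osc G.z x l * (Complex.I / 2 * (y' x - G.g x * K x) * α x l) :=
    integrable_osc_mul (R := fun x l => α x l) ((hy'.sub hgK).const_mul _) G.continuous_z hαc
      (fun x l => h.α_norm x l) l
  -- With `γ = e^{2iλz}`, the derivative of `γyα` contains the unwanted term `γyfβ`. Subtracting
  -- `Kγβ` cancels it, since `K' = yf`, and `(γβ)' = γgα` has no factor `λ`.
  have hV := ((hγ.mul (hy.mul hα)).sub (hK.mul (hγ.mul hβ))).congr'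
    (g := fun x => 2 * Complex.I * (l * (osc G.z x l * (G.p x * y x * α x l)) -
      osc G.z x l * (Complex.I / 2 * (y' x - G.g x * K x) * α x l))) fun x => by
    simp only [osc]
    linear_combination (Complex.exp (2 * Complex.I * l * G.z x) * (y' x - G.g x * K x) * α x l) *
      Complex.I_sq
  have bd : ∀ {L : Filter ℝ} {u v : ℝ → ℂ} {B : ℝ}, Tendsto u L (𝓝 0) → (∀ x, ‖v x‖ ≤ B) →
      Tendsto (fun x => u x * v x) L (𝓝 0) := fun {L u v B} hu hv => by
    refine squeeze_zero_norm (a := fun x => ‖u x‖ * B) (fun x => ?_) (by simpa using hu.norm.mul_const B)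
    rw [norm_mul]
    gcongr
    exact hv x
  have b1 : ∀ x, ‖osc G.z x l * α x l‖ ≤ 4 / 3 := fun x => by
    rw [norm_mul, norm_osc, one_mul]
    exact h.α_norm x l
  have b2 : ∀ x, ‖osc G.z x l * β x l‖ ≤ 1 / 3 := fun x => by
    rw [norm_mul, norm_osc, one_mul]
    exact h.β_bd x l
  have b3 : ∀ x, ‖osc G.z x l * K x‖ ≤ C := fun x => by
    rw [norm_mul, norm_osc, one_mul]
    exact hKC x
  have t : ∀ {L : Filter ℝ}, Tendsto y L (𝓝 0) → Tendsto (fun x => K x * (osc G.z x l * β x l)) L (𝓝 0) →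
      Tendsto (fun x => osc G.z x l * (y x * α x l) - K x * (osc G.z x l * β x l)) L (𝓝 0) :=
    fun {L} h1 h2 => by
    have := ((bd h1 b1).congr fun x => mul_left_comm _ _ _).sub h2
    rwa [sub_zero] at this
  -- The term with `y` vanishes at both ends; the other vanishes at `+∞` because of `β` and at `-∞`
  -- because of `K`.
  have key := hV.integral_eq_sub (((i1.const_mul _).sub i2).const_mul _)
    (t hyt ((bd (h.tendsto_β G.g_int G.monotone_z hl) b3).congr fun x => by ring))
    (t hyb (bd hKb b2))
  rw [integral_const_mul, integral_sub (i1.const_mul _) i2, integral_const_mul, sub_zero] at key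
  have : 2 * Complex.I ≠ 0 := by simp
  exact sub_eq_zero.1 ((mul_eq_zero.1 key).resolve_left this)

theorem Gauge.p_ne_zero (G : Gauge q) (x : ℝ) : (G.p x : ℂ) ≠ 0 :=
  Complex.ofReal_ne_zero.2 (zero_lt_one.trans_le (G.one_le_p x)).ne'

/-- Integration by parts with `y = φ/p`. The new amplitude `(i/2)(y' - gK)` has one derivative less;
`K` does not decay at `+∞`, but it is bounded with derivative in the weighted class, so `gK` stays
weighted. -/
theorem Gauge.exists_mul_integral_osc (G : Gauge q) (h : IsWeightedGaugeJost G.f G.g G.z α β) {k : ℕ}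
    (hp : MemB (k + 1) fun x => ((G.p x)⁻¹ : ℂ)) (hf : MemW k G.f) (hg : MemW k G.g)
    (hφ : MemW (k + 1) φ) : ∃ ψ, MemW k ψ ∧ ∀ l : ℝ, l * ∫ x, osc G.z x l * (φ x * α x l) =
      ∫ x, osc G.z x l * (ψ x * α x l) := by
  have hy := hp.mul_memW hφ
  obtain ⟨-, y', hyy, hy'⟩ := id hy
  have hyf := hy.mul hf
  have hK := HasPrim.of_integral_Iic hyf.integrable
  obtain ⟨C, hC⟩ := hK.bounded hyf.integrable
  have hKB : MemB (k + 1) fun x => ∫ t in Iic x, (G.p t : ℂ)⁻¹ * φ t * G.f t :=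
    ⟨⟨C, hC⟩, _, hK, hyf⟩
  have e : ∀ x, G.p x * ((G.p x : ℂ)⁻¹ * φ x) = φ x := fun x => mul_inv_cancel_left₀ (G.p_ne_zero x) _
  obtain ⟨ht, hb⟩ := hy.tendsto_zero
  refine ⟨_, ((hy'.add ((hKB.of_succ.mul_memW hg).const_mul (-1))).const_mul (Complex.I / 2)),
    fun l => ?_⟩
  have := G.mul_integral_osc h hyy hy'.integrable (by simpa only [e] using hφ.integrable) ht hb hK hC
    (tendsto_integral_Iic_atBot hyf.integrable) l
  simp only [e] at this
  rw [this]
  congr 1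
  funext x
  ring

/-- For `y = 2iρE` the primitive is explicit: `K = -2i (conj E - 1)`, which vanishes at `-∞` by the
normalisation of `E`. Since `g conj E = -sE`, one gets `y' - gK = -2ig`, so the new amplitude is
exactly `g`. -/
theorem Gauge.mul_integral_osc_ρ (G : Gauge q) (h : IsWeightedGaugeJost G.f G.g G.z α β)
    (hE : Tendsto G.E atBot (𝓝 1)) {k : ℕ}
    (hp : MemB (k + 1) fun x => ((G.p x)⁻¹ : ℂ))
    (hφ : MemW (k + 1) fun x => 2 * Complex.I * G.p x * G.ρ x * G.E x) (l : ℝ) :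
    l * ∫ x, osc G.z x l * (2 * Complex.I * G.p x * G.ρ x * G.E x * α x l) =
      ∫ x, osc G.z x l * (G.g x * α x l) := by
  have hy := (hp.mul_memW hφ).congr_fun (g := fun x => 2 * Complex.I * (G.ρ x * G.E x)) fun x => by
    have := G.p_ne_zero x
    field_simp
  obtain ⟨-, y', hyy, hy'⟩ := id hy
  have hyy' := G.hasPrim_ρE.const_mul (2 * Complex.I)
  have ey := hyy.ae_unique hyy'
  obtain ⟨ht, hb⟩ := hy.tendsto_zero
  obtain ⟨C, hC⟩ := G.E_bdd
  have hK : HasPrim (fun x => -(2 * Complex.I) * (conj (G.E x) - 1))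
      (fun x => 2 * Complex.I * (G.ρ x * G.E x) * G.f x) := by
    refine ((G.hasPrim_E.conjugate.sub (.const 1)).const_mul (-(2 * Complex.I))).congr' fun x => ?_
    simp only [map_mul, map_neg, Complex.conj_conj]
    linear_combination (-(2 * Complex.I * G.ρ x)) * G.f_mul x
  have hEc : Tendsto (fun x => -(2 * Complex.I) * (conj (G.E x) - 1)) atBot (𝓝 0) := by
    have := (((Complex.continuous_conj.tendsto _).comp hE).sub_const 1).const_mul (-(2 * Complex.I))
    simpa using this
  have e : ∀ x, G.p x * (2 * Complex.I * (G.ρ x * G.E x)) = 2 * Complex.I * G.p x * G.ρ x * G.E x :=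
    fun x => by ring
  have := G.mul_integral_osc h hyy' (hy'.integrable.congr ey) (by simpa only [e] using hφ.integrable)
    ht hb hK (C := 2 * (C + 1)) (fun x => ?_) hEc l
  · simp only [e] at this
    rw [this]
    congr 1
    funext x
    linear_combination (osc G.z x l * α x l) * ((G.s x * G.E x + G.g x * conj (G.E x) - G.g x) *
      Complex.I_sq - G.g_mul x)
  · rw [norm_mul, norm_neg, norm_mul, Complex.norm_I, mul_one, RCLike.norm_ofNat]
    gcongr
    refine (norm_sub_le _ _).trans ?_
    rw [norm_one, RCLike.norm_conj]
    gcongr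
    exact hC x

theorem Gauge.exists_pow_mul_integral_osc (G : Gauge q) (h : IsWeightedGaugeJost G.f G.g G.z α β)
    {n : ℕ} (hp : MemB (n + 1) fun x => ((G.p x)⁻¹ : ℂ)) (hf : MemW n G.f) (hg : MemW n G.g) :
    ∀ {j : ℕ}, j ≤ n → ∃ ψ, MemW (n - j) ψ ∧ ∀ l : ℝ, (l : ℂ) ^ j *
      ∫ x, osc G.z x l * (G.g x * α x l) = ∫ x, osc G.z x l * (ψ x * α x l)
  | 0, _ => ⟨G.g, hg, fun l => by rw [pow_zero, one_mul]⟩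
  | j + 1, hj => by
    obtain ⟨ψ, hψ, e⟩ := G.exists_pow_mul_integral_osc h hp hf hg (j := j) (by omega)
    have ek : n - j = n - (j + 1) + 1 := by omega
    rw [ek] at hψ
    obtain ⟨ψ', hψ', e'⟩ := G.exists_mul_integral_osc h (k := n - (j + 1)) (hp.mono (by omega))
      (hf.mono (by omega)) (hg.mono (by omega)) hψ
    exact ⟨ψ', hψ', fun l => by rw [pow_succ', mul_assoc, e, e']⟩

end Recursion

end WKI

namespace WKI

open Filter Topology Set ComplexConjugate ENNReal

/-! ### The main theorem -/

theorem MemH1.congr {F F' : ℝ → ℂ} (h : MemH1 F) (he : F =ᵐ[volume] F') : MemH1 F' := by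
  obtain ⟨h2, g, ⟨h3, h4, h5⟩, h6⟩ := h
  refine ⟨(memLp_congr_ae he).1 h2, g, ⟨h3.congr he, h4, fun φ hφ hc => ?_⟩, h6⟩
  rw [← h5 φ hφ hc]
  refine integral_congr_ae ?_
  filter_upwards [he] with x hx
  rw [hx]

variable {q φ : ℝ → ℂ} {α β : ℝ → ℂ → ℂ}

/-- As `z - x` is bounded, the weight `z` costs no more than the weights `x` and `1`. -/
theorem Gauge.memLp_z_mul (G : Gauge q) {k : ℕ} (hφ : MemW k φ) : MemLp (fun x => G.z x * φ x) 2 := by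
  obtain ⟨C, hC⟩ := G.z_bdd
  have h1 : MemLp (fun x => ((G.z x - x : ℝ) : ℂ) * φ x) 2 := by
    have hz := G.continuous_z
    refine MemLp.of_le_mul (c := C) hφ.memLp
      ((by fun_prop : Continuous fun x => ((G.z x - x : ℝ) : ℂ)).aestronglyMeasurable.mul
        hφ.integrable.1) (.of_forall fun x => ?_)
    rw [norm_mul, Complex.norm_real]
    gcongr
    exact hC x
  refine (h1.add hφ.memLp_mul).ae_eq (.of_forall fun x => ?_)
  simp only [Pi.add_apply]
  push_cast
  ring

theorem Gauge.abs_sub_le (G : Gauge q) (x y : ℝ) : |x - y| ≤ |G.z x - G.z y| := by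
  rcases le_total x y with h | h
  · rw [abs_sub_comm, abs_sub_comm (G.z x), abs_of_nonneg (sub_nonneg.2 h)]
    exact (G.sub_le_z_sub h).trans (le_abs_self _)
  · rw [abs_of_nonneg (sub_nonneg.2 h)]
    exact (G.sub_le_z_sub h).trans (le_abs_self _)

theorem Gauge.isWeightedGaugeJost (G : Gauge q) {k : ℕ} (hf : MemW k G.f) (hg : MemW k G.g)
    (h : IsGaugeJost G.f G.g G.z α β) (hf4 : ∫⁻ x, ‖G.f x‖ₑ ≤ 4⁻¹) (hg4 : ∫⁻ x, ‖G.g x‖ₑ ≤ 4⁻¹) :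
    IsWeightedGaugeJost G.f G.g G.z α β where
  toIsGaugeJost := h
  f_int := G.f_int
  g_int := G.g_int
  f_memLp := hf.memLp
  g_memLp := hg.memLp
  zf_memLp := G.memLp_z_mul hf
  zg_memLp := G.memLp_z_mul hg
  f_small := hf4
  g_small := hg4
  z_cont := G.continuous_z
  z_exp := G.abs_sub_le

theorem IsWeightedGaugeJost.half_le_norm {f g : ℝ → ℂ} {z : ℝ → ℝ}
    (h : IsWeightedGaugeJost f g z α β) (l : ℂ) : 1 / 2 ≤ ‖1 - ∫ x, f x * β x l‖ := by
  have := norm_sub_norm_le 1 (∫ x, f x * β x l)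
  rw [norm_one] at this
  linarith [h.norm_integral_fβ_le l]

theorem Gauge.memH1_div (G : Gauge q) (h : IsWeightedGaugeJost G.f G.g G.z α β) {k : ℕ}
    (hφ : MemW k φ) : MemH1 fun l : ℝ =>
      (∫ x, osc G.z x l * (φ x * α x l)) / (1 - ∫ x, G.f x * β x l) := by
  obtain ⟨K, hK, hKs⟩ := h.exists_shift_integral_osc_α_le hφ.integrable (G.memLp_z_mul hφ)
  obtain ⟨L, hL, hLs⟩ := h.exists_shift_integral_fβ_le
  have hβ := (h.continuous_shift_β 0).measurable
  simp only [add_zero] at hβ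
  refine WKI.memH1_div (h.memLp_integral_osc_α hφ.integrable hφ.memLp)
    (aestronglyMeasurable_const.sub
      (aestronglyMeasurable_integral_mul (D := fun x l : ℝ => β x l) G.f_int.1 hβ))
    (fun l => h.norm_integral_osc_α_le hφ.integrable l) (fun l => h.half_le_norm l) hK hL
    (fun t => by simpa using hKs t) fun t => ?_
  refine le_trans (le_of_eq ?_) (hLs t)
  rw [← eLpNorm_neg]
  congr 1
  funext l
  simp only [Pi.neg_apply]
  ring

theorem scattering_of_small {n : ℕ} {Q Q' : ℝ → ℂ} (hp : HasPrim Q Q') (hQ : MemW (n + 1) Q)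
    (hQ' : MemW n Q') (hs : ∫⁻ x, ‖Q' x‖ₑ ≤ 4⁻¹) :
    (∀ l : ℂ, 0 ≤ l.im → scatteringA Q l ≠ 0) ∧
      MemH1 (fun l : ℝ => (l : ℂ)⁻¹ * (scatteringB Q l / scatteringA Q l)) ∧
      ∀ j ≤ n, MemH1 (fun l : ℝ => (l : ℂ) ^ j * (scatteringB Q l / scatteringA Q l)) := by
  obtain ⟨G, hE, hz, hf, hg, hfW, hgW, hpB, hφ⟩ := exists_gauge hp hQ hQ'
  have hf4 : ∫⁻ x, ‖G.f x‖ₑ ≤ 4⁻¹ :=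
    (lintegral_mono fun x => enorm_le_iff_norm_le.2 (hf x)).trans hs
  have hg4 : ∫⁻ x, ‖G.g x‖ₑ ≤ 4⁻¹ :=
    (lintegral_mono fun x => enorm_le_iff_norm_le.2 (hg x)).trans hs
  obtain ⟨α, β, hJ⟩ := exists_isGaugeJost G.f_int G.g_int (integral_norm_le_quarter G.f_int hf4)
    (integral_norm_le_quarter G.g_int hg4) G.continuous_z G.monotone_z
  -- Reflection exchanges `f` and `g` up to sign, so the smallness carries over.
  have hf4' : ∫⁻ x, ‖G.reflect.f x‖ₑ ≤ 4⁻¹ := by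
    refine le_trans (le_of_eq ?_) hg4
    rw [← lintegral_neg_eq_self]
    simp [Gauge.reflect]
  have hg4' : ∫⁻ x, ‖G.reflect.g x‖ₑ ≤ 4⁻¹ := by
    refine le_trans (le_of_eq ?_) hf4
    rw [← lintegral_neg_eq_self]
    simp [Gauge.reflect]
  obtain ⟨α', β', hJ'⟩ := exists_isGaugeJost G.reflect.f_int G.reflect.g_int
    (integral_norm_le_quarter G.reflect.f_int hf4') (integral_norm_le_quarter G.reflect.g_int hg4')
    G.reflect.continuous_z G.reflect.monotone_z
  have hW := G.isWeightedGaugeJost hfW hgW hJ hf4 hg4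
  have hA0 : ∀ l : ℂ, 1 - ∫ x, G.f x * β x l ≠ 0 := fun l h0 => by
    have := hW.half_le_norm l
    rw [h0, norm_zero] at this
    norm_num at this
  have hreal : ∀ l : ℂ, l.im = 0 → scatteringA Q l = scatteringMatrix Q l.re 0 0 := fun l hl => by
    rw [scatteringA, if_pos hl]
  -- The normalising factor `κ`, which depends on `l`, cancels in the quotient.
  have hBA : ∀ l : ℝ, scatteringB Q l / scatteringA Q l =
      -((∫ x, osc G.z x l * (G.g x * α x l)) / (1 - ∫ x, G.f x * β x l)) := fun l => by
    obtain ⟨κ, hκ, ha, hb⟩ := G.scatteringMatrix_eq hE hz hJ hJ' l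
    rw [hreal _ (Complex.ofReal_im l), Complex.ofReal_re, scatteringB, ha, hb,
      mul_div_mul_left _ _ hκ, neg_div]
    rfl
  refine ⟨fun l hl => ?_, ?_, fun j hj => ?_⟩
  · rcases hl.eq_or_lt with h0 | h0
    · obtain ⟨κ, hκ, ha, -⟩ := G.scatteringMatrix_eq hE hz hJ hJ' l.re
      rw [hreal l h0.symm, ha]
      exact mul_ne_zero hκ (hA0 _)
    · exact G.scatteringA_ne_zero hJ hJ' h0
  · refine (G.memH1_div hW (hφ.const_mul (-1))).congr ?_
    -- At `l = 0` the convention `0⁻¹ = 0` breaks the identity, but this point is a null set.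
    have : ∀ᵐ l : ℝ, l ≠ 0 := by simp [ae_iff, measure_singleton]
    filter_upwards [this] with l hl
    have e : ∀ x, osc G.z x l * (-1 * (2 * Complex.I * G.p x * G.ρ x * G.E x) * α x l) =
        -1 * (osc G.z x l * (2 * Complex.I * G.p x * G.ρ x * G.E x * α x l)) := fun x => by ring
    simp only [e]
    rw [integral_const_mul, hBA, ← G.mul_integral_osc_ρ hW hE hpB hφ]
    have hl' : (l : ℂ) ≠ 0 := Complex.ofReal_ne_zero.2 hl
    rw [mul_neg, ← mul_div_assoc, inv_mul_cancel_left₀ hl', neg_one_mul, neg_div]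
  · obtain ⟨ψ, hψ, e⟩ := G.exists_pow_mul_integral_osc hW hpB hfW hgW hj
    refine (G.memH1_div hW (hψ.const_mul (-1))).congr (.of_forall fun l => ?_)
    have e' : ∀ x, osc G.z x l * (-1 * ψ x * α x l) = -1 * (osc G.z x l * (ψ x * α x l)) :=
      fun x => by ring
    simp only [e']
    rw [integral_const_mul, hBA, ← e]
    ring

end WKI

theorem mainTheorem2 :
    ∃ δ : ℝ, 0 < δ ∧ ∀ (n : ℕ) (q : ℝ → ℂ), WKI.MemX (n + 1) q →
      WKI.normX 1 q < ENNReal.ofReal δ →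
        (∀ l : ℂ, 0 ≤ l.im → WKI.scatteringA q l ≠ 0) ∧
        WKI.MemH1 (fun l : ℝ => (l : ℂ)⁻¹ * (WKI.scatteringB q l / WKI.scatteringA q l)) ∧
        ∀ j ≤ n,
          WKI.MemH1 (fun l : ℝ => (l : ℂ) ^ j * (WKI.scatteringB q l / WKI.scatteringA q l)) := by
  set N : ENNReal := eLpNorm (fun x => (WKI.bracket x)⁻¹) 2 with hN
  have hNtop : N ≠ ⊤ := WKI.memLp_inv_bracket.2.ne
  have hpos : 0 < 4 * (N.toReal + 1) := by positivity
  -- Chosen so that `N δ ≤ 1/4`; adding `1` avoids having to know that `N` is positive.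
  refine ⟨(4 * (N.toReal + 1))⁻¹, inv_pos.2 hpos, fun n q hq hn => ?_⟩
  obtain ⟨Q, Q', hQq, hp, hQ, hQ', hs⟩ := hq.exists_memW
  obtain ⟨ha, hb⟩ := WKI.scattering_congr hQq
  rw [← ha, ← hb]
  refine WKI.scattering_of_small hp hQ hQ' (hs.trans ((mul_le_mul_right hn.le N).trans ?_))
  rw [← ENNReal.ofReal_toReal hNtop, ← ENNReal.ofReal_mul ENNReal.toReal_nonneg,
    ← ENNReal.ofReal_ofNat, ← ENNReal.ofReal_inv_of_pos (by norm_num)]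
  refine ENNReal.ofReal_le_ofReal ?_
  rw [ENNReal.toReal_ofReal ENNReal.toReal_nonneg, mul_inv, mul_left_comm]
  refine mul_le_of_le_one_right (by norm_num) ?_
  rw [← div_eq_mul_inv, div_le_one (by positivity)]
  linarith
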